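/- Let $\mathfrak{sl}_4$ be the Lie algebra of traceless complex $4\times 4$ matrices, and let $Red(4)$ be the variety of reductions: the Zariski closure, with its reduced structure, of the set of Cartan subalgebras of $\mathfrak{sl}_4$ in the Grassmannian $G(3,\mathfrak{sl}_4)$ of three-dimensional subspaces. The group $PGL_4$ acts on $G(3,\mathfrak{sl}_4)$ by conjugation and preserves $Red(4)$. For a subspace $L\subset\mathbb{C}^4$ let $\mathfrak{a}(L)=\{X\in\mathfrak{sl}_4 : X(\mathbb{C}^4)\subseteq L,\ X(L)=0\}$; put $\mathcal{O}'_{min}=\{\mathfrak{a}(L) : \dim L=1\}$ and $\mathcal{O}''_{min}=\{\mathfrak{a}(L) : \dim L=3\}$. Let $\mathcal{O}_6$ be the $PGL_4$-orbit of the algebra of the matrices $\begin{pmatrix} 0&0&a&b\\ 0&0&0&c\\ 0&0&0&0\\ 0&0&0&0\end{pmatrix}$, $a,b,c\in\mathbb{C}$. Then the singular locus of $Red(4)$ is exactly the disjoint union $\mathcal{O}'_{min}\sqcup\mathcal{O}''_{min}$. Here $\mathcal{O}'_{min}$ and $\mathcal{O}''_{min}$ are single $PGL_4$-orbits, and $L\mapsto\mathfrak{a}(L)$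 is a $PGL_4$-equivariant bijection from the projective space $\mathbb{P}^3$ of lines in $\mathbb{C}^4$ to $\mathcal{O}'_{min}$ and from the dual projective space $\check{\mathbb{P}}^3$ of hyperplanes in $\mathbb{C}^4$ to $\mathcal{O}''_{min}$. Moreover, $\mathcal{O}_6$ is contained in the smooth locus of $Red(4)$, and $\mathcal{O}_6$ is contained in the Zariski closure of every $PGL_4$-orbit in $Red(4)$ other than $\mathcal{O}'_{min}$ and $\mathcal{O}''_{min}$. -/

import Mathlib

open scoped Matrix

noncomputable section

namespace Reductions

/-! ## Grassmannians of subspaces and their Zariski topology -/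

section Grassmannian

variable {V V' : Type*} [AddCommGroup V] [Module ℂ V] [AddCommGroup V'] [Module ℂ V']

/-- The Grassmannian of `k`-dimensional linear subspaces of the complex vector space `V`. -/
def Gr (k : ℕ) (V : Type*) [AddCommGroup V] [Module ℂ V] : Type _ :=
  {W : Submodule ℂ V // Module.finrank ℂ W = k}

/-- The image of a `k`-dimensional subspace under a linear isomorphism. -/
def Gr.map {k : ℕ} (e : V ≃ₗ[ℂ] V') (W : Gr k V) : Gr k V' :=
  ⟨W.1.map (e : V →ₗ[ℂ] V'), by rw [LinearEquiv.finrank_map_eq, W.2]⟩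

/-- A linear form on `Λ^k V` is the same as an alternating `k`-linear form on `V`; the Plücker
coordinates of `W` are the values of all these forms at `w₁ ∧ ⋯ ∧ w_k` for `w₁, …, w_k` in `W`.
So this is the zero locus in the Grassmannian of a homogeneous polynomial in the Plücker
coordinates. -/
def zeroLocus {k : ℕ} (P : MvPolynomial (V [⋀^Fin k]→ₗ[ℂ] ℂ) ℂ) : Set (Gr k V) :=
  {W | ∀ w : Fin k → V, (∀ i, w i ∈ W.1) →
    MvPolynomial.eval (fun ω : V [⋀^Fin k]→ₗ[ℂ] ℂ => ω w) P = 0}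

/-- The Zariski topology of the Grassmannian as a projective variety (through the Plücker
embedding): its closed sets are generated by the zero loci of the homogeneous polynomials in the
Plücker coordinates. -/
instance zariskiTopology (k : ℕ) : TopologicalSpace (Gr k V) :=
  TopologicalSpace.generateFrom
    {U | ∃ (d : ℕ) (P : MvPolynomial (V [⋀^Fin k]→ₗ[ℂ] ℂ) ℂ),
      P.IsHomogeneous d ∧ U = (zeroLocus P)ᶜ}

end Grassmannian

/-! ## Local rings of affine sets -/

section LocalRing

variable {E : Type*} [AddCommGroup E] [Module ℂ E]

/-- The ring of polynomial functions on a subset `Z` of the vector space `E`: the algebra of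
functions on `Z` generated by the restrictions of the linear forms (this is the polynomial ring
of `E` modulo the ideal of the polynomials that vanish on `Z`). -/
def coordinateRing (Z : Set E) : Subalgebra ℂ (Z → ℂ) :=
  Algebra.adjoin ℂ (Set.range fun (f : Module.Dual ℂ E) (z : Z) => f z)

/-- Evaluation of polynomial functions at a point. -/
def evalAt (Z : Set E) (z : Z) : coordinateRing Z →+* ℂ :=
  (Pi.evalRingHom (fun _ : Z => ℂ) z).comp (coordinateRing Z).subtype

instance evalAt_ker_isPrime (Z : Set E) (z : Z) : (RingHom.ker (evalAt Z z)).IsPrime :=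
  RingHom.ker_isPrime _

/-- The local ring at the point `z` of the (reduced) affine variety `Z`: the localization of the
coordinate ring at the maximal ideal of the functions that vanish at `z`. -/
abbrev localRing (Z : Set E) (z : Z) : Type _ :=
  Localization.AtPrime (RingHom.ker (evalAt Z z))

end LocalRing

/-! ## Regular and singular points of subvarieties of a Grassmannian -/

section Singular

variable {V : Type*} [AddCommGroup V] [Module ℂ V] {k : ℕ}

/-- The graph `{w + φ w | w ∈ W}` of a linear map between two subspaces of `V`. For `W'` a
complement of `W`, `φ ↦ graph φ` identifies `Hom(W, W')` with the standard affine open subset of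
the Grassmannian of the subspaces complementary to `W'`, and `0` with the point `W`. -/
def graph {W W' : Submodule ℂ V} (φ : W →ₗ[ℂ] W') : Submodule ℂ V :=
  LinearMap.range (W.subtype + W'.subtype ∘ₗ φ)

/-- The part of `X` in that affine open subset, in the affine coordinates `Hom(W, W')`. -/
def chartSet (X : Set (Gr k V)) (W W' : Submodule ℂ V) : Set (W →ₗ[ℂ] W') :=
  {φ | ∃ U ∈ X, U.1 = graph φ}

theorem zero_mem_chartSet {X : Set (Gr k V)} {W : Gr k V} (hW : W ∈ X) (W' : Submodule ℂ V) :
    (0 : W.1 →ₗ[ℂ] W') ∈ chartSet X W.1 W' :=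
  ⟨W, hW, by simp [graph]⟩

/-- `W` is a regular point of the closed subset `X` (a reduced projective variety) of the
Grassmannian: the local ring of `X` at `W`, computed in the affine charts of the Grassmannian
centred at `W`, is a regular local ring. -/
def IsRegularPoint (X : Set (Gr k V)) (W : Gr k V) (hW : W ∈ X) : Prop :=
  ∀ W' : Submodule ℂ V, IsCompl W.1 W' →
    IsRegularLocalRing (localRing (chartSet X W.1 W') ⟨0, zero_mem_chartSet hW W'⟩)

/-- The set of regular points of `X`. -/
def regularLocus (X : Set (Gr k V)) : Set (Gr k V) :=
  {W | ∃ hW : W ∈ X, IsRegularPoint X W hW}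

/-- The set of singular, that is non-regular, points of `X`. -/
def singularLocus (X : Set (Gr k V)) : Set (Gr k V) :=
  {W | ∃ hW : W ∈ X, ¬ IsRegularPoint X W hW}

end Singular

/-! ## The variety of reductions and the action of the linear group -/

/-- The Lie algebra of traceless complex `4 × 4` matrices. -/
abbrev sl4 : Type := LieAlgebra.SpecialLinear.sl (Fin 4) ℂ

theorem mem_sl4 {X : Matrix (Fin 4) (Fin 4) ℂ} :
    X ∈ LieAlgebra.SpecialLinear.sl (Fin 4) ℂ ↔ X.trace = 0 :=
  Iff.rfl

/-- The set of the Cartan subalgebras of `sl₄` of dimension three (all of them have this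
dimension). -/
def red4Open : Set (Gr 3 sl4) :=
  {W | ∃ H : LieSubalgebra ℂ sl4, H.IsCartanSubalgebra ∧ H.toSubmodule = W.1}

/-- The variety of reductions for `sl₄`: the Zariski closure of the set of Cartan subalgebras. -/
def red4 : Set (Gr 3 sl4) := closure red4Open

/-- Conjugation by an invertible matrix, on `sl₄`. -/
def conj (g : GL (Fin 4) ℂ) : sl4 ≃ₗ[ℂ] sl4 where
  toFun X := ⟨g.1 * X.1 * g⁻¹.1, by
    have h := mem_sl4.1 X.2
    rw [mem_sl4, Matrix.trace_mul_comm, ← Matrix.mul_assoc, Units.inv_mul, Matrix.one_mul, h]⟩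
  invFun X := ⟨g⁻¹.1 * X.1 * g.1, by
    have h := mem_sl4.1 X.2
    rw [mem_sl4, Matrix.trace_mul_comm, ← Matrix.mul_assoc, Units.mul_inv, Matrix.one_mul, h]⟩
  map_add' X Y := Subtype.ext (by simp [Matrix.mul_add, Matrix.add_mul])
  map_smul' c X := Subtype.ext (by simp)
  left_inv X := Subtype.ext (by
    change g⁻¹.1 * (g.1 * X.1 * g⁻¹.1) * g.1 = X.1
    rw [Matrix.mul_assoc g.1, ← Matrix.mul_assoc g⁻¹.1, Units.inv_mul, Matrix.one_mul,
      Matrix.mul_assoc, Units.inv_mul, Matrix.mul_one])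
  right_inv X := Subtype.ext (by
    change g.1 * (g⁻¹.1 * X.1 * g.1) * g⁻¹.1 = X.1
    rw [Matrix.mul_assoc g⁻¹.1, ← Matrix.mul_assoc g.1, Units.mul_inv, Matrix.one_mul,
      Matrix.mul_assoc, Units.mul_inv, Matrix.mul_one])

/-- The action of `GL₄` on the Grassmannian by conjugation. The scalar matrices act trivially, so
it has the same orbits as the induced action of `PGL₄`. -/
instance conjAction : MulAction (GL (Fin 4) ℂ) (Gr 3 sl4) where
  smul g W := W.map (conj g)
  one_smul W := Subtype.ext (by
    change W.1.map ((conj 1 : sl4 ≃ₗ[ℂ] sl4) : sl4 →ₗ[ℂ] sl4) = W.1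
    have h : ((conj 1 : sl4 ≃ₗ[ℂ] sl4) : sl4 →ₗ[ℂ] sl4) = LinearMap.id :=
      LinearMap.ext fun X => Subtype.ext (by simp [conj])
    rw [h, Submodule.map_id])
  mul_smul g g' W := Subtype.ext (by
    change W.1.map ((conj (g * g') : sl4 ≃ₗ[ℂ] sl4) : sl4 →ₗ[ℂ] sl4) =
      (W.1.map ((conj g' : sl4 ≃ₗ[ℂ] sl4) : sl4 →ₗ[ℂ] sl4)).map
        ((conj g : sl4 ≃ₗ[ℂ] sl4) : sl4 →ₗ[ℂ] sl4)
    rw [← Submodule.map_comp]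
    congr 1
    exact LinearMap.ext fun X => Subtype.ext (by simp [conj, Matrix.mul_assoc]))

/-- The linear automorphism of `ℂ⁴` given by an invertible matrix. -/
def vecEquiv (g : GL (Fin 4) ℂ) : (Fin 4 → ℂ) ≃ₗ[ℂ] (Fin 4 → ℂ) where
  toFun v := g.1 *ᵥ v
  invFun v := g⁻¹.1 *ᵥ v
  map_add' v w := Matrix.mulVec_add _ v w
  map_smul' c v := Matrix.mulVec_smul _ c v
  left_inv v := by
    change g⁻¹.1 *ᵥ (g.1 *ᵥ v) = v
    rw [Matrix.mulVec_mulVec, Units.inv_mul, Matrix.one_mulVec]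
  right_inv v := by
    change g.1 *ᵥ (g⁻¹.1 *ᵥ v) = v
    rw [Matrix.mulVec_mulVec, Units.mul_inv, Matrix.one_mulVec]

/-! ## The minimal orbits and the orbit `O₆` -/

/-- The abelian algebra of the endomorphisms of `ℂ⁴` that map `ℂ⁴` into `L` and `L` to zero. -/
def flagAlgebra (L : Submodule ℂ (Fin 4 → ℂ)) : Submodule ℂ sl4 where
  carrier := {X | (∀ v, X.1 *ᵥ v ∈ L) ∧ ∀ v ∈ L, X.1 *ᵥ v = 0}
  zero_mem' := by simp
  add_mem' {X Y} hX hY :=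
    ⟨fun v => by simpa [Matrix.add_mulVec] using L.add_mem (hX.1 v) (hY.1 v),
      fun v hv => by simp [Matrix.add_mulVec, hX.2 v hv, hY.2 v hv]⟩
  smul_mem' c X hX :=
    ⟨fun v => by simpa [Matrix.smul_mulVec] using L.smul_mem c (hX.1 v),
      fun v hv => by simp [Matrix.smul_mulVec, hX.2 v hv]⟩

theorem finrank_flagAlgebra (L : Submodule ℂ (Fin 4 → ℂ)) :
    Module.finrank ℂ (flagAlgebra L) =
      Module.finrank ℂ ((Fin 4 → ℂ) ⧸ L) * Module.finrank ℂ L := by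
  rw [← Module.finrank_linearMap (R := ℂ) (S := ℂ)]
  refine (LinearEquiv.finrank_eq (LinearEquiv.ofBijective
    (M := ((Fin 4 → ℂ) ⧸ L) →ₗ[ℂ] L) (M₂ := flagAlgebra L)
    { toFun := fun f => ⟨⟨LinearMap.toMatrix' (L.subtype ∘ₗ f ∘ₗ L.mkQ), ?_⟩, ?_⟩
      map_add' := ?_
      map_smul' := ?_ } ⟨?_, ?_⟩)).symm
  · rw [mem_sl4]
    have hsq : LinearMap.toMatrix' (L.subtype ∘ₗ f ∘ₗ L.mkQ) ^ 2 = 0 := by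
      rw [pow_two, ← LinearMap.toMatrix'_comp]
      have : (L.subtype ∘ₗ f ∘ₗ L.mkQ) ∘ₗ (L.subtype ∘ₗ f ∘ₗ L.mkQ) = 0 := by
        refine LinearMap.ext fun v => ?_
        have h0 : L.mkQ (f (L.mkQ v)).1 = 0 :=
          (Submodule.Quotient.mk_eq_zero L).2 (f (L.mkQ v)).2
        simp only [LinearMap.comp_apply, Submodule.subtype_apply, h0, map_zero,
          LinearMap.zero_apply]
      rw [this, map_zero]
    exact (Matrix.isNilpotent_trace_of_isNilpotent ⟨2, hsq⟩).eq_zero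
  · refine ⟨fun v => ?_, fun v hv => ?_⟩
    · simp [LinearMap.toMatrix'_mulVec]
    · have : L.mkQ v = 0 := by simpa using hv
      simp only [LinearMap.toMatrix'_mulVec, LinearMap.comp_apply, this, map_zero]
  · intro f f'
    refine Subtype.ext (Subtype.ext ?_)
    simp [LinearMap.add_comp, LinearMap.comp_add]
  · intro c f
    refine Subtype.ext (Subtype.ext ?_)
    simp [LinearMap.smul_comp, LinearMap.comp_smul]
  · intro f f' h
    have h2 := congrArg (fun X : flagAlgebra L => X.1.1) h
    have h3 := LinearMap.toMatrix'.injective h2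
    refine LinearMap.ext fun q => ?_
    obtain ⟨v, rfl⟩ := L.mkQ_surjective q
    exact Subtype.ext (LinearMap.congr_fun h3 v)
  · intro X
    refine ⟨L.liftQ (LinearMap.codRestrict L (Matrix.toLin' X.1.1) X.2.1) ?_, ?_⟩
    · intro v hv
      exact Subtype.ext (X.2.2 v hv)
    · refine Subtype.ext (Subtype.ext (Matrix.toLin'.injective ?_))
      refine LinearMap.ext fun v => ?_
      simp only [LinearMap.coe_mk, AddHom.coe_mk, Matrix.toLin'_toMatrix']
      rfl

/-- The point of the Grassmannian given by the endomorphisms with image in a given line `L` and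
with `L` in their kernel. -/
def lineAlgebra (L : Gr 1 (Fin 4 → ℂ)) : Gr 3 sl4 :=
  ⟨flagAlgebra L.1, by
    have h := L.1.finrank_quotient_add_finrank
    have h1 := L.2
    rw [Module.finrank_fin_fun] at h
    rw [finrank_flagAlgebra, h1]
    omega⟩

/-- The point of the Grassmannian given by the endomorphisms with image in a given hyperplane `L`
and with `L` in their kernel. -/
def hyperplaneAlgebra (L : Gr 3 (Fin 4 → ℂ)) : Gr 3 sl4 :=
  ⟨flagAlgebra L.1, by
    have h := L.1.finrank_quotient_add_finrank
    have h1 := L.2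
    rw [Module.finrank_fin_fun] at h
    rw [finrank_flagAlgebra, h1]
    omega⟩

/-- The first minimal orbit, parametrized by `ℙ³`. -/
def minimalOrbit : Set (Gr 3 sl4) := Set.range lineAlgebra

/-- The second minimal orbit, parametrized by the dual `ℙ³`. -/
def dualMinimalOrbit : Set (Gr 3 sl4) := Set.range hyperplaneAlgebra

/-- The matrix with upper right block `(a, b; 0, c)` and zeros elsewhere, linearly in
`(a, b, c)`. -/
def o6Map : (Fin 3 → ℂ) →ₗ[ℂ] sl4 where
  toFun x := ⟨!![0, 0, x 0, x 1; 0, 0, 0, x 2; 0, 0, 0, 0; 0, 0, 0, 0], by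
    rw [mem_sl4]; simp [Matrix.trace, Fin.sum_univ_four]⟩
  map_add' x y := Subtype.ext (by
    ext i j; fin_cases i <;> fin_cases j <;> simp)
  map_smul' c x := Subtype.ext (by
    ext i j; fin_cases i <;> fin_cases j <;> simp)

theorem o6Map_injective : Function.Injective o6Map := by
  intro x y h
  have h' : ∀ i j, (o6Map x).1 i j = (o6Map y).1 i j := fun i j => by rw [h]
  have h0 := h' 0 2
  have h1 := h' 0 3
  have h2 := h' 1 3
  simp [o6Map] at h0 h1 h2
  ext i
  fin_cases i <;> assumption

/-- The abelian algebra of the matrices with upper right block `(a, b; 0, c)` and zeros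
elsewhere. -/
def o6Point : Gr 3 sl4 :=
  ⟨LinearMap.range o6Map, by
    rw [LinearMap.finrank_range_of_inj o6Map_injective, Module.finrank_fin_fun]⟩

/-- The orbit `O₆` of that algebra under conjugation. -/
def orbitO6 : Set (Gr 3 sl4) := MulAction.orbit (GL (Fin 4) ℂ) o6Point

end Reductions

end

/-!
A Cartan subalgebra of `sl₄` is abelian, so all points of the variety of reductions are abelian
three-dimensional subspaces, and the converse holds as well: the variety of reductions is the
variety of commuting three-dimensional subspaces (`mem_red4_iff`). All statements are proved with
this description.

*The chart.* Around the algebra `o6Point` the three entries in the positions `(1, 3)`, `(1, 4)` and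
`(2, 4)` can be taken as coordinates on the subspaces. The commutation relations can then be solved: the commuting
subspaces on which these entries are independent form an affine space of dimension twelve, with an
explicit polynomial frame `chartFrame` (`exists_eq_chartPoint`). A generic point of the chart
contains a matrix with four distinct eigenvalues, so it is a Cartan subalgebra, and the chart lies in
the variety of reductions. The local rings at points of the chart are localizations of a polynomial
ring, so these points are smooth (`isRegularPoint_chartPoint`). The torus of the matrices
`diag(s, s², s³, s⁴)` acts on the chart with positive weights and contracts it to `o6Point`, which
is hence in the closure of the orbit of every point of the chart
(`o6Point_mem_closure_orbit_chartPoint`).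

*Every commuting subspace outside of the two minimal orbits can be moved into the chart*
(`exists_inChart`). In terms of endomorphisms two linear forms and two vectors with suitable
properties are needed (`HasChartFrame`). If some element of the subspace has a cyclic subspace of
dimension three, they are found in terms of this element. Otherwise every element has a quadratic
minimal polynomial, which reduces the claim to subspaces of square-zero matrices. This gives the
closure statement, the smoothness along `O₆`, and that every singular point is in one of the
minimal orbits. It also shows that every commuting subspace is in the variety of reductions: the
points of the minimal orbits are limits of Cartan subalgebras too.

*Singularity along the minimal orbits.* Near the algebra of a line, a commuting subspace, together
with the scalar matrices, is a commutative algebra with a basis `1, x₁, x₂, x₃`, and the eighteen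
structure constants `Γᵢⱼᵏ` generate the coordinate ring. They satisfy a nontrivial polynomial
relation, so the local ring has dimension at most seventeen. But there are eighteen lines
through the point in the variety, in independent directions, so that the cotangent space has
dimension at least eighteen (`not_isRegularPoint_firstLine`). Transposition exchanges the two minimal
orbits.
-/

open scoped Matrix

noncomputable section

namespace Reductions

/-! ### Plücker coordinates and the Zariski topology -/

section Pluecker

variable {V V' : Type*} [AddCommGroup V] [Module ℂ V] [AddCommGroup V'] [Module ℂ V'] {k : ℕ}

theorem Gr.finiteDimensional {k : ℕ} (hk : 0 < k) (W : Gr k V) : FiniteDimensional ℂ W.1 :=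
  Module.finite_of_finrank_pos (by rw [W.2]; exact hk)

/-- The span of `k` linearly independent vectors. -/
def spanGr (u : Fin k → V) (hu : LinearIndependent ℂ u) : Gr k V :=
  ⟨Submodule.span ℂ (Set.range u), by rw [finrank_span_eq_card hu, Fintype.card_fin]⟩

/-- The Plücker coordinates of two frames of the same subspace differ by a common factor, the
determinant of the change of frame. -/
theorem exists_pluecker_eq_mul {u : Fin k → V} (hu : LinearIndependent ℂ u) (w : Fin k → V)
    (hw : ∀ i, w i ∈ Submodule.span ℂ (Set.range u)) :
    ∃ c : ℂ, ∀ ω : V [⋀^Fin k]→ₗ[ℂ] ℂ, ω w = c * ω u := by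
  let b := Module.Basis.span hu
  refine ⟨b.det fun i => ⟨w i, hw i⟩, fun ω => ?_⟩
  have h := congrArg (fun f => f fun i => (⟨w i, hw i⟩ : Submodule.span ℂ (Set.range u)))
    ((ω.compLinearMap (Submodule.span ℂ (Set.range u)).subtype).eq_smul_basis_det b)
  have hb : (fun i => ((b i : Submodule.span ℂ (Set.range u)) : V)) = u :=
    funext fun i => congrArg Subtype.val (Module.Basis.span_apply hu i)
  simp only [AlternatingMap.compLinearMap_apply, AlternatingMap.smul_apply, smul_eq_mul] at h
  change ω w = ω (fun i => ((b i : Submodule.span ℂ (Set.range u)) : V)) * _ at h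
  rw [h, hb, mul_comm]

theorem eval_pluecker_smul {d : ℕ} {P : MvPolynomial (V [⋀^Fin k]→ₗ[ℂ] ℂ) ℂ}
    (hP : P.IsHomogeneous d) (c : ℂ) (u : Fin k → V) :
    MvPolynomial.eval (fun ω : V [⋀^Fin k]→ₗ[ℂ] ℂ => c * ω u) P =
      c ^ d * MvPolynomial.eval (fun ω : V [⋀^Fin k]→ₗ[ℂ] ℂ => ω u) P := by
  rw [MvPolynomial.eval_eq, MvPolynomial.eval_eq, Finset.mul_sum]
  refine Finset.sum_congr rfl fun m hm => ?_
  have hd : ∑ i ∈ m.support, m i = d := by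
    have := hP (MvPolynomial.mem_support_iff.1 hm)
    rwa [Finsupp.weight_apply, Finsupp.sum, Finset.sum_congr rfl
      (fun i _ => by simp : ∀ i ∈ m.support, m i • (1 : (V [⋀^Fin k]→ₗ[ℂ] ℂ) → ℕ) i = m i)] at this
  simp_rw [mul_pow]
  rw [Finset.prod_mul_distrib, Finset.prod_pow_eq_pow_sum, hd]
  ring

/-- A homogeneous polynomial in the Plücker coordinates may be tested on a single frame. -/
theorem spanGr_mem_zeroLocus {d : ℕ} {P : MvPolynomial (V [⋀^Fin k]→ₗ[ℂ] ℂ) ℂ}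
    (hP : P.IsHomogeneous d) {u : Fin k → V} (hu : LinearIndependent ℂ u) :
    spanGr u hu ∈ zeroLocus P ↔
      MvPolynomial.eval (fun ω : V [⋀^Fin k]→ₗ[ℂ] ℂ => ω u) P = 0 := by
  refine ⟨fun h => h u fun i => Submodule.subset_span ⟨i, rfl⟩, fun h w hw => ?_⟩
  obtain ⟨c, hc⟩ := exists_pluecker_eq_mul hu w hw
  simp_rw [hc]
  rw [eval_pluecker_smul hP, h, mul_zero]

/-- Plücker coordinates of a frame lie in any algebra of functions that contains the coordinates of
the vectors of the frame. -/
theorem pluecker_mem [FiniteDimensional ℂ V] {T : Type*} (S : Subalgebra ℂ (T → ℂ))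
    (u : T → Fin k → V) (hu : ∀ (f : Module.Dual ℂ V) i, (fun t => f (u t i)) ∈ S)
    (ω : V [⋀^Fin k]→ₗ[ℂ] ℂ) : (fun t => ω (u t)) ∈ S := by
  let b := Module.finBasis ℂ V
  have h : (fun t => ω (u t)) = ∑ r : Fin k → Fin (Module.finrank ℂ V),
      (∏ i, fun t => b.coord (r i) (u t i)) * algebraMap ℂ (T → ℂ) (ω fun i => b (r i)) := by
    funext t
    have ht : u t = fun i => ∑ j, b.coord j (u t i) • b j :=
      funext fun i => (b.sum_repr (u t i)).symm
    have := (ω : MultilinearMap ℂ (fun _ : Fin k => V) ℂ).map_sum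
      (fun i j => b.coord j (u t i) • b j)
    rw [← ht] at this
    rw [Finset.sum_apply]
    refine this.trans (Finset.sum_congr rfl fun r _ => ?_)
    rw [MultilinearMap.map_smul_univ]
    simp [Finset.prod_apply]
  rw [h]
  exact S.sum_mem fun r _ => S.mul_mem (S.prod_mem fun i _ => hu _ _) (S.algebraMap_mem _)

theorem eval_mem {T σ : Type*} (S : Subalgebra ℂ (T → ℂ)) (a : σ → T → ℂ) (ha : ∀ i, a i ∈ S)
    (P : MvPolynomial σ ℂ) : (fun t => MvPolynomial.eval (fun i => a i t) P) ∈ S := by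
  induction P using MvPolynomial.induction_on with
  | C c =>
    simp only [MvPolynomial.eval_C]
    exact S.algebraMap_mem c
  | add p q hp hq => simpa using! S.add_mem hp hq
  | mul_X p i hp => simpa using! S.mul_mem hp (ha i)

/-- The algebra of polynomial functions of one variable. -/
def polyFun : Subalgebra ℂ (ℂ → ℂ) :=
  (AlgHom.pi fun t => Polynomial.aeval (R := ℂ) t).range

theorem mem_polyFun {f : ℂ → ℂ} : f ∈ polyFun ↔ ∃ p : Polynomial ℂ, ∀ t, p.eval t = f t := by
  constructor
  · rintro ⟨p, rfl⟩
    exact ⟨p, fun t => by simp [Polynomial.aeval_def, Polynomial.eval₂_eq_eval_map]⟩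
  · rintro ⟨p, hp⟩
    exact ⟨p, funext fun t => by
      simp [Polynomial.aeval_def, Polynomial.eval₂_eq_eval_map, hp]⟩

theorem finite_zeros_of_mem_polyFun {f : ℂ → ℂ} (hf : f ∈ polyFun) {t₀ : ℂ} (h : f t₀ ≠ 0) :
    {t | f t = 0}.Finite := by
  obtain ⟨p, hp⟩ := mem_polyFun.1 hf
  have hp0 : p ≠ 0 := by
    rintro rfl
    exact h (by rw [← hp, Polynomial.eval_zero])
  refine (p.roots.toFinset.finite_toSet).subset fun t ht => ?_
  simp only [Finset.mem_coe, Multiset.mem_toFinset, Polynomial.mem_roots hp0, Polynomial.IsRoot.def]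
  rw [hp]
  exact ht

/-- A polynomial curve in the Grassmannian which runs in a closed set for infinitely many values of
the parameter runs in it entirely. -/
theorem curve_mem_of_isClosed [FiniteDimensional ℂ V] {C : Set (Gr k V)} (hC : IsClosed C)
    (u : ℂ → Fin k → V) (hu : ∀ t, LinearIndependent ℂ (u t))
    (hpoly : ∀ (f : Module.Dual ℂ V) i, (fun t => f (u t i)) ∈ polyFun)
    (hinf : {t | spanGr (u t) (hu t) ∈ C}.Infinite) (t : ℂ) : spanGr (u t) (hu t) ∈ C := by
  let γ : CofiniteTopology ℂ → Gr k V := fun t => spanGr (u (CofiniteTopology.of.symm t)) (hu _)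
  have hγ : Continuous γ := by
    refine continuous_generateFrom_iff.2 ?_
    rintro _ ⟨d, P, hP, rfl⟩
    rw [CofiniteTopology.isOpen_iff]
    rintro ⟨t₀, ht₀⟩
    have hS := eval_mem polyFun (fun (ω : V [⋀^Fin k]→ₗ[ℂ] ℂ) t => ω (u t))
      (fun ω => pluecker_mem polyFun u hpoly ω) P
    refine Set.Finite.subset ((finite_zeros_of_mem_polyFun hS (t₀ := CofiniteTopology.of.symm t₀)
      fun h => ht₀ ((spanGr_mem_zeroLocus hP (hu _)).2 h)).preimage
        CofiniteTopology.of.symm.injective.injOn) fun s hs => ?_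
    have hs' : γ s ∈ zeroLocus P := by simpa using hs
    exact (spanGr_mem_zeroLocus hP (hu _)).1 hs'
  rcases CofiniteTopology.isClosed_iff.1 (hC.preimage hγ) with h | h
  · exact Set.eq_univ_iff_forall.1 h (CofiniteTopology.of t)
  · refine absurd ((h.image CofiniteTopology.of.symm).subset fun s hs => ?_) hinf
    exact ⟨CofiniteTopology.of s, hs, rfl⟩

theorem Gr.map_symm_map (e : V ≃ₗ[ℂ] V') (W : Gr k V) : (W.map e).map e.symm = W := by
  refine Subtype.ext ?_
  change (W.1.map (e : V →ₗ[ℂ] V')).map (e.symm : V' →ₗ[ℂ] V) = W.1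
  rw [← Submodule.map_comp]
  simp

theorem Gr.map_map_symm (e : V ≃ₗ[ℂ] V') (W : Gr k V') : (W.map e.symm).map e = W := by
  simpa using Gr.map_symm_map e.symm W

theorem Gr.continuous_map (e : V ≃ₗ[ℂ] V') : Continuous (Gr.map (k := k) e) := by
  refine continuous_generateFrom_iff.2 ?_
  rintro _ ⟨d, P, hP, rfl⟩
  refine TopologicalSpace.isOpen_generateFrom_of_mem
    ⟨d, MvPolynomial.rename (fun ω => ω.compLinearMap (e : V →ₗ[ℂ] V')) P,
      hP.rename_isHomogeneous, ?_⟩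
  rw [Set.preimage_compl]
  congr 1
  ext W
  simp only [Set.mem_preimage, zeroLocus, Set.mem_ofPred_eq, MvPolynomial.eval_rename]
  constructor
  · intro h w hw
    exact h (fun i => e (w i)) fun i => Submodule.mem_map_of_mem (hw i)
  · intro h w hw
    choose v hv hvw using hw
    have := h v hv
    convert this using 3
    funext ω
    simp only [Function.comp, AlternatingMap.compLinearMap_apply]
    congr 1
    funext i
    exact (hvw i).symm

theorem Gr.map_mem_closure (e : V ≃ₗ[ℂ] V') {X : Set (Gr k V)} {Y : Set (Gr k V')}
    (h : ∀ W ∈ X, W.map e ∈ Y) {W : Gr k V} (hW : W ∈ closure X) : W.map e ∈ closure Y :=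
  _root_.map_mem_closure (Gr.continuous_map e) hW h

end Pluecker

/-! ### Local rings of affine sets -/

section LocalRings

variable {E E' : Type*} [AddCommGroup E] [Module ℂ E] [AddCommGroup E'] [Module ℂ E']

theorem dual_mem_coordinateRing (Z : Set E) (f : Module.Dual ℂ E) :
    (fun z : Z => f z) ∈ coordinateRing Z :=
  Algebra.subset_adjoin ⟨f, rfl⟩

theorem comp_mem_coordinateRing (T : E →ₗ[ℂ] E') {Z : Set E} {Z' : Set E'} (τ : Z → Z')
    (hτ : ∀ z, (τ z : E') = T z) {b : Z' → ℂ} (hb : b ∈ coordinateRing Z') :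
    b ∘ τ ∈ coordinateRing Z := by
  induction hb using Algebra.adjoin_induction with
  | mem x hx =>
    obtain ⟨f, rfl⟩ := hx
    have : (fun z : Z' => f z) ∘ τ = fun z : Z => (f ∘ₗ T) z := by
      funext z
      simp [hτ]
    rw [this]
    exact dual_mem_coordinateRing Z _
  | algebraMap r => exact (coordinateRing Z).algebraMap_mem r
  | add x y _ _ hx hy => exact (coordinateRing Z).add_mem hx hy
  | mul x y _ _ hx hy => exact (coordinateRing Z).mul_mem hx hy

/-- A linear isomorphism that carries one affine set onto another identifies their coordinate
rings. -/
def coordinateRingEquiv (T : E ≃ₗ[ℂ] E') {Z : Set E} {Z' : Set E'} (τ : Z ≃ Z')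
    (hτ : ∀ z, (τ z : E') = T z) : coordinateRing Z' ≃+* coordinateRing Z where
  toFun b := ⟨b.1 ∘ τ, comp_mem_coordinateRing T.toLinearMap τ hτ b.2⟩
  invFun b := ⟨b.1 ∘ τ.symm, comp_mem_coordinateRing T.symm.toLinearMap τ.symm
    (fun z => by
      have := hτ (τ.symm z)
      rw [Equiv.apply_symm_apply] at this
      simp [this]) b.2⟩
  left_inv b := Subtype.ext (by funext z; simp)
  right_inv b := Subtype.ext (by funext z; simp)
  map_mul' _ _ := rfl
  map_add' _ _ := rfl

theorem isRegularLocalRing_of_linearEquiv (T : E ≃ₗ[ℂ] E') {Z : Set E} {Z' : Set E'} (τ : Z ≃ Z')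
    (hτ : ∀ z, (τ z : E') = T z) (z : Z) (z' : Z') (hz : τ z = z')
    (h : IsRegularLocalRing (localRing Z z)) : IsRegularLocalRing (localRing Z' z') := by
  subst hz
  let e := (coordinateRingEquiv T τ hτ).symm
  have hp : (RingHom.ker (evalAt Z z)).primeCompl.map (e : coordinateRing Z →* coordinateRing Z') =
      (RingHom.ker (evalAt Z' (τ z))).primeCompl := by
    have hcomap : RingHom.ker (evalAt Z z) = (RingHom.ker (evalAt Z' (τ z))).comap e := by
      ext b
      simp only [RingHom.mem_ker, Ideal.mem_comap]
      change b.1 z = 0 ↔ b.1 (τ.symm (τ z)) = 0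
      rw [Equiv.symm_apply_apply]
    ext b
    simp only [Submonoid.mem_map]
    constructor
    · rintro ⟨a, ha, rfl⟩ hb
      exact ha (by rw [hcomap]; exact hb)
    · intro hb
      refine ⟨e.symm b, fun ha => hb ?_, by simp⟩
      rw [hcomap] at ha
      simpa using ha
  exact IsRegularLocalRing.of_ringEquiv (R := localRing Z z) (R' := localRing Z' (τ z))
    (IsLocalization.ringEquivOfRingEquiv (localRing Z z) (localRing Z' (τ z)) e hp)

/-! #### Germs -/

variable {Z : Set E} {z : Z}

theorem isUnit_of_eval_ne_zero {b : coordinateRing Z} (hb : b.1 z ≠ 0) :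
    IsUnit (algebraMap (coordinateRing Z) (localRing Z z) b) :=
  IsLocalization.map_units (M := (RingHom.ker (evalAt Z z)).primeCompl) _ ⟨b, hb⟩

/-- The element `r` of the local ring is the germ of the function `f`, which need only be defined
(that is, meaningful) near `z`. -/
def IsGerm (z : Z) (r : localRing Z z) (f : Z → ℂ) : Prop :=
  ∃ s b : coordinateRing Z, s.1 z ≠ 0 ∧
    r * algebraMap _ (localRing Z z) s = algebraMap _ (localRing Z z) b ∧
    ∀ x, s.1 x ≠ 0 → s.1 x * f x = b.1 x

theorem isGerm_algebraMap (b : coordinateRing Z) :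
    IsGerm z (algebraMap _ (localRing Z z) b) b.1 :=
  ⟨1, b, by simp, by simp, by simp⟩

theorem IsGerm.add {r r' : localRing Z z} {f f' : Z → ℂ} (h : IsGerm z r f) (h' : IsGerm z r' f') :
    IsGerm z (r + r') (f + f') := by
  obtain ⟨s, b, hs, hr, hf⟩ := h
  obtain ⟨s', b', hs', hr', hf'⟩ := h'
  refine ⟨s * s', b * s' + b' * s, mul_ne_zero hs hs', ?_, fun x hx => ?_⟩
  · simp only [map_mul, map_add, ← hr, ← hr']
    ring
  · have hx1 := left_ne_zero_of_mul hx
    have hx2 := right_ne_zero_of_mul hx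
    change s.1 x * s'.1 x * (f x + f' x) = b.1 x * s'.1 x + b'.1 x * s.1 x
    rw [← hf x hx1, ← hf' x hx2]
    ring

theorem IsGerm.mul {r r' : localRing Z z} {f f' : Z → ℂ} (h : IsGerm z r f) (h' : IsGerm z r' f') :
    IsGerm z (r * r') (f * f') := by
  obtain ⟨s, b, hs, hr, hf⟩ := h
  obtain ⟨s', b', hs', hr', hf'⟩ := h'
  refine ⟨s * s', b * b', mul_ne_zero hs hs', ?_, fun x hx => ?_⟩
  · simp only [map_mul, ← hr, ← hr']
    ring
  · have hx1 := left_ne_zero_of_mul hx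
    have hx2 := right_ne_zero_of_mul hx
    change s.1 x * s'.1 x * (f x * f' x) = b.1 x * b'.1 x
    rw [← hf x hx1, ← hf' x hx2]
    ring

theorem isGerm_div {a g : coordinateRing Z} (hg : g.1 z ≠ 0) :
    ∃ r, IsGerm z r fun x => a.1 x / g.1 x :=
  ⟨IsLocalization.mk' (localRing Z z) a
    (⟨g, hg⟩ : (RingHom.ker (evalAt Z z)).primeCompl), g, a, hg,
    IsLocalization.mk'_spec (localRing Z z) a
      (⟨g, hg⟩ : (RingHom.ker (evalAt Z z)).primeCompl), fun x hx => by field_simp⟩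

/-- Functions that agree near `z` have the same germ. -/
theorem IsGerm.eq {r r' : localRing Z z} {f f' : Z → ℂ} (h : IsGerm z r f) (h' : IsGerm z r' f')
    {g : coordinateRing Z} (hg : g.1 z ≠ 0) (hff' : ∀ x, g.1 x ≠ 0 → f x = f' x) : r = r' := by
  obtain ⟨s, b, hs, hr, hf⟩ := h
  obtain ⟨s', b', hs', hr', hf'⟩ := h'
  have h0 : g * s * s' * (b * s') = g * s * s' * (b' * s) := by
    refine Subtype.ext (funext fun x => ?_)
    change g.1 x * s.1 x * s'.1 x * (b.1 x * s'.1 x) = g.1 x * s.1 x * s'.1 x * (b'.1 x * s.1 x)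
    by_cases hgx : g.1 x = 0
    · simp [hgx]
    by_cases hsx : s.1 x = 0
    · simp [hsx]
    by_cases hsx' : s'.1 x = 0
    · simp [hsx']
    rw [← hf x hsx, ← hf' x hsx', hff' x hgx]
    ring
  have hu : IsUnit (algebraMap _ (localRing Z z) (g * s * s')) :=
    isUnit_of_eval_ne_zero (mul_ne_zero (mul_ne_zero hg hs) hs')
  have h1 := congrArg (algebraMap _ (localRing Z z)) h0
  rw [map_mul, map_mul _ _ (b' * s), hu.mul_right_inj, map_mul, map_mul, ← hr, ← hr'] at h1
  have hu' : IsUnit (algebraMap _ (localRing Z z) (s * s')) :=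
    isUnit_of_eval_ne_zero (mul_ne_zero hs hs')
  refine hu'.mul_left_inj.1 ?_
  rw [map_mul, ← mul_assoc, h1, mul_assoc, mul_comm (algebraMap _ (localRing Z z) s')]

/-- Functions with the same germ agree near `z`. -/
theorem IsGerm.exists_eqOn {r : localRing Z z} {f f' : Z → ℂ} (h : IsGerm z r f)
    (h' : IsGerm z r f') :
    ∃ g : coordinateRing Z, g.1 z ≠ 0 ∧ ∀ x, g.1 x ≠ 0 → f x = f' x := by
  obtain ⟨s, b, hs, hr, hf⟩ := h
  obtain ⟨s', b', hs', hr', hf'⟩ := h'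
  have h1 : algebraMap _ (localRing Z z) (b * s') = algebraMap _ (localRing Z z) (b' * s) := by
    rw [map_mul, map_mul, ← hr, ← hr']
    ring
  obtain ⟨c, hc⟩ := (IsLocalization.eq_iff_exists
    (RingHom.ker (evalAt Z z)).primeCompl (localRing Z z)).1 h1
  refine ⟨c * (s * s'), mul_ne_zero c.2 (mul_ne_zero hs hs'), fun x hx => ?_⟩
  have hcx : c.1.1 x ≠ 0 := left_ne_zero_of_mul hx
  have hsx : s.1 x ≠ 0 := left_ne_zero_of_mul (right_ne_zero_of_mul hx)
  have hsx' : s'.1 x ≠ 0 := right_ne_zero_of_mul (right_ne_zero_of_mul hx)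
  have h2 : c.1.1 x * (b.1 x * s'.1 x) = c.1.1 x * (b'.1 x * s.1 x) :=
    congrFun (congrArg Subtype.val hc) x
  rw [← hf x hsx, ← hf' x hsx'] at h2
  have h3 := mul_left_cancel₀ hcx h2
  refine mul_left_cancel₀ (mul_ne_zero hsx hsx') ?_
  linear_combination h3

theorem IsGerm.isUnit {r : localRing Z z} {f : Z → ℂ} (h : IsGerm z r f) (hf : f z ≠ 0) :
    IsUnit r := by
  obtain ⟨s, b, hs, hr, hf'⟩ := h
  have hb : b.1 z ≠ 0 := by
    rw [← hf' z hs]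
    exact mul_ne_zero hs hf
  have := isUnit_of_eval_ne_zero (z := z) hb
  rw [← hr] at this
  exact isUnit_of_mul_isUnit_left this

theorem exists_mul_eq_algebraMap (r : localRing Z z) :
    ∃ s b : coordinateRing Z, s.1 z ≠ 0 ∧
      r * algebraMap _ (localRing Z z) s = algebraMap _ (localRing Z z) b := by
  obtain ⟨⟨b, s⟩, h⟩ := IsLocalization.surj (RingHom.ker (evalAt Z z)).primeCompl r
  exact ⟨s, b, s.2, h⟩

/-- The local ring of an affine set at `z` is regular if near `z` the set is identified with an open
subset of affine space: the affine coordinates are the fractions `a i / g`, and the inverse `Ψ` is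
given by fractions with denominator `g'`. -/
theorem isRegularLocalRing_of_chart {n : ℕ} (a : Fin n → coordinateRing Z) (g : coordinateRing Z)
    (hg : g.1 z ≠ 0) (g' : MvPolynomial (Fin n) ℂ) (Ψ : (Fin n → ℂ) → E)
    (hg' : MvPolynomial.eval (fun i => (a i).1 z / g.1 z) g' ≠ 0)
    (hΨmem : ∀ x, MvPolynomial.eval x g' ≠ 0 → Ψ x ∈ Z)
    (hΨpoly : ∀ f : Module.Dual ℂ E, ∃ p : MvPolynomial (Fin n) ℂ,
      ∀ x, MvPolynomial.eval x g' ≠ 0 → MvPolynomial.eval x g' * f (Ψ x) = MvPolynomial.eval x p)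
    (hΨΦ : ∀ y : Z, g.1 y ≠ 0 → MvPolynomial.eval (fun i => (a i).1 y / g.1 y) g' ≠ 0 →
      Ψ (fun i => (a i).1 y / g.1 y) = y)
    (hΦΨ : ∀ x (hx : MvPolynomial.eval x g' ≠ 0), g.1 ⟨Ψ x, hΨmem x hx⟩ ≠ 0 →
      ∀ i, (a i).1 ⟨Ψ x, hΨmem x hx⟩ / g.1 ⟨Ψ x, hΨmem x hx⟩ = x i) :
    IsRegularLocalRing (localRing Z z) := by
  let Φ : Z → Fin n → ℂ := fun y i => (a i).1 y / g.1 y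
  choose r hr using fun i => isGerm_div (z := z) (a := a i) hg
  let θ : MvPolynomial (Fin n) ℂ →ₐ[ℂ] localRing Z z := MvPolynomial.aeval r
  have hθ : ∀ p, IsGerm z (θ p) fun y => MvPolynomial.eval (Φ y) p := by
    intro p
    induction p using MvPolynomial.induction_on with
    | C c =>
      have h := isGerm_algebraMap (z := z) (algebraMap ℂ (coordinateRing Z) c)
      rw [← IsScalarTower.algebraMap_apply] at h
      simpa [θ] using! h
    | add p q hp hq => simpa using! hp.add hq
    | mul_X p i hp => simpa [θ] using! hp.mul (hr i)
  -- Functions on `Z` become fractions of polynomials after composition with `Ψ`.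
  have hpull : ∀ b ∈ coordinateRing Z, ∃ (N : ℕ) (p : MvPolynomial (Fin n) ℂ),
      ∀ x (hx : MvPolynomial.eval x g' ≠ 0),
        MvPolynomial.eval x g' ^ N * b ⟨Ψ x, hΨmem x hx⟩ = MvPolynomial.eval x p := by
    intro b hb
    induction hb using Algebra.adjoin_induction with
    | mem x hx =>
      obtain ⟨f, rfl⟩ := hx
      obtain ⟨p, hp⟩ := hΨpoly f
      exact ⟨1, p, fun x hx => by simpa using hp x hx⟩
    | algebraMap c => exact ⟨0, MvPolynomial.C c, fun x hx => by simp⟩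
    | add b c _ _ hb hc =>
      obtain ⟨N, p, hp⟩ := hb
      obtain ⟨M, q, hq⟩ := hc
      refine ⟨N + M, g' ^ M * p + g' ^ N * q, fun x hx => ?_⟩
      simp only [map_add, map_mul, map_pow, ← hp x hx, ← hq x hx, Pi.add_apply]
      ring
    | mul b c _ _ hb hc =>
      obtain ⟨N, p, hp⟩ := hb
      obtain ⟨M, q, hq⟩ := hc
      refine ⟨N + M, p * q, fun x hx => ?_⟩
      simp only [map_mul, ← hp x hx, ← hq x hx, Pi.mul_apply]
      ring
  have hval : ∀ b : coordinateRing Z, ∀ (N : ℕ) (p : MvPolynomial (Fin n) ℂ),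
      (∀ x (hx : MvPolynomial.eval x g' ≠ 0),
        MvPolynomial.eval x g' ^ N * b.1 ⟨Ψ x, hΨmem x hx⟩ = MvPolynomial.eval x p) →
      b.1 z ≠ 0 → MvPolynomial.eval (Φ z) p ≠ 0 := by
    intro b N p hp hb
    rw [← hp _ hg']
    refine mul_ne_zero (pow_ne_zero _ hg') ?_
    convert hb
    exact hΨΦ z hg hg'
  let e : MvPolynomial (Fin n) ℂ →+* ℂ := MvPolynomial.eval (Φ z)
  have : (RingHom.ker e).IsPrime := RingHom.ker_isPrime _
  let : Algebra (MvPolynomial (Fin n) ℂ) (localRing Z z) := θ.toRingHom.toAlgebra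
  have hloc : IsLocalization (RingHom.ker e).primeCompl (localRing Z z) := by
    refine ⟨⟨fun p => (hθ p.1).isUnit p.2, fun b => ?_, fun {p q} hpq => ?_⟩⟩
    · have key : ∀ b : coordinateRing Z, ∃ (p q : MvPolynomial (Fin n) ℂ), e q ≠ 0 ∧
          algebraMap _ (localRing Z z) b * θ q = θ p ∧ (b.1 z ≠ 0 → e p ≠ 0) := by
        intro b
        obtain ⟨N, p, hp⟩ := hpull b.1 b.2
        refine ⟨p, g' ^ N, by simpa [e] using! pow_ne_zero N hg', ?_, hval b N p hp⟩
        obtain ⟨s, c, hs, -, hsc⟩ := hθ g'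
        have hc : c.1 z ≠ 0 := by
          rw [← hsc z hs]
          exact mul_ne_zero hs hg'
        refine IsGerm.eq (g := g * (s * c)) ((isGerm_algebraMap b).mul (hθ _)) (hθ p)
          (mul_ne_zero hg (mul_ne_zero hs hc)) fun x hx => ?_
        have hgx : g.1 x ≠ 0 := left_ne_zero_of_mul hx
        have hsx : s.1 x ≠ 0 := left_ne_zero_of_mul (right_ne_zero_of_mul hx)
        have hcx : c.1 x ≠ 0 := right_ne_zero_of_mul (right_ne_zero_of_mul hx)
        rw [← hsc x hsx] at hcx
        have hgx' : MvPolynomial.eval (Φ x) g' ≠ 0 := right_ne_zero_of_mul hcx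
        have h1 := hp _ hgx'
        have h2 : (⟨Ψ (Φ x), hΨmem _ hgx'⟩ : Z) = x := Subtype.ext (hΨΦ x hgx hgx')
        rw [h2] at h1
        simp only [Pi.mul_apply, map_pow]
        rw [← h1, mul_comm]
      obtain ⟨⟨c, s⟩, hb⟩ := IsLocalization.surj (RingHom.ker (evalAt Z z)).primeCompl b
      obtain ⟨p, q, hq, hpq, -⟩ := key c
      obtain ⟨p', q', hq', hpq', hp'⟩ := key s.1
      refine ⟨⟨p * q', ⟨p' * q, fun h => ?_⟩⟩, ?_⟩
      · rw [SetLike.mem_coe, RingHom.mem_ker, map_mul] at h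
        exact mul_ne_zero (hp' s.2) hq h
      · change b * θ (p' * q) = θ (p * q')
        rw [map_mul, map_mul, ← hpq, ← hpq', ← hb]
        ring
    · obtain ⟨s, hs, hs'⟩ := (hθ p).exists_eqOn
        (f' := fun y => MvPolynomial.eval (Φ y) q) (by
          have h : θ p = θ q := hpq
          rw [h]
          exact hθ q)
      obtain ⟨N, σ, hσ⟩ := hpull s.1 s.2
      obtain ⟨M, τ, hτ⟩ := hpull g.1 g.2
      refine ⟨⟨g' * (σ * τ), fun h => ?_⟩, MvPolynomial.funext fun x => ?_⟩
      · rw [SetLike.mem_coe, RingHom.mem_ker, map_mul, map_mul] at h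
        exact mul_ne_zero hg' (mul_ne_zero (hval s N σ hσ hs) (hval g M τ hτ hg)) h
      · simp only [map_mul]
        by_cases hx : MvPolynomial.eval x g' = 0
        · simp [hx]
        by_cases hx1 : MvPolynomial.eval x σ = 0
        · simp [hx1]
        by_cases hx2 : MvPolynomial.eval x τ = 0
        · simp [hx2]
        rw [← hσ x hx] at hx1
        rw [← hτ x hx] at hx2
        have h1 := hs' _ (right_ne_zero_of_mul hx1)
        have h2 : Φ ⟨Ψ x, hΨmem x hx⟩ = x :=
          funext fun i => hΦΨ x hx (right_ne_zero_of_mul hx2) i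
        rw [h2] at h1
        rw [h1]
  exact IsRegularLocalRing.of_ringEquiv (R := Localization.AtPrime (RingHom.ker e))
    (R' := localRing Z z)
    (IsLocalization.algEquiv (RingHom.ker e).primeCompl _ _).toRingEquiv

open IsLocalRing in
/-- Independent tangent vectors at the closed point, given as homomorphisms to the dual numbers,
bound from below the number of generators of the maximal ideal. -/
theorem card_le_spanFinrank_maximalIdeal {R ι : Type*} [CommRing R] [IsLocalRing R]
    [IsNoetherianRing R] [Fintype ι] (e : R →+* ℂ) (he : ∀ x ∈ maximalIdeal R, e x = 0)
    (Δ : ι → R →+* DualNumber ℂ) (hΔ : ∀ m r, (Δ m r).fst = e r) (x : ι → R)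
    (hx : ∀ l, x l ∈ maximalIdeal R)
    (hind : LinearIndependent ℂ fun l m => (Δ m (x l)).snd) :
    Fintype.card ι ≤ (maximalIdeal R).spanFinrank := by
  have hfg : (maximalIdeal R).FG := IsNoetherian.noetherian _
  let δ : R → ι → ℂ := fun x m => (Δ m x).snd
  let T : Submodule ℂ (ι → ℂ) := Submodule.span ℂ (δ '' (maximalIdeal R).generators)
  have hT : ∀ x ∈ Submodule.span R (maximalIdeal R).generators, δ x ∈ T := by
    intro x hx
    induction hx using Submodule.span_induction with
    | mem x hx => exact Submodule.subset_span ⟨x, hx, rfl⟩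
    | zero =>
      have : δ 0 = 0 := funext fun m => by simp [δ]
      rw [this]
      exact T.zero_mem
    | add x y _ _ hx hy =>
      have : δ (x + y) = δ x + δ y := funext fun m => by simp [δ]
      rw [this]
      exact T.add_mem hx hy
    | smul r x hx' hx =>
      rw [Submodule.span_generators] at hx'
      have : δ (r • x) = e r • δ x := funext fun m => by simp [δ, hΔ, he x hx']
      rw [this]
      exact T.smul_mem _ hx
  have hγ : ∀ l, (fun m => (Δ m (x l)).snd) ∈ T := fun l =>
    hT _ (by rw [Submodule.span_generators]; exact hx l)
  have hle : Fintype.card ι ≤ Module.finrank ℂ T :=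
    LinearIndependent.fintype_card_le_finrank (b := fun l => (⟨_, hγ l⟩ : T))
      (LinearIndependent.of_comp T.subtype hind)
  have hG := Submodule.FG.finite_generators hfg
  let := (hG.image δ).fintype
  refine hle.trans ((finrank_span_le_card (R := ℂ) (δ '' (maximalIdeal R).generators)).trans ?_)
  rw [← Set.ncard_eq_toFinset_card', ← Submodule.FG.generators_ncard hfg]
  exact Set.ncard_image_le hG

/-- The hypotheses say that `Z` is embedded by the `γ i` in affine space of dimension `n`, as a
proper closed subset which contains `n` independent lines through the origin: then the dimension of
`Z` at the origin is less than `n`, while that of the cotangent space is `n`. -/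
theorem not_isRegularLocalRing_of_lines {ι : Type*} [Fintype ι] (hz : (z : E) = 0)
    (γ : ι → Module.Dual ℂ E) (ψ : ι → E) (hψ : ∀ m (t : ℂ), t • ψ m ∈ Z)
    (hind : LinearIndependent ℂ fun l m => γ l (ψ m))
    (hgen : ∀ f : Module.Dual ℂ E, ∃ p : MvPolynomial ι ℂ,
      ∀ y ∈ Z, f y = MvPolynomial.eval (fun l => γ l y) p)
    (p : MvPolynomial ι ℂ) (hp : p ≠ 0)
    (hrel : ∀ y ∈ Z, MvPolynomial.eval (fun l => γ l y) p = 0) :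
    ¬ IsRegularLocalRing (localRing Z z) := by
  intro hreg
  let γB : ι → coordinateRing Z := fun l => ⟨fun y => γ l y, dual_mem_coordinateRing Z _⟩
  let π : MvPolynomial ι ℂ →ₐ[ℂ] coordinateRing Z := MvPolynomial.aeval γB
  have hπ : ∀ q (y : Z), (π q).1 y = MvPolynomial.eval (fun l => γ l y) q := by
    intro q y
    induction q using MvPolynomial.induction_on with
    | C c => simp [π]
    | add p q hp hq => simp [hp, hq]
    | mul_X p i hp => simp [hp, π, γB]
  have hsurj : Function.Surjective π := by
    rintro ⟨b, hb⟩
    have : b ∈ π.range.map (coordinateRing Z).val := by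
      refine (Algebra.adjoin_le (S := π.range.map (coordinateRing Z).val) ?_) hb
      rintro _ ⟨f, rfl⟩
      obtain ⟨q, hq⟩ := hgen f
      exact ⟨π q, ⟨q, rfl⟩, funext fun y => (hπ q y).trans (hq y y.2).symm⟩
    obtain ⟨_, ⟨q, rfl⟩, hq⟩ := this
    exact ⟨q, Subtype.ext hq⟩
  have hdim : ringKrullDim (coordinateRing Z) + 1 ≤ Fintype.card ι := by
    have h := ringKrullDim_succ_le_of_surjective π.toRingHom hsurj
      (mem_nonZeroDivisors_of_ne_zero hp) (Subtype.ext (funext fun y => (hπ p y).trans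
        (hrel y y.2)))
    rwa [MvPolynomial.ringKrullDim_of_isNoetherianRing, ringKrullDim_eq_zero_of_field, zero_add,
      Nat.card_eq_fintype_card] at h
  have hloc : ringKrullDim (localRing Z z) ≤ ringKrullDim (coordinateRing Z) := by
    rw [IsLocalization.AtPrime.ringKrullDim_eq_height (RingHom.ker (evalAt Z z)) (localRing Z z)]
    exact Ideal.height_le_ringKrullDim_of_ne_top (evalAt_ker_isPrime Z z).ne_top
  let 𝔪 := IsLocalRing.maximalIdeal (localRing Z z)
  have hfin : 𝔪.spanFinrank < Fintype.card ι := by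
    have h := hreg.spanFinrank_maximalIdeal
    rw [← h] at hloc
    have := (add_le_add_left hloc 1).trans hdim
    exact_mod_cast this
  -- The velocities of the lines are derivations of the coordinate ring at the origin.
  have hdiff : ∀ m, ∀ b ∈ coordinateRing Z,
      DifferentiableAt ℂ (fun t : ℂ => b ⟨t • ψ m, hψ m t⟩) 0 := by
    intro m b hb
    induction hb using Algebra.adjoin_induction with
    | mem x hx =>
      obtain ⟨f, rfl⟩ := hx
      simp only [map_smul, smul_eq_mul]
      fun_prop
    | algebraMap c => exact differentiableAt_const _
    | add b c _ _ hb hc => exact hb.add hc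
    | mul b c _ _ hb hc => exact hb.mul hc
  have hz0 : ∀ m, (⟨(0 : ℂ) • ψ m, hψ m 0⟩ : Z) = z := fun m => Subtype.ext (by simp [hz])
  let D : ι → coordinateRing Z →+* DualNumber ℂ := fun m =>
    { toFun := fun b => TrivSqZeroExt.inl (b.1 z) +
        TrivSqZeroExt.inr (deriv (fun t : ℂ => b.1 ⟨t • ψ m, hψ m t⟩) 0)
      map_one' := by ext <;> simp
      map_zero' := by ext <;> simp
      map_add' := fun b c => by
        ext
        · simp
        · simpa using! deriv_add (hdiff m b.1 b.2) (hdiff m c.1 c.2)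
      map_mul' := fun b c => by
        ext
        · simp
        · have := deriv_mul (hdiff m b.1 b.2) (hdiff m c.1 c.2)
          rw [hz0] at this
          simp only [TrivSqZeroExt.snd_add, TrivSqZeroExt.snd_inl, TrivSqZeroExt.snd_inr,
            TrivSqZeroExt.snd_mul, TrivSqZeroExt.fst_add, TrivSqZeroExt.fst_inl,
            TrivSqZeroExt.fst_inr, zero_add, add_zero, smul_eq_mul, MulOpposite.smul_eq_mul_unop,
            MulOpposite.unop_op]
          refine this.trans ?_
          ring }
  have hDunit : ∀ m (s : (RingHom.ker (evalAt Z z)).primeCompl), IsUnit (D m s) := by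
    intro m s
    rw [TrivSqZeroExt.isUnit_iff_isUnit_fst]
    have hs : s.1.1 z ≠ 0 := s.2
    simpa [D] using hs
  let Δ : ι → localRing Z z →+* DualNumber ℂ := fun m => IsLocalization.lift (hDunit m)
  have hΔ : ∀ m b, Δ m (algebraMap _ _ b) = D m b := fun m b => IsLocalization.lift_eq _ _
  let e : localRing Z z →+* ℂ :=
    IsLocalization.lift (M := (RingHom.ker (evalAt Z z)).primeCompl) (g := evalAt Z z)
      fun s => isUnit_iff_ne_zero.2 s.2
  have he : ∀ b : coordinateRing Z, e (algebraMap _ _ b) = b.1 z :=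
    fun b => IsLocalization.lift_eq _ _
  have hker : ∀ r, e r = 0 → ¬ IsUnit r := fun r hr hu => (hu.map e).ne_zero hr
  have hunit : ∀ r, e r ≠ 0 → IsUnit r := by
    intro r hr
    obtain ⟨s, b, hs, hb⟩ := exists_mul_eq_algebraMap r
    have h2 : b.1 z ≠ 0 := by
      rw [← he b, ← hb, map_mul, he]
      exact mul_ne_zero hr hs
    have h4 := isUnit_of_eval_ne_zero (z := z) h2
    rw [← hb] at h4
    exact isUnit_of_mul_isUnit_left h4
  have hfst : ∀ m r, (Δ m r).fst = e r := by
    intro m r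
    have h : (TrivSqZeroExt.fstHom ℂ ℂ ℂ).toRingHom.comp (Δ m) = e := by
      refine IsLocalization.ringHom_ext (RingHom.ker (evalAt Z z)).primeCompl
        (RingHom.ext fun b => ?_)
      simp only [RingHom.comp_apply, hΔ, he]
      simp [D]
    exact congrArg (fun f => f r) h
  refine absurd (card_le_spanFinrank_maximalIdeal e (fun x hx => ?_) Δ hfst
    (fun l => algebraMap _ (localRing Z z) (γB l)) (fun l => ?_) ?_) (not_le.2 hfin)
  · by_contra h
    exact hx (hunit x h)
  · refine hker _ ?_
    rw [he]
    simp [γB, hz]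
  · convert hind using 3 with l m
    rw [hΔ]
    have : (fun t : ℂ => (γB l).1 ⟨t • ψ m, hψ m t⟩) = fun t : ℂ => t * γ l (ψ m) := by
      funext t
      simp [γB]
    simp [D, this]

end LocalRings

/-! ### The chart of the variety of reductions around `o6Point` -/

section Chart

/-- The three matrices that span the point with coordinates `x` of the chart of the variety of
reductions around `o6Point`, up to scalar matrices, which are normalized by the vanishing of the
entry `(3, 3)`. The coordinates are twelve of the entries: if the matrices are called `a`, `b`, `c`,
then `x` lists `a₁₂, a₂₃, a₃₄, c₁₂, c₂₃, a₂₂, b₁₂, b₂₃, b₃₄, c₂₂, b₂₂, c₂₁`. -/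
def chartMat {R : Type*} [CommRing R] (x : Fin 12 → R) : Fin 3 → Matrix (Fin 4) (Fin 4) R :=
  ![!![-x 8 + x 5 - x 0 * x 1 - x 2 * x 4, x 0, 1, 0;
      -x 1 * x 8 + x 2 * x 7, x 5, x 1, 0;
      x 2 * x 11 - x 2 * x 10 + x 0 * x 2 * x 7 + x 5 * x 8 - x 0 * x 1 * x 8, x 2 * x 6
        + x 1 * x 2 * x 3 - x 0 * x 5 + x 0^2 * x 1, 0, x 2;
      x 2 * x 10 * x 4 - x 2 * x 7 * x 9 + x 8 * x 11 - x 5 * x 8 * x 4 + x 1 * x 8 * x 9,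
        -x 2 * x 6 * x 4 - x 0 * x 11 + x 0 * x 5 * x 4 - x 0 * x 1 * x 9 + x 2 * x 7 * x 3,
        -x 11 + x 5 * x 4 - x 1 * x 9, x 5 - x 0 * x 1 - x 2 * x 4],
    !![x 11 - x 5 * x 4 + x 1 * x 9 + x 0 * x 7 - x 1 * x 6, x 6, 0, 1;
      x 5 * x 7 - x 1 * x 10, x 10, x 7, 0;
      x 2 * x 6 * x 7 - x 0 * x 5 * x 7 - x 1 * x 6 * x 8 + x 0 * x 1 * x 10 + x 2 * x 10 * x 4
        - x 2 * x 7 * x 9 + x 8 * x 11 - x 5 * x 8 * x 4 + x 1 * x 8 * x 9, x 2 * x 7 * x 3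
        + x 6 * x 8 + x 0^2 * x 7 - x 0 * x 10, 0, x 8;
      -x 2 * x 6 * x 7 * x 4 - 2 * x 0 * x 7 * x 11 + 2 * x 0 * x 5 * x 7 * x 4
        + x 2 * x 7^2 * x 3 - x 5 * x 1 * x 7 * x 3 + x 1^2 * x 10 * x 3 + x 1 * x 6 * x 11
        - x 1 * x 7 * x 8 * x 3 + x 1 * x 6 * x 8 * x 4 - 2 * x 0 * x 1 * x 10 * x 4
        - x 5 * x 7 * x 9 - x 2 * x 10 * x 4^2 + x 2 * x 7 * x 9 * x 4 - x 11^2 + x 10 * x 11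
        - x 8 * x 11 * x 4 + x 5 * x 11 * x 4 + x 5 * x 8 * x 4^2 - x 1 * x 11 * x 9
        + x 1 * x 10 * x 9 - x 1 * x 8 * x 9 * x 4, x 5 * x 7 * x 3 - x 1 * x 10 * x 3
        - x 6 * x 11 + x 7 * x 8 * x 3 - x 0 * x 7 * x 9 - x 6 * x 8 * x 4 + x 0 * x 10 * x 4,
        x 10 * x 4 - x 7 * x 9, -x 11 + x 10 - x 0 * x 7 - x 8 * x 4],
    !![x 0 * x 4 - x 1 * x 3, x 3, 0, 0;
      x 11, x 9, x 4, 1;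
      -x 0 * x 11 - x 1 * x 8 * x 3 + x 2 * x 7 * x 3, x 8 * x 3 + x 2 * x 3 * x 4 + x 0^2 * x 4
        - x 0 * x 9, 0, -x 0;
      -x 1 * x 10 * x 3 + x 5 * x 7 * x 3 - x 6 * x 11, -x 3 * x 11 + x 5 * x 3 * x 4
        - x 1 * x 3 * x 9 - x 0 * x 7 * x 3 + x 0 * x 6 * x 4 - x 6 * x 9 + x 10 * x 3,
        -x 6 * x 4 + x 7 * x 3, -x 6 + x 0 * x 4 - x 1 * x 3]]

theorem chartMat_mul_comm_of_lt {R : Type*} [CommRing R] (x : Fin 12 → R) {k l : Fin 3}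
    (hkl : k < l) : chartMat x k * chartMat x l = chartMat x l * chartMat x k := by
  ext i j
  rw [Matrix.mul_apply, Matrix.mul_apply, Fin.sum_univ_four, Fin.sum_univ_four]
  fin_cases k <;> fin_cases l <;> try exact absurd hkl (by decide)
  all_goals
    fin_cases i <;> fin_cases j <;>
    simp only [Fin.zero_eta, Fin.mk_one, Fin.reduceFinMk, Fin.isValue, chartMat, Matrix.cons_val,
      Matrix.of_apply] <;> ring

theorem chartMat_mul_comm {R : Type*} [CommRing R] (x : Fin 12 → R) (k l : Fin 3) :
    chartMat x k * chartMat x l = chartMat x l * chartMat x k := by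
  rcases lt_trichotomy k l with hkl | rfl | hkl
  · exact chartMat_mul_comm_of_lt x hkl
  · rfl
  · exact (chartMat_mul_comm_of_lt x hkl).symm

theorem eta_fin_four (A : Matrix (Fin 4) (Fin 4) ℂ) :
    A = !![A 0 0, A 0 1, A 0 2, A 0 3; A 1 0, A 1 1, A 1 2, A 1 3;
      A 2 0, A 2 1, A 2 2, A 2 3; A 3 0, A 3 1, A 3 2, A 3 3] := by
  ext i j
  fin_cases i <;> fin_cases j <;> rfl

/-- Commuting matrices in the chart are determined by the twelve coordinates: the other entries are
eliminated one after the other, in the order of their weights. -/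
theorem eq_chartMat_of_commute {A B C : Matrix (Fin 4) (Fin 4) ℂ} (hAB : A * B = B * A)
    (hAC : A * C = C * A) (hBC : B * C = C * B)
    (hA₁₃ : A 0 2 = 1) (hA₁₄ : A 0 3 = 0) (hA₂₄ : A 1 3 = 0) (hA₃₃ : A 2 2 = 0)
    (hB₁₃ : B 0 2 = 0) (hB₁₄ : B 0 3 = 1) (hB₂₄ : B 1 3 = 0) (hB₃₃ : B 2 2 = 0)
    (hC₁₃ : C 0 2 = 0) (hC₁₄ : C 0 3 = 0) (hC₂₄ : C 1 3 = 1) (hC₃₃ : C 2 2 = 0) :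
    ∃ x : Fin 12 → ℂ, A = chartMat x 0 ∧ B = chartMat x 1 ∧ C = chartMat x 2 := by
  have entry : ∀ {M N : Matrix (Fin 4) (Fin 4) ℂ}, M * N = N * M → ∀ i j,
      M i 0 * N 0 j + M i 1 * N 1 j + M i 2 * N 2 j + M i 3 * N 3 j =
        N i 0 * M 0 j + N i 1 * M 1 j + N i 2 * M 2 j + N i 3 * M 3 j := by
    intro M N h i j
    simpa only [Matrix.mul_apply, Fin.sum_univ_four] using congrFun (congrFun h i) j
  have ac14 := entry hAC 0 3
  have ab14 := entry hAB 0 3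
  have ac24 := entry hAC 1 3
  have ac13 := entry hAC 0 2
  have bc14 := entry hBC 0 3
  have ab24 := entry hAB 1 3
  have ac34 := entry hAC 2 3
  have ac23 := entry hAC 1 2
  have ab13 := entry hAB 0 2
  have bc24 := entry hBC 1 3
  have ac12 := entry hAC 0 1
  have bc13 := entry hBC 0 2
  have ab34 := entry hAB 2 3
  have ac22 := entry hAC 1 1
  have ab23 := entry hAB 1 2
  have ab12 := entry hAB 0 1
  have bc23 := entry hBC 1 2
  have ac11 := entry hAC 0 0
  have bc12 := entry hBC 0 1
  have ab11 := entry hAB 0 0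
  have ab33 := entry hAB 2 2
  have bc22 := entry hBC 1 1
  have ac43 := entry hAC 3 2
  have ab43 := entry hAB 3 2
  rw [eta_fin_four A, eta_fin_four B, eta_fin_four C]
  simp only [hA₁₃, hA₁₄, hA₂₄, hA₃₃, hB₁₃, hB₁₄, hB₂₄, hB₃₃,
    hC₁₃, hC₁₄, hC₂₄, hC₃₃]
    at ac14 ab14 ac24 ac13 bc14 ab24 ac34 ac23 ab13 bc24 ac12 bc13
      ab34 ac22 ab23 ab12 bc23 ac11 bc12 ab11 ab33 bc22 ac43 ab43 ⊢
  clear entry hAB hAC hBC hA₁₃ hA₁₄ hA₂₄ hA₃₃ hB₁₃ hB₁₄ hB₂₄ hB₃₃ hC₁₃ hC₁₄ hC₂₄ hC₃₃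
  generalize A 0 0 = a11 at *
  generalize A 0 1 = a12 at *
  generalize A 1 0 = a21 at *
  generalize A 1 1 = a22 at *
  generalize A 1 2 = a23 at *
  generalize A 2 0 = a31 at *
  generalize A 2 1 = a32 at *
  generalize A 2 3 = a34 at *
  generalize A 3 0 = a41 at *
  generalize A 3 1 = a42 at *
  generalize A 3 2 = a43 at *
  generalize A 3 3 = a44 at *
  generalize B 0 0 = b11 at *
  generalize B 0 1 = b12 at *
  generalize B 1 0 = b21 at *
  generalize B 1 1 = b22 at *
  generalize B 1 2 = b23 at *
  generalize B 2 0 = b31 at *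
  generalize B 2 1 = b32 at *
  generalize B 2 3 = b34 at *
  generalize B 3 0 = b41 at *
  generalize B 3 1 = b42 at *
  generalize B 3 2 = b43 at *
  generalize B 3 3 = b44 at *
  generalize C 0 0 = c11 at *
  generalize C 0 1 = c12 at *
  generalize C 1 0 = c21 at *
  generalize C 1 1 = c22 at *
  generalize C 1 2 = c23 at *
  generalize C 2 0 = c31 at *
  generalize C 2 1 = c32 at *
  generalize C 2 3 = c34 at *
  generalize C 3 0 = c41 at *
  generalize C 3 1 = c42 at *
  generalize C 3 2 = c43 at *
  generalize C 3 3 = c44 at *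
  obtain rfl : c34 = -a12 := by
    linear_combination ac14
  obtain rfl : a11 = -b34 + a22 - a12 * a23 - a34 * c23 := by
    linear_combination ab14 - ac24
  obtain rfl : a44 = a22 - a12 * a23 - a34 * c23 := by
    linear_combination -ac24
  obtain rfl : c11 = a12 * c23 - a23 * c12 := by
    linear_combination -ac13
  obtain rfl : c44 = -b12 + a12 * c23 - a23 * c12 := by
    linear_combination bc14 - ac13
  obtain rfl : a21 = -a23 * b34 + a34 * b23 := by
    linear_combination ab24
  obtain rfl : a32 = a34 * b12 + a23 * a34 * c12 - a12 * a22 + a12^2 * a23 := by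
    linear_combination ac34
  obtain rfl : a43 = -c21 + a22 * c23 - a23 * c22 := by
    linear_combination -ac23
  obtain rfl : b11 = c21 - a22 * c23 + a23 * c22 + a12 * b23 - a23 * b12 := by
    linear_combination ac23 - ab13
  obtain rfl : b44 = -c21 + b22 - a12 * b23 - b34 * c23 := by
    linear_combination -bc24
  obtain rfl : c32 = b34 * c12 + a34 * c12 * c23 + a12^2 * c23 - a12 * c22 := by
    linear_combination ac12
  obtain rfl : c43 = -b12 * c23 + b23 * c12 := by
    linear_combination bc13
  obtain rfl : a31 = a34 * c21 - a34 * b22 + a12 * a34 * b23 + a22 * b34 - a12 * a23 * b34 := by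
    linear_combination ab34
  obtain rfl : a42 = -a34 * b12 * c23 - a12 * c21 + a12 * a22 * c23 - a12 * a23 * c22
      + a34 * b23 * c12 := by
    linear_combination -ac22
  obtain rfl : b21 = a22 * b23 - a23 * b22 := by
    linear_combination -ab23
  obtain rfl : b32 = a34 * b23 * c12 + b12 * b34 + a12^2 * b23 - a12 * b22 := by
    linear_combination -ac22 + ab12
  obtain rfl : b43 = b22 * c23 - b23 * c22 := by
    linear_combination -bc23
  obtain rfl : c31 = -a12 * c21 - a23 * b34 * c12 + a34 * b23 * c12 := by
    linear_combination ac11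
  obtain rfl : c42 = -c12 * c21 + a22 * c12 * c23 - a23 * c12 * c22 - a12 * b23 * c12
      + a12 * b12 * c23 - b12 * c22 + b22 * c12 := by
    linear_combination bc12
  obtain rfl : a41 = a34 * b22 * c23 - a34 * b23 * c22 + b34 * c21 - a22 * b34 * c23
      + a23 * b34 * c22 := by
    linear_combination -ab11 - ab33
  obtain rfl : b31 = a34 * b12 * b23 - a12 * a22 * b23 - a23 * b12 * b34 + a12 * a23 * b22
      + a34 * b22 * c23 - a34 * b23 * c22 + b34 * c21 - a22 * b34 * c23 + a23 * b34 * c22 := by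
    linear_combination -ab33
  obtain rfl : b42 = a22 * b23 * c12 - a23 * b22 * c12 - b12 * c21 + b23 * b34 * c12
      - a12 * b23 * c22 - b12 * b34 * c23 + a12 * b22 * c23 := by
    linear_combination -bc22
  obtain rfl : c41 = -a23 * b22 * c12 + a22 * b23 * c12 - b12 * c21 := by
    linear_combination -ac43
  obtain rfl : b41 = -a34 * b12 * b23 * c23 - 2 * a12 * b23 * c21 + 2 * a12 * a22 * b23 * c23
      + a34 * b23^2 * c12 - a22 * a23 * b23 * c12 + a23^2 * b22 * c12 + a23 * b12 * c21
      - a23 * b23 * b34 * c12 + a23 * b12 * b34 * c23 - 2 * a12 * a23 * b22 * c23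
      - a22 * b23 * c22 - a34 * b22 * c23^2 + a34 * b23 * c22 * c23 - c21^2 + b22 * c21
      - b34 * c21 * c23 + a22 * c21 * c23 + a22 * b34 * c23^2 - a23 * c21 * c22 + a23 * b22 * c22
      - a23 * b34 * c22 * c23 := by
    linear_combination -ab43
  exact ⟨![a12, a23, a34, c12, c23, a22, b12, b23, b34, c22, b22, c21],
    by simp [chartMat], by simp [chartMat], by simp [chartMat]⟩

end Chart

/-! ### Commuting subspaces of `sl₄` and Cartan subalgebras -/

section Commuting

/-- The matrices in `W` commute with each other, that is, `W` is an abelian subalgebra. -/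
def IsCommuting (W : Submodule ℂ sl4) : Prop :=
  ∀ X ∈ W, ∀ Y ∈ W, X.1 * Y.1 = Y.1 * X.1

theorem lie_eq_zero_iff {X Y : sl4} : ⁅X, Y⁆ = 0 ↔ X.1 * Y.1 = Y.1 * X.1 := by
  rw [← sub_eq_zero (a := X.1 * Y.1), ← LieAlgebra.SpecialLinear.sl_bracket]
  exact ⟨fun h => by rw [h]; rfl, fun h => Subtype.ext h⟩

/-- The trace-free representation of `sl₄` on `ℂ⁴` is irreducible and faithful. -/
instance : LieAlgebra.HasTrivialRadical ℂ sl4 := by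
  have : LieModule.IsIrreducible ℂ sl4 (Fin 4 → ℂ) := by
    refine LieModule.IsIrreducible.mk fun N hN => ?_
    obtain ⟨v, hv, hv0⟩ : ∃ v ∈ N, v ≠ 0 := by
      by_contra! h
      exact hN ((LieSubmodule.eq_bot_iff N).2 h)
    obtain ⟨j, hj⟩ := Function.ne_iff.1 hv0
    have hE : ∀ i j, i ≠ j → ∀ w ∈ N, w j ≠ 0 → (Pi.single i 1 : Fin 4 → ℂ) ∈ N := by
      intro i j hij w hw hwj
      have h := N.lie_mem (x := LieAlgebra.SpecialLinear.single (R := ℂ) i j hij (w j)⁻¹) hw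
      have h' : ⁅LieAlgebra.SpecialLinear.single (R := ℂ) i j hij (w j)⁻¹, w⁆ =
          (Matrix.single i j (w j)⁻¹) *ᵥ w := rfl
      rw [h', Matrix.single_mulVec, inv_mul_cancel₀ hwj] at h
      exact h
    have hN1 : ∀ i, i ≠ j → (Pi.single i 1 : Fin 4 → ℂ) ∈ N := fun i hi => hE i j hi v hv hj
    have hN2 : ∀ i, (Pi.single i 1 : Fin 4 → ℂ) ∈ N := by
      intro i
      by_cases hi : i = j
      · obtain ⟨k, hk⟩ := exists_ne j
        exact hE i k (hi ▸ hk.symm) _ (hN1 k hk) (by simp)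
      · exact hN1 i hi
    rw [eq_top_iff]
    intro w _
    rw [pi_eq_sum_univ' w]
    exact sum_mem fun i _ => N.smul_mem _ (by
      convert! hN2 i using 1)
  refine LieAlgebra.hasTrivialRadical_of_isIrreducible_of_isFaithful ℂ sl4 (Fin 4 → ℂ) fun X => ?_
  have h : LieModule.toEnd ℂ sl4 (Fin 4 → ℂ) X = Matrix.toLin' X.1 := rfl
  rw [h, Matrix.trace_toLin'_eq]
  exact X.2

theorem isCommuting_of_mem_red4Open {W : Gr 3 sl4} (hW : W ∈ red4Open) : IsCommuting W.1 := by
  obtain ⟨H, hH, hHW⟩ := hW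
  intro X hX Y hY
  rw [← hHW] at hX hY
  have h := LieModule.IsTrivial.trivial (L := H) (M := H) ⟨X, hX⟩ ⟨Y, hY⟩
  exact lie_eq_zero_iff.1 (congrArg Subtype.val h)

/-- The alternating form `f [u, v] h w + f [v, w] h u + f [w, u] h v`. -/
def lieForm (f h : Module.Dual ℂ sl4) : sl4 [⋀^Fin 3]→ₗ[ℂ] ℂ where
  toFun u := f ⁅u 0, u 1⁆ * h (u 2) + f ⁅u 1, u 2⁆ * h (u 0) + f ⁅u 2, u 0⁆ * h (u 1)
  map_update_add' {inst} u i x y := by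
    obtain rfl : inst = instDecidableEqFin 3 := Subsingleton.elim _ _
    fin_cases i <;> simp [Function.update] <;> ring
  map_update_smul' {inst} u i c x := by
    obtain rfl : inst = instDecidableEqFin 3 := Subsingleton.elim _ _
    fin_cases i <;> simp [Function.update] <;> ring
  map_eq_zero_of_eq' u i j huij hij := by
    have hs : ∀ X Y : sl4, f ⁅X, Y⁆ = -f ⁅Y, X⁆ := fun X Y => by rw [← lie_skew, map_neg]
    fin_cases i <;> fin_cases j <;> simp at hij huij <;> simp [huij]
    · linear_combination hs (u 1) (u 2) * h (u 1)
    · linear_combination hs (u 2) (u 1) * h (u 2)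
    · linear_combination hs (u 0) (u 2) * h (u 0)
    · linear_combination hs (u 0) (u 2) * h (u 2)
    · linear_combination hs (u 0) (u 1) * h (u 0)
    · linear_combination hs (u 0) (u 1) * h (u 1)

theorem isCommuting_of_mem_red4 {W : Gr 3 sl4} (hW : W ∈ red4) : IsCommuting W.1 := by
  have hlin : ∀ (f h : Module.Dual ℂ sl4) (U : Gr 3 sl4),
      U ∈ zeroLocus (MvPolynomial.X (lieForm f h)) ↔
        ∀ u : Fin 3 → sl4, (∀ i, u i ∈ U.1) → lieForm f h u = 0 := fun f h U => by
    simp [zeroLocus]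
  have hW' : ∀ f h : Module.Dual ℂ sl4, W ∈ zeroLocus (MvPolynomial.X (lieForm f h)) := by
    intro f h
    have hcl : IsClosed (zeroLocus (k := 3) (MvPolynomial.X (lieForm f h))) :=
      ⟨TopologicalSpace.isOpen_generateFrom_of_mem ⟨1, _, MvPolynomial.isHomogeneous_X _ _, rfl⟩⟩
    refine closure_minimal (fun U hU => (hlin f h U).2 fun u hu => ?_) hcl hW
    have hc := isCommuting_of_mem_red4Open hU
    have h0 : ∀ i j, ⁅u i, u j⁆ = 0 := fun i j => lie_eq_zero_iff.2 (hc _ (hu i) _ (hu j))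
    simp [lieForm, h0]
  intro X hX Y hY
  rw [← lie_eq_zero_iff, ← Module.forall_dual_apply_eq_zero_iff ℂ]
  intro f
  by_contra hf
  -- A vector of `W` outside of the span of `X` and `Y`, and a linear form that isolates it.
  have := W.finiteDimensional three_pos
  have hlt : Submodule.span ℂ {X, Y} < W.1 := by
    refine lt_of_le_of_ne (Submodule.span_le.2 fun Z hZ => ?_) fun he => ?_
    · rcases hZ with rfl | rfl <;> assumption
    · have h1 := (finrank_span_finset_le_card (R := ℂ) ({X, Y} : Finset sl4)).trans
        Finset.card_le_two
      have h3 := W.2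
      rw [← he] at h3
      rw [Finset.coe_pair] at h1
      exact absurd (h3.symm.trans_le h1) (by norm_num)
  obtain ⟨Z, hZ, hZn⟩ := SetLike.exists_of_lt hlt
  obtain ⟨h, hh, hhZ⟩ := Submodule.exists_dual_map_eq_bot_of_notMem hZn inferInstance
  have h1 : ∀ V ∈ Submodule.span ℂ {X, Y}, h V = 0 := fun V hV => by
    have : h V ∈ (Submodule.span ℂ {X, Y}).map h := ⟨V, hV, rfl⟩
    rwa [hhZ, Submodule.mem_bot] at this
  have h2 := (hlin f h W).1 (hW' f h) ![X, Y, Z] (by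
    intro i
    fin_cases i <;> assumption)
  simp [lieForm, h1 X (Submodule.subset_span (by simp)), h1 Y (Submodule.subset_span (by simp)),
    hf, hh] at h2

end Commuting

/-! ### The points of the chart -/

section ChartPoint

/-- The projection of a matrix to its trace-free part. -/
def tracelessPart : Matrix (Fin 4) (Fin 4) ℂ →ₗ[ℂ] sl4 where
  toFun X := ⟨X - (X.trace / 4) • 1, by
    rw [mem_sl4, Matrix.trace_sub, Matrix.trace_smul, Matrix.trace_one]
    simp⟩
  map_add' X Y := Subtype.ext (by
    change X + Y - ((X + Y).trace / 4) • (1 : Matrix (Fin 4) (Fin 4) ℂ) =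
      (X - (X.trace / 4) • 1) + (Y - (Y.trace / 4) • 1)
    rw [Matrix.trace_add, add_div, add_smul]
    abel)
  map_smul' c X := Subtype.ext (by
    change c • X - ((c • X).trace / 4) • (1 : Matrix (Fin 4) (Fin 4) ℂ) =
      c • (X - (X.trace / 4) • 1)
    rw [Matrix.trace_smul, smul_sub, smul_smul, smul_eq_mul, mul_div_assoc])

theorem tracelessPart_val (X : Matrix (Fin 4) (Fin 4) ℂ) :
    (tracelessPart X).1 = X - (X.trace / 4) • 1 := rfl

theorem tracelessPart_apply_of_ne (X : Matrix (Fin 4) (Fin 4) ℂ) {i j : Fin 4} (hij : i ≠ j) :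
    (tracelessPart X).1 i j = X i j := by
  rw [tracelessPart_val]
  simp [hij]

theorem tracelessPart_sub_smul_one (X : sl4) (c : ℂ) : tracelessPart (X.1 - c • 1) = X := by
  refine Subtype.ext ?_
  rw [tracelessPart_val, Matrix.trace_sub, Matrix.trace_smul, mem_sl4.1 X.2, Matrix.trace_one]
  ext i j
  simp only [Matrix.sub_apply, Matrix.smul_apply, Matrix.one_apply, smul_eq_mul, Fintype.card_fin]
  split_ifs
  · simp
    ring
  · simp

theorem tracelessPart_mul_comm {X Y : Matrix (Fin 4) (Fin 4) ℂ} (h : X * Y = Y * X) :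
    (tracelessPart X).1 * (tracelessPart Y).1 = (tracelessPart Y).1 * (tracelessPart X).1 := by
  rw [tracelessPart_val, tracelessPart_val]
  simp only [sub_mul, mul_sub, h, smul_mul_assoc, mul_smul_comm, one_mul, mul_one, smul_sub]
  rw [smul_comm]
  abel

/-- The three matrix entries whose independence on a subspace defines the chart. -/
def chartEntries : sl4 →ₗ[ℂ] Fin 3 → ℂ where
  toFun X := ![X.1 0 2, X.1 0 3, X.1 1 3]
  map_add' X Y := by
    funext i
    fin_cases i <;> rfl
  map_smul' c X := by
    funext i
    fin_cases i <;> rfl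

/-- The subspaces on which the three entries are independent. -/
def InChart (W : Submodule ℂ sl4) : Prop :=
  ∀ X ∈ W, chartEntries X = 0 → X = 0

/-- The basis of the point of the chart with coordinates `x`. -/
def chartFrame (x : Fin 12 → ℂ) (k : Fin 3) : sl4 := tracelessPart (chartMat x k)

theorem chartEntries_tracelessPart (X : Matrix (Fin 4) (Fin 4) ℂ) :
    chartEntries (tracelessPart X) = ![X 0 2, X 0 3, X 1 3] := by
  simp only [chartEntries, LinearMap.coe_mk, AddHom.coe_mk]
  rw [tracelessPart_apply_of_ne _ (by decide), tracelessPart_apply_of_ne _ (by decide),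
    tracelessPart_apply_of_ne _ (by decide)]

theorem chartEntries_chartFrame (x : Fin 12 → ℂ) (k : Fin 3) :
    chartEntries (chartFrame x k) = Pi.single k 1 := by
  rw [chartFrame, chartEntries_tracelessPart]
  funext i
  fin_cases k <;> fin_cases i <;> simp [chartMat]

theorem linearIndependent_chartFrame (x : Fin 12 → ℂ) : LinearIndependent ℂ (chartFrame x) := by
  refine LinearIndependent.of_comp chartEntries ?_
  have : chartEntries ∘ chartFrame x = fun k => Pi.single k 1 :=
    funext fun k => chartEntries_chartFrame x k
  rw [this]
  exact Pi.linearIndependent_single_one (Fin 3) ℂ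

/-- The point of the chart with coordinates `x`. -/
def chartPoint (x : Fin 12 → ℂ) : Gr 3 sl4 :=
  spanGr (chartFrame x) (linearIndependent_chartFrame x)

theorem isCommuting_span {ι : Type*} {u : ι → sl4}
    (h : ∀ i j, (u i).1 * (u j).1 = (u j).1 * (u i).1) :
    IsCommuting (Submodule.span ℂ (Set.range u)) := by
  intro X hX Y hY
  induction hX, hY using Submodule.span_induction₂ with
  | mem_mem X Y hX hY =>
    obtain ⟨i, rfl⟩ := hX
    obtain ⟨j, rfl⟩ := hY
    exact h i j
  | zero_left Y _ => simp
  | zero_right X _ => simp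
  | add_left X Y Z _ _ _ h1 h2 => simp [add_mul, mul_add, h1, h2]
  | add_right X Y Z _ _ _ h1 h2 => simp [add_mul, mul_add, h1, h2]
  | smul_left c X Y _ _ h1 => simp [h1]
  | smul_right c X Y _ _ h1 => simp [h1]

theorem isCommuting_chartPoint (x : Fin 12 → ℂ) : IsCommuting (chartPoint x).1 :=
  isCommuting_span fun k l => tracelessPart_mul_comm (chartMat_mul_comm x k l)

theorem chartFrame_mem (x : Fin 12 → ℂ) (k : Fin 3) : chartFrame x k ∈ (chartPoint x).1 :=
  Submodule.subset_span ⟨k, rfl⟩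

/-- The commuting subspaces in the chart form an affine space of dimension twelve. -/
theorem exists_eq_chartPoint {W : Gr 3 sl4} (hW : IsCommuting W.1) (hc : InChart W.1) :
    ∃ x, W = chartPoint x := by
  have := W.finiteDimensional three_pos
  have hinj : Function.Injective (chartEntries.comp W.1.subtype) := by
    rw [← LinearMap.ker_eq_bot, LinearMap.ker_eq_bot']
    exact fun X hX => Subtype.ext (hc X X.2 hX)
  have hsurj : Function.Surjective (chartEntries.comp W.1.subtype) :=
    (LinearMap.injective_iff_surjective_of_finrank_eq_finrank
      (by rw [W.2, Module.finrank_fin_fun])).1 hinj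
  choose X hX using fun k : Fin 3 => hsurj (Pi.single k 1)
  have hX' : ∀ k, chartEntries (X k).1 = Pi.single k 1 := hX
  let M : Fin 3 → Matrix (Fin 4) (Fin 4) ℂ := fun k => (X k).1.1 - (X k).1.1 2 2 • 1
  have hM : ∀ k l, M k * M l = M l * M k := by
    intro k l
    simp only [M, sub_mul, mul_sub, hW _ (X k).2 _ (X l).2, smul_mul_assoc, mul_smul_comm,
      one_mul, mul_one, smul_sub]
    rw [smul_comm]
    abel
  have hoff : ∀ k i j, i ≠ j → M k i j = (X k).1.1 i j := fun k i j hij => by simp [M, hij]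
  have h13 : ∀ k, (X k).1.1 0 2 = (Pi.single k 1 : Fin 3 → ℂ) 0 := fun k => congrFun (hX' k) 0
  have h14 : ∀ k, (X k).1.1 0 3 = (Pi.single k 1 : Fin 3 → ℂ) 1 := fun k => congrFun (hX' k) 1
  have h24 : ∀ k, (X k).1.1 1 3 = (Pi.single k 1 : Fin 3 → ℂ) 2 := fun k => congrFun (hX' k) 2
  obtain ⟨x, h0, h1, h2⟩ := eq_chartMat_of_commute (hM 0 1) (hM 0 2) (hM 1 2)
    (by rw [hoff _ _ _ (by decide), h13]; simp) (by rw [hoff _ _ _ (by decide), h14]; simp)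
    (by rw [hoff _ _ _ (by decide), h24]; simp) (by simp [M])
    (by rw [hoff _ _ _ (by decide), h13]; simp) (by rw [hoff _ _ _ (by decide), h14]; simp)
    (by rw [hoff _ _ _ (by decide), h24]; simp) (by simp [M])
    (by rw [hoff _ _ _ (by decide), h13]; simp) (by rw [hoff _ _ _ (by decide), h14]; simp)
    (by rw [hoff _ _ _ (by decide), h24]; simp) (by simp [M])
  have hMx : ∀ k, M k = chartMat x k := by
    intro k
    fin_cases k
    exacts [h0, h1, h2]
  refine ⟨x, Subtype.ext (Submodule.eq_of_le_of_finrank_eq (Submodule.span_le.2 ?_) ?_).symm⟩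
  · rintro _ ⟨k, rfl⟩
    rw [chartFrame, ← hMx, tracelessPart_sub_smul_one]
    exact (X k).2
  · rw [W.2]
    exact (chartPoint x).2

theorem chartMat_map {R R' : Type*} [CommRing R] [CommRing R'] (φ : R →+* R') (x : Fin 12 → R)
    (k : Fin 3) : (chartMat x k).map φ = chartMat (fun i => φ (x i)) k := by
  ext i j
  rw [Matrix.map_apply]
  fin_cases k <;> fin_cases i <;> fin_cases j <;>
    simp only [Fin.zero_eta, Fin.mk_one, Fin.reduceFinMk, Fin.isValue, chartMat, Matrix.cons_val,
      Matrix.of_apply, map_add, map_sub, map_mul, map_neg, map_pow, map_one, map_zero, map_ofNat]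

theorem chartMat_mem {T : Type*} (S : Subalgebra ℂ (T → ℂ)) (x : T → Fin 12 → ℂ)
    (hx : ∀ i, (fun t => x t i) ∈ S) (k : Fin 3) (i j : Fin 4) :
    (fun t => chartMat (x t) k i j) ∈ S := by
  have h : (fun t => chartMat (x t) k i j) =
      (chartMat (fun i => (⟨fun t => x t i, hx i⟩ : S)) k i j).1 := by
    funext t
    have := congrFun (congrFun (chartMat_map ((Pi.evalRingHom (fun _ : T => ℂ) t).comp
      S.subtype) (fun i => (⟨fun t => x t i, hx i⟩ : S)) k) i) j
    exact this.symm
  rw [h]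
  exact Subtype.prop _

theorem chartFrame_mem_subalgebra {T : Type*} (S : Subalgebra ℂ (T → ℂ)) (x : T → Fin 12 → ℂ)
    (hx : ∀ i, (fun t => x t i) ∈ S) (f : Module.Dual ℂ sl4) (k : Fin 3) :
    (fun t => f (chartFrame (x t) k)) ∈ S := by
  have h : (fun t => f (chartFrame (x t) k)) = ∑ i, ∑ j,
      (fun t => chartMat (x t) k i j) *
        algebraMap ℂ (T → ℂ) (f (tracelessPart (Matrix.single i j 1))) := by
    funext t
    rw [chartFrame]
    conv_lhs => rw [Matrix.matrix_eq_sum_single (chartMat (x t) k)]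
    simp only [map_sum, Finset.sum_apply, Pi.mul_apply]
    refine Finset.sum_congr rfl fun i _ => Finset.sum_congr rfl fun j _ => ?_
    rw [← mul_one (chartMat (x t) k i j), ← smul_eq_mul, ← Matrix.smul_single, map_smul, map_smul]
    simp
  rw [h]
  exact S.sum_mem fun i _ => S.sum_mem fun j _ =>
    S.mul_mem (chartMat_mem S x hx k i j) (S.algebraMap_mem _)

theorem o6Point_eq_chartPoint : o6Point = chartPoint 0 := by
  have h : ∀ k, chartFrame 0 k = o6Map (Pi.single k 1) := by
    intro k
    refine Subtype.ext ?_
    rw [chartFrame, tracelessPart_val]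
    have : chartMat (0 : Fin 12 → ℂ) k = (o6Map (Pi.single k 1)).1 := by
      ext i j
      fin_cases k <;> fin_cases i <;> fin_cases j <;> simp [chartMat, o6Map]
    rw [this, mem_sl4.1 (o6Map (Pi.single k 1)).2]
    simp
  refine Subtype.ext (Submodule.eq_of_le_of_finrank_eq (Submodule.span_le.2 ?_) ?_).symm
  · rintro _ ⟨k, rfl⟩
    rw [h]
    exact ⟨_, rfl⟩
  · exact (chartPoint 0).2.trans o6Point.2.symm

/-! ### The contraction of the chart to `o6Point` -/

/-- The diagonal matrix `(s, s², s³, s⁴)`. -/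
def torus (s : ℂˣ) : GL (Fin 4) ℂ where
  val := Matrix.diagonal fun i => (s : ℂ) ^ (i.1 + 1)
  inv := Matrix.diagonal fun i => ((s⁻¹ : ℂˣ) : ℂ) ^ (i.1 + 1)
  val_inv := by
    rw [Matrix.diagonal_mul_diagonal, ← Matrix.diagonal_one]
    congr 1
    funext i
    rw [← mul_pow, Units.mul_inv, one_pow]
  inv_val := by
    rw [Matrix.diagonal_mul_diagonal, ← Matrix.diagonal_one]
    congr 1
    funext i
    rw [← mul_pow, Units.inv_mul, one_pow]

/-- The weights of the coordinates of the chart under the torus: all of them are positive. -/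
def chartWeight : Fin 12 → ℕ := ![1, 1, 1, 1, 1, 2, 2, 2, 2, 2, 3, 3]

theorem torus_mul_chartMat (s : ℂ) (x : Fin 12 → ℂ) (k : Fin 3) :
    chartMat (fun i => s ^ chartWeight i * x i) k *
        Matrix.diagonal (fun i : Fin 4 => s ^ (i.1 + 1)) =
      s ^ (![2, 3, 2] k) • (Matrix.diagonal (fun i : Fin 4 => s ^ (i.1 + 1)) * chartMat x k) := by
  ext i j
  rw [Matrix.mul_diagonal, Matrix.smul_apply, Matrix.diagonal_mul, smul_eq_mul]
  fin_cases k <;> fin_cases i <;> fin_cases j <;>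
    simp only [Fin.zero_eta, Fin.mk_one, Fin.reduceFinMk, Fin.isValue, chartMat, Matrix.cons_val,
      Matrix.of_apply, chartWeight] <;> ring

theorem conj_tracelessPart (g : GL (Fin 4) ℂ) (X : Matrix (Fin 4) (Fin 4) ℂ) :
    conj g (tracelessPart X) = tracelessPart (g.1 * X * g⁻¹.1) := by
  have h : (g.1 * X * g⁻¹.1).trace = X.trace := by
    rw [Matrix.trace_mul_comm, ← Matrix.mul_assoc, Units.inv_mul, Matrix.one_mul]
  refine Subtype.ext ?_
  rw [tracelessPart_val, h]
  change g.1 * (X - (X.trace / 4) • 1) * g⁻¹.1 = _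
  rw [mul_sub, sub_mul, mul_smul_comm, smul_mul_assoc, mul_one, Units.mul_inv]

theorem torus_smul_chartPoint (s : ℂˣ) (x : Fin 12 → ℂ) :
    torus s • chartPoint x = chartPoint fun i => (s : ℂ) ^ chartWeight i * x i := by
  refine Subtype.ext (Submodule.eq_of_le_of_finrank_eq (Submodule.span_le.2 ?_) ?_).symm
  · rintro _ ⟨k, rfl⟩
    refine ⟨(s : ℂ) ^ (![2, 3, 2] k) • chartFrame x k,
      Submodule.smul_mem _ _ (chartFrame_mem x k), ?_⟩
    change conj (torus s) _ = _
    rw [map_smul, chartFrame, conj_tracelessPart, ← map_smul, ← smul_mul_assoc]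
    have h := torus_mul_chartMat s x k
    change _ * (torus s).1 = _ • ((torus s).1 * _) at h
    rw [← h, Matrix.mul_assoc, Units.mul_inv, Matrix.mul_one]
    rfl
  · exact (chartPoint _).2.trans (torus s • chartPoint x).2.symm

theorem o6Point_mem_closure_orbit_chartPoint (x : Fin 12 → ℂ) :
    o6Point ∈ closure (MulAction.orbit (GL (Fin 4) ℂ) (chartPoint x)) := by
  have hinf : {t : ℂ | spanGr (chartFrame fun i => t ^ chartWeight i * x i)
      (linearIndependent_chartFrame _) ∈
        closure (MulAction.orbit (GL (Fin 4) ℂ) (chartPoint x))}.Infinite := by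
    refine (Set.finite_singleton (0 : ℂ)).infinite_compl.mono fun t ht => subset_closure ?_
    exact ⟨torus (Units.mk0 t ht), torus_smul_chartPoint _ x⟩
  have h := curve_mem_of_isClosed isClosed_closure
    (fun t : ℂ => chartFrame fun i => t ^ chartWeight i * x i)
    (fun t => linearIndependent_chartFrame _) (fun f k => chartFrame_mem_subalgebra polyFun
      (fun (t : ℂ) i => t ^ chartWeight i * x i) (fun i => mem_polyFun.2
        ⟨Polynomial.X ^ chartWeight i * Polynomial.C (x i), fun t => by
          rw [Polynomial.eval_mul, Polynomial.eval_pow, Polynomial.eval_X,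
            Polynomial.eval_C]⟩) f k) hinf 0
  rw [o6Point_eq_chartPoint]
  have h0 : (fun i => (0 : ℂ) ^ chartWeight i * x i) = 0 := by
    funext i
    fin_cases i <;> simp [chartWeight]
  rwa [← h0]

theorem smul_mem_closure_orbit (g : GL (Fin 4) ℂ) {W U : Gr 3 sl4}
    (hU : U ∈ closure (MulAction.orbit (GL (Fin 4) ℂ) W)) :
    g • U ∈ closure (MulAction.orbit (GL (Fin 4) ℂ) W) :=
  Gr.map_mem_closure (conj g) (fun U' hU' => by
    obtain ⟨g', rfl⟩ := hU'
    exact ⟨g * g', mul_smul g g' W⟩) hU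

/-- The torus contracts the chart to `o6Point`, so the closure of each orbit that meets the chart
contains `orbitO6`. -/
theorem orbitO6_subset_closure_orbit {W : Gr 3 sl4} {g : GL (Fin 4) ℂ} {x : Fin 12 → ℂ}
    (h : g • W = chartPoint x) :
    orbitO6 ⊆ closure (MulAction.orbit (GL (Fin 4) ℂ) W) := by
  rintro _ ⟨g', rfl⟩
  refine smul_mem_closure_orbit g' ?_
  rw [← MulAction.orbit_smul g W, h]
  exact o6Point_mem_closure_orbit_chartPoint x

end ChartPoint

/-! ### Commuting subspaces with a regular semisimple element -/

section Regular

/-- The subspace contains, up to a scalar matrix, a matrix with four distinct eigenvalues. -/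
def HasRegularElement (W : Submodule ℂ sl4) : Prop :=
  ∃ X : Matrix (Fin 4) (Fin 4) ℂ, tracelessPart X ∈ W ∧ X.charpoly.Separable

theorem exists_conj_eq_diagonal {X : Matrix (Fin 4) (Fin 4) ℂ} (hX : X.charpoly.Separable) :
    ∃ (g : GL (Fin 4) ℂ) (μ : Fin 4 → ℂ), Function.Injective μ ∧
      g.1 * X * g⁻¹.1 = Matrix.diagonal μ := by
  have hcard : X.charpoly.roots.toFinset.card = 4 := by
    rw [Multiset.toFinset_card_of_nodup (Polynomial.nodup_roots hX),
      (Polynomial.splits_iff_card_roots.1 (IsAlgClosed.splits X.charpoly)),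
      Matrix.charpoly_natDegree_eq_dim, Fintype.card_fin]
  let e := (Finset.equivFinOfCardEq hcard).symm
  let μ : Fin 4 → ℂ := fun i => e i
  have hμ : Function.Injective μ := Subtype.val_injective.comp e.injective
  have hev : ∀ i, Module.End.HasEigenvalue (Matrix.toLin' X) (μ i) := by
    intro i
    rw [Module.End.hasEigenvalue_iff_isRoot_charpoly, Matrix.charpoly_toLin']
    exact Polynomial.isRoot_of_mem_roots (Multiset.mem_toFinset.1 (e i).2)
  choose v hv using fun i => (hev i).exists_hasEigenvector
  have hind := Module.End.eigenvectors_linearIndependent' (Matrix.toLin' X) μ hμ v hv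
  let P : Matrix (Fin 4) (Fin 4) ℂ := Matrix.of fun i j => v j i
  have hP : IsUnit P := Matrix.linearIndependent_cols_iff_isUnit.1 hind
  have hXP : X * P = P * Matrix.diagonal μ := by
    ext i j
    rw [Matrix.mul_diagonal]
    have h := congrFun (hv j).apply_eq_smul i
    rw [Matrix.toLin'_apply, Pi.smul_apply, smul_eq_mul, mul_comm] at h
    exact h
  refine ⟨hP.unit⁻¹, μ, hμ, ?_⟩
  rw [inv_inv]
  change hP.unit⁻¹.1 * X * P = _
  rw [Matrix.mul_assoc, hXP, ← Matrix.mul_assoc]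
  have : hP.unit⁻¹.1 * P = 1 := hP.unit.inv_mul
  rw [this, Matrix.one_mul]

theorem eq_zero_of_commute_diagonal {μ : Fin 4 → ℂ} (hμ : Function.Injective μ)
    {Z : Matrix (Fin 4) (Fin 4) ℂ} (h : Z * Matrix.diagonal μ = Matrix.diagonal μ * Z)
    (hZ : ∀ i, Z i i = 0) : Z = 0 := by
  ext i j
  by_cases hij : i = j
  · rw [← hij, hZ i]
    rfl
  · have := congrFun (congrFun h i) j
    rw [Matrix.mul_diagonal, Matrix.diagonal_mul, mul_comm] at this
    have h0 : (μ j - μ i) * Z i j = 0 := by rw [sub_mul, this, sub_self]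
    exact (mul_eq_zero.1 h0).resolve_left (sub_ne_zero.2 fun h => hij (hμ h).symm)

theorem conj_apply_val (g : GL (Fin 4) ℂ) (X : sl4) : (conj g X).1 = g.1 * X.1 * g⁻¹.1 := rfl

theorem conj_val_mul (g : GL (Fin 4) ℂ) (X Y : sl4) :
    (conj g X).1 * (conj g Y).1 = g.1 * (X.1 * Y.1) * g⁻¹.1 := by
  rw [conj_apply_val, conj_apply_val]
  simp only [Matrix.mul_assoc]
  rw [← Matrix.mul_assoc g⁻¹.1 g.1, Units.inv_mul, Matrix.one_mul]

theorem isCommuting_map_conj {W : Submodule ℂ sl4} (hW : IsCommuting W) (g : GL (Fin 4) ℂ) :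
    IsCommuting (W.map (conj g : sl4 →ₗ[ℂ] sl4)) := by
  rintro _ ⟨X, hX, rfl⟩ _ ⟨Y, hY, rfl⟩
  change (conj g X).1 * (conj g Y).1 = (conj g Y).1 * (conj g X).1
  rw [conj_val_mul, conj_val_mul, hW X hX Y hY]

/-- A three-dimensional commuting subspace with a regular element is the centralizer of this
element, and it is its own normalizer. -/
theorem mem_red4Open_of_hasRegularElement {W : Gr 3 sl4} (hW : IsCommuting W.1)
    (hr : HasRegularElement W.1) : W ∈ red4Open := by
  have := W.finiteDimensional three_pos
  obtain ⟨X, hX, hsep⟩ := hr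
  obtain ⟨g, μ, hμ, hg⟩ := exists_conj_eq_diagonal hsep
  have hTd : (conj g (tracelessPart X)).1 =
      Matrix.diagonal μ - ((Matrix.diagonal μ).trace / 4) • 1 := by
    rw [conj_tracelessPart, hg, tracelessPart_val]
  have hcomm : ∀ Z : sl4, Z.1 * (tracelessPart X).1 = (tracelessPart X).1 * Z.1 →
      (conj g Z).1 * Matrix.diagonal μ = Matrix.diagonal μ * (conj g Z).1 := by
    intro Z hZ
    have h : (conj g Z).1 * (conj g (tracelessPart X)).1 =
        (conj g (tracelessPart X)).1 * (conj g Z).1 := by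
      rw [conj_val_mul, conj_val_mul, hZ]
    rw [hTd] at h
    simpa [mul_sub, sub_mul] using h
  have hzero : ∀ Z : sl4, Z.1 * (tracelessPart X).1 = (tracelessPart X).1 * Z.1 →
      (∀ i, (conj g Z).1 i i = 0) → Z = 0 := by
    intro Z hZ hd
    have := eq_zero_of_commute_diagonal hμ (hcomm Z hZ) hd
    exact (conj g).map_eq_zero_iff.1 (Subtype.ext this)
  -- The first three diagonal entries are coordinates on the centralizer of `X`.
  let ψ : sl4 →ₗ[ℂ] Fin 3 → ℂ :=
    { toFun := fun Z i => (conj g Z).1 i.castSucc i.castSucc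
      map_add' := fun Y Z => by
        funext i
        rw [map_add]
        rfl
      map_smul' := fun c Z => by
        funext i
        rw [map_smul]
        rfl }
  have hψ : ∀ Z : sl4, Z.1 * (tracelessPart X).1 = (tracelessPart X).1 * Z.1 → ψ Z = 0 →
      Z = 0 := by
    intro Z hZ h0
    refine hzero Z hZ fun i => ?_
    have h3 : ∀ i : Fin 3, (conj g Z).1 i.castSucc i.castSucc = 0 := fun i => congrFun h0 i
    have htr := mem_sl4.1 (conj g Z).2
    rw [Matrix.trace, Fin.sum_univ_castSucc] at htr
    simp only [Matrix.diag_apply, h3, Finset.sum_const_zero, zero_add] at htr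
    induction i using Fin.lastCases with
    | last => exact htr
    | cast i => exact h3 i
  have hinj : Function.Injective (ψ.comp W.1.subtype) := by
    rw [← LinearMap.ker_eq_bot, LinearMap.ker_eq_bot']
    exact fun Z hZ => Subtype.ext (hψ Z (hW _ Z.2 _ hX) hZ)
  have hsurj : Function.Surjective (ψ.comp W.1.subtype) :=
    (LinearMap.injective_iff_surjective_of_finrank_eq_finrank
      (by rw [W.2, Module.finrank_fin_fun])).1 hinj
  have hmem : ∀ Z : sl4, Z.1 * (tracelessPart X).1 = (tracelessPart X).1 * Z.1 → Z ∈ W.1 := by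
    intro Z hZ
    obtain ⟨Y, hY⟩ := hsurj (ψ Z)
    have h : Z - Y.1 = 0 := by
      refine hψ _ ?_ ?_
      · change (Z.1 - Y.1.1) * _ = _ * (Z.1 - Y.1.1)
        rw [sub_mul, mul_sub, hZ, hW _ Y.2 _ hX]
      · rw [map_sub, ← hY]
        exact sub_self _
    rw [sub_eq_zero.1 h]
    exact Y.2
  let H : LieSubalgebra ℂ sl4 :=
    { W.1 with
      lie_mem' := fun {Y Z} hY hZ => by
        have h0 : ⁅Y, Z⁆ = 0 := lie_eq_zero_iff.2 (hW Y hY Z hZ)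
        rw [h0]
        exact W.1.zero_mem }
  refine ⟨H, ⟨?_, ?_⟩, rfl⟩
  · have : IsLieAbelian H := ⟨fun Y Z => Subtype.ext (lie_eq_zero_iff.2 (hW Y Y.2 Z Z.2))⟩
    infer_instance
  · refine le_antisymm (fun Z hZ => ?_) (LieSubalgebra.le_normalizer H)
    have h1 : ⁅Z, tracelessPart X⁆ ∈ W.1 := (LieSubalgebra.mem_normalizer_iff H Z).1 hZ _ hX
    refine hmem Z (lie_eq_zero_iff.1 (hzero _ (hW _ h1 _ hX) fun i => ?_))
    have h2 : (conj g ⁅Z, tracelessPart X⁆).1 = (conj g Z).1 * (conj g (tracelessPart X)).1 -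
        (conj g (tracelessPart X)).1 * (conj g Z).1 := by
      rw [conj_val_mul, conj_val_mul, ← sub_mul, ← mul_sub]
      rfl
    rw [h2, hTd]
    simp [mul_sub, sub_mul, mul_comm]

/-- The commuting points of the Grassmannian that contain a regular semisimple element. -/
def regularCommuting : Set (Gr 3 sl4) := {W | IsCommuting W.1 ∧ HasRegularElement W.1}

theorem regularCommuting_subset : regularCommuting ⊆ red4Open :=
  fun _ hW => mem_red4Open_of_hasRegularElement hW.1 hW.2

theorem smul_mem_regularCommuting (g : GL (Fin 4) ℂ) {W : Gr 3 sl4} (hW : W ∈ regularCommuting) :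
    g • W ∈ regularCommuting := by
  refine ⟨isCommuting_map_conj hW.1 g, ?_⟩
  obtain ⟨X, hX, hs⟩ := hW.2
  exact ⟨g.1 * X * g⁻¹.1, ⟨_, hX, conj_tracelessPart g X⟩, by
    rwa [Matrix.coe_units_inv, Matrix.charpoly_units_conj]⟩

theorem smul_mem_closure_regularCommuting (g : GL (Fin 4) ℂ) {W : Gr 3 sl4}
    (hW : W ∈ closure regularCommuting) : g • W ∈ closure regularCommuting :=
  Gr.map_mem_closure (conj g) (fun _ hU => smul_mem_regularCommuting g hU) hW

/-- In a polynomial family of matrices, the characteristic polynomial is separable for infinitely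
many values of the parameter if it is for one of them. -/
theorem infinite_setOf_separable (Y : Matrix (Fin 4) (Fin 4) (Polynomial ℂ)) (t : ℂ)
    (ht : (Y.map (Polynomial.evalRingHom t)).charpoly.Separable) :
    {s | (Y.map (Polynomial.evalRingHom s)).charpoly.Separable}.Infinite := by
  let h := Polynomial.resultant Y.charpoly (Polynomial.derivative Y.charpoly) 4 3
  have hh : ∀ s, h.eval s ≠ 0 ↔ (Y.map (Polynomial.evalRingHom s)).charpoly.Separable := by
    intro s
    have h4 : (Y.map (Polynomial.evalRingHom s)).charpoly.natDegree = 4 := by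
      rw [Matrix.charpoly_natDegree_eq_dim, Fintype.card_fin]
    have h3 : (Polynomial.derivative
        (Y.map (Polynomial.evalRingHom s)).charpoly).natDegree = 3 := by
      rw [Polynomial.natDegree_derivative, h4]
    have h1 : h.eval s = Polynomial.resultant (Y.map (Polynomial.evalRingHom s)).charpoly
        (Polynomial.derivative (Y.map (Polynomial.evalRingHom s)).charpoly) := by
      rw [h4, h3, Matrix.charpoly_map, Polynomial.derivative_map, Polynomial.resultant_map_map]
      rfl
    have h0 : (Y.map (Polynomial.evalRingHom s)).charpoly ≠ 0 :=
      (Matrix.charpoly_monic _).ne_zero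
    rw [h1, Ne, Polynomial.resultant_eq_zero_iff, not_and_not_right]
    exact ⟨fun h => h (Or.inl h0), fun h _ => h⟩
  have hne : h ≠ 0 := fun h0 => (hh t).2 ht (by rw [h0, Polynomial.eval_zero])
  have hfin : {s | ¬h.eval s ≠ 0}.Finite := by
    refine (h.roots.toFinset.finite_toSet).subset fun s hs => ?_
    have : h.eval s = 0 := not_not.1 hs
    simp [hne, this]
  refine hfin.infinite_compl.mono fun s hs => (hh s).1 (not_not.1 hs)

theorem separable_charpoly_of_upperTriangular {X : Matrix (Fin 4) (Fin 4) ℂ}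
    (hX : X.BlockTriangular id) (hd : Function.Injective fun i => X i i) :
    X.charpoly.Separable := by
  rw [Matrix.charpoly_of_isUpperTriangular X hX]
  exact Polynomial.separable_prod_X_sub_C_iff.2 hd

theorem mem_closure_regularCommuting_chartPoint (x : Fin 12 → ℂ) :
    chartPoint x ∈ closure regularCommuting := by
  -- The point with `a₂₂ = b₂₂ = c₂₂ = 1` contains an element with eigenvalues `1, 3, 0, 2`.
  let x₁ : Fin 12 → ℂ := ![0, 0, 0, 0, 0, 1, 0, 0, 0, 1, 1, 0]
  let p : Fin 12 → Polynomial ℂ := fun i =>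
    Polynomial.C (x i) + Polynomial.X * Polynomial.C (x₁ i - x i)
  have hp : ∀ (s : ℂ) i, Polynomial.evalRingHom s (p i) = x i + s * (x₁ i - x i) := by
    intro s i
    simp only [p, Polynomial.coe_evalRingHom, Polynomial.eval_add, Polynomial.eval_mul,
      Polynomial.eval_C, Polynomial.eval_X]
  let Y : Matrix (Fin 4) (Fin 4) (Polynomial ℂ) := ∑ k, chartMat p k
  have hY : ∀ s : ℂ, Y.map (Polynomial.evalRingHom s) =
      ∑ k, chartMat (fun i => x i + s * (x₁ i - x i)) k := by
    intro s
    have h := map_sum (RingHom.mapMatrix (m := Fin 4) (Polynomial.evalRingHom s))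
      (chartMat p) Finset.univ
    refine h.trans (Finset.sum_congr rfl fun k _ => ?_)
    rw [RingHom.mapMatrix_apply, chartMat_map]
    simp only [hp]
  have h1 : (Y.map (Polynomial.evalRingHom 1)).charpoly.Separable := by
    have hx₁ : (fun i => x i + 1 * (x₁ i - x i)) = x₁ := by
      funext i
      ring
    have hM : Y.map (Polynomial.evalRingHom 1) =
        !![1, 0, 1, 1; 0, 3, 0, 1; 0, 0, 0, 0; 0, 0, 0, 2] := by
      rw [hY, hx₁, Fin.sum_univ_three]
      ext i j
      fin_cases i <;> fin_cases j <;> simp [chartMat, x₁] <;> norm_num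
    rw [hM]
    refine separable_charpoly_of_upperTriangular ?_ ?_
    · intro i j hij
      fin_cases i <;> fin_cases j <;> simp at hij ⊢
    · intro i j hij
      fin_cases i <;> fin_cases j <;> simp at hij ⊢
  have hinf := infinite_setOf_separable Y 1 h1
  have h := curve_mem_of_isClosed (isClosed_closure (s := regularCommuting))
    (fun t : ℂ => chartFrame fun i => x i + t * (x₁ i - x i))
    (fun t => linearIndependent_chartFrame _) (fun f k => chartFrame_mem_subalgebra polyFun
      (fun (t : ℂ) i => x i + t * (x₁ i - x i))
      (fun i => mem_polyFun.2 ⟨p i, fun t => hp t i⟩) f k)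
    (hinf.mono fun s hs => subset_closure ⟨isCommuting_chartPoint _, _, ?_, hs⟩) 0
  · have h0 : (fun i => x i + 0 * (x₁ i - x i)) = x := by
      funext i
      ring
    rw [h0] at h
    exact h
  · rw [hY, map_sum]
    exact Submodule.sum_mem _ fun k _ => chartFrame_mem _ k

end Regular

/-! ### Transposition -/

section Transpose

/-- Transposition of traceless matrices. -/
def transposition : sl4 ≃ₗ[ℂ] sl4 where
  toFun X := ⟨X.1ᵀ, by rw [mem_sl4, Matrix.trace_transpose]; exact X.2⟩
  invFun X := ⟨X.1ᵀ, by rw [mem_sl4, Matrix.trace_transpose]; exact X.2⟩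
  map_add' X Y := rfl
  map_smul' c X := rfl
  left_inv X := rfl
  right_inv X := rfl

theorem isCommuting_map_transposition {W : Submodule ℂ sl4} (hW : IsCommuting W) :
    IsCommuting (W.map (transposition : sl4 →ₗ[ℂ] sl4)) := by
  rintro _ ⟨X, hX, rfl⟩ _ ⟨Y, hY, rfl⟩
  change X.1ᵀ * Y.1ᵀ = Y.1ᵀ * X.1ᵀ
  rw [← Matrix.transpose_mul, ← Matrix.transpose_mul, hW X hX Y hY]

theorem map_transposition_mem_regularCommuting {W : Gr 3 sl4} (hW : W ∈ regularCommuting) :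
    W.map transposition ∈ regularCommuting := by
  refine ⟨isCommuting_map_transposition hW.1, ?_⟩
  obtain ⟨X, hX, hs⟩ := hW.2
  refine ⟨Xᵀ, ⟨_, hX, Subtype.ext ?_⟩, by rwa [Matrix.charpoly_transpose]⟩
  change (tracelessPart X).1ᵀ = (tracelessPart Xᵀ).1
  rw [tracelessPart_val, tracelessPart_val, Matrix.trace_transpose, Matrix.transpose_sub,
    Matrix.transpose_smul, Matrix.transpose_one]

end Transpose

/-! ### Commuting spaces of endomorphisms -/

section CommutingEnd

variable {V : Type*} [AddCommGroup V] [Module ℂ V]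

/-- Two linear forms `α₁, α₂` and two vectors `v₃, v₄` with `αᵢ vⱼ = 0`, such that the three
functions `α₁ X v₃`, `α₁ X v₄`, `α₂ X v₄` determine the elements `X` of the space `A` of
endomorphisms up to scalars: in a suitable basis, these functions are the three entries of the
matrix of `X` that define the chart. -/
def HasChartFrame (A : Submodule ℂ (Module.End ℂ V)) : Prop :=
  ∃ (α₁ α₂ : Module.Dual ℂ V) (v₃ v₄ : V), α₁ v₃ = 0 ∧ α₁ v₄ = 0 ∧ α₂ v₃ = 0 ∧ α₂ v₄ = 0 ∧
    ∀ X ∈ A, α₁ (X v₃) = 0 → α₁ (X v₄) = 0 → α₂ (X v₄) = 0 → ∃ c : ℂ, X = c • 1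

variable {A : Submodule ℂ (Module.End ℂ V)}

theorem apply_comm (hA : ∀ X ∈ A, ∀ Y ∈ A, X * Y = Y * X) {X Y : Module.End ℂ V} (hX : X ∈ A)
    (hY : Y ∈ A) (v : V) : X (Y v) = Y (X v) :=
  LinearMap.congr_fun (hA X hX Y hY) v

theorem eq_sum_four (B : Module.Basis (Fin 4) ℂ V) (v : V) :
    v = B.coord 0 v • B 0 + B.coord 1 v • B 1 + B.coord 2 v • B 2 + B.coord 3 v • B 3 := by
  conv_lhs => rw [← B.sum_repr v, Fin.sum_univ_four]
  rfl

theorem exists_basis_of_coord {v : Fin 4 → V} (hV : Module.finrank ℂ V = 4)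
    (h : ∀ c : Fin 4 → ℂ, c 0 • v 0 + c 1 • v 1 + c 2 • v 2 + c 3 • v 3 = 0 → ∀ i, c i = 0) :
    ∃ B : Module.Basis (Fin 4) ℂ V, ∀ i, B i = v i := by
  have hv : LinearIndependent ℂ v := Fintype.linearIndependent_iff.2 fun c hc =>
    h c (by rwa [Fin.sum_univ_four] at hc)
  exact ⟨basisOfLinearIndependentOfCardEqFinrank hv (by rw [hV, Fintype.card_fin]),
    fun i => by rw [coe_basisOfLinearIndependentOfCardEqFinrank]⟩

theorem exists_basis_extension {a b c : V} (hV : Module.finrank ℂ V = 4)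
    (h : LinearIndependent ℂ ![a, b, c]) :
    ∃ B : Module.Basis (Fin 4) ℂ V, B 0 = a ∧ B 1 = b ∧ B 2 = c := by
  have hlt : Submodule.span ℂ (Set.range ![a, b, c]) < ⊤ := by
    refine lt_top_iff_ne_top.2 fun he => ?_
    have h3 := finrank_span_eq_card h
    rw [he, finrank_top, hV, Fintype.card_fin] at h3
    exact absurd h3 (by norm_num)
  obtain ⟨d, -, hd⟩ := SetLike.exists_of_lt hlt
  have h4 : LinearIndependent ℂ (Fin.snoc ![a, b, c] d : Fin 4 → V) :=
    linearIndependent_finSnoc.2 ⟨h, hd⟩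
  refine ⟨basisOfLinearIndependentOfCardEqFinrank h4 (by rw [hV, Fintype.card_fin]), ?_, ?_, ?_⟩ <;>
  · rw [coe_basisOfLinearIndependentOfCardEqFinrank]
    rfl

/-- Unless `A` has a frame, a three-dimensional cyclic subspace of an element of `A` is mapped to
itself by the whole of `A`. -/
theorem coord_three_apply_eq_zero (hA : ∀ X ∈ A, ∀ Y ∈ A, X * Y = Y * X)
    (hno : ¬HasChartFrame A) {n : Module.End ℂ V} (hn : n ∈ A) (B : Module.Basis (Fin 4) ℂ V)
    (h1 : n (B 0) = B 1) (h2 : n (B 1) = B 2) {Z : Module.End ℂ V} (hZ : Z ∈ A) :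
    B.coord 3 (Z (B 0)) = 0 := by
  by_contra hZ3
  refine hno ⟨B.coord 2, B.coord 3, B 1, B 0, by simp, by simp, by simp, by simp,
    fun X hX hX1 hX2 hX3 => ⟨B.coord 0 (X (B 0)), ?_⟩⟩
  have e0 := eq_sum_four B (X (B 0))
  rw [hX2, hX3, zero_smul, add_zero, zero_smul, add_zero] at e0
  have e1 : X (B 1) = B.coord 0 (X (B 0)) • B 1 + B.coord 1 (X (B 0)) • B 2 := by
    conv_lhs => rw [← h1, apply_comm hA hX hn, e0, map_add, map_smul, map_smul, h1, h2]
  have hq : B.coord 1 (X (B 0)) = 0 := by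
    have := congrArg (B.coord 2) e1
    rw [hX1] at this
    simpa using this.symm
  rw [hq, zero_smul, add_zero] at e0 e1
  have e2 : X (B 2) = B.coord 0 (X (B 0)) • B 2 := by
    conv_lhs => rw [← h2, apply_comm hA hX hn, e1, map_smul, h2]
  have ez : X (Z (B 0)) = B.coord 0 (X (B 0)) • Z (B 0) := by
    conv_lhs => rw [apply_comm hA hX hZ, e0, map_smul]
  have e3 : X (B 3) = B.coord 0 (X (B 0)) • B 3 := by
    generalize B.coord 0 (X (B 0)) = c at *
    rw [eq_sum_four B (Z (B 0))] at ez
    simp only [map_add, map_smul, e0, e1, e2, smul_add, smul_comm c] at ez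
    have := add_left_cancel ez
    rw [← sub_eq_zero, ← smul_sub] at this
    exact sub_eq_zero.1 ((smul_eq_zero.1 this).resolve_left hZ3)
  refine B.ext fun i => ?_
  fin_cases i
  exacts [e0, e1, e2, e3]

/-- Unless `A` has a frame, `A` contains no endomorphism `X` of rank one that kills a
three-dimensional cyclic subspace of some `n ∈ A` and whose image is killed by `n`. The first three
vectors of the basis `B` span the cyclic subspace. -/
theorem hasChartFrame_of_rank_one (hV : Module.finrank ℂ V = 4)
    (hA : ∀ X ∈ A, ∀ Y ∈ A, X * Y = Y * X) (h1A : 1 ∈ A)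
    {n : Module.End ℂ V} (hn : n ∈ A) (B : Module.Basis (Fin 4) ℂ V)
    (h1 : n (B 0) = B 1) (h2 : n (B 1) = B 2) {X : Module.End ℂ V} (hX : X ∈ A)
    (hX0 : X (B 0) = 0) (hu : X (B 3) ≠ 0) (hnu : n (X (B 3)) = 0) : HasChartFrame A := by
  by_contra hno
  have hX1 : X (B 1) = 0 := by rw [← h1, apply_comm hA hX hn, hX0, map_zero]
  have hX2 : X (B 2) = 0 := by rw [← h2, apply_comm hA hX hn, hX1, map_zero]
  set u := X (B 3) with hudef
  have hXv : ∀ v, X v = B.coord 3 v • u := by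
    intro v
    conv_lhs => rw [eq_sum_four B v]
    simp only [map_add, map_smul, hX0, hX1, hX2, smul_zero, zero_add]
    rfl
  have hn3 : ∀ v, B.coord 3 (n v) = 0 := by
    intro v
    have h : X (n v) = 0 := by rw [apply_comm hA hX hn, hXv, map_smul, hnu, smul_zero]
    rw [hXv] at h
    exact (smul_eq_zero.1 h).resolve_right hu
  have c00 : B.coord 0 (B 0) = 1 := by simp
  have c11 : B.coord 1 (B 1) = 1 := by simp
  have c22 : B.coord 2 (B 2) = 1 := by simp
  have c33 : B.coord 3 (B 3) = 1 := by simp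
  have c01 : B.coord 0 (B 1) = 0 := by simp
  have c02 : B.coord 0 (B 2) = 0 := by simp
  have c03 : B.coord 0 (B 3) = 0 := by simp
  have c10 : B.coord 1 (B 0) = 0 := by simp
  have c12 : B.coord 1 (B 2) = 0 := by simp
  have c13 : B.coord 1 (B 3) = 0 := by simp
  have c20 : B.coord 2 (B 0) = 0 := by simp
  have c21 : B.coord 2 (B 1) = 0 := by simp
  have c23 : B.coord 2 (B 3) = 0 := by simp
  have c30 : B.coord 3 (B 0) = 0 := by simp
  have c31 : B.coord 3 (B 1) = 0 := by simp
  have c32 : B.coord 3 (B 2) = 0 := by simp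
  by_cases hu3 : B.coord 3 u = 0
  swap
  · -- The cyclic subspace of `B 0 + u` is not stable under `X`.
    obtain ⟨B', hB'⟩ := exists_basis_of_coord (v := ![B 0 + u, B 1, B 2, B 0]) hV (by
      intro c hc
      simp only [Matrix.cons_val] at hc
      have e3 := congrArg (B.coord 3) hc
      simp only [map_add, map_smul, map_zero, smul_eq_mul, c30, c31, c32] at e3
      have hc0 : c 0 = 0 := by
        refine (mul_eq_zero.1 (?_ : c 0 * B.coord 3 u = 0)).resolve_right hu3
        linear_combination e3
      rw [hc0] at hc
      have e0 := congrArg (B.coord 0) hc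
      have e1 := congrArg (B.coord 1) hc
      have e2 := congrArg (B.coord 2) hc
      simp only [map_add, map_smul, map_zero, smul_eq_mul, c00, c01, c02, c10, c11, c12,
        c20, c21, c22] at e0 e1 e2
      intro i
      fin_cases i
      · exact hc0
      · simpa using e1
      · simpa using e2
      · simpa using e0)
    have b0 : B' 0 = B 0 + u := hB' 0
    have b1 : B' 1 = B 1 := hB' 1
    have b2 : B' 2 = B 2 := hB' 2
    have b3 : B' 3 = B 0 := hB' 3
    have h := coord_three_apply_eq_zero hA hno hn B' (by rw [b0, b1, map_add, hnu, h1, add_zero])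
      (by rw [b1, b2, h2]) hX
    have hX' : X (B' 0) = B.coord 3 u • (B' 0 - B' 3) := by
      rw [hXv, b0, b3, map_add, c30, zero_add, add_sub_cancel_left]
    rw [hX', map_smul, map_sub] at h
    simp at h
    exact hu3 h
  obtain ⟨q, hq⟩ : ∃ q, q = B.coord 0 u := ⟨_, rfl⟩
  obtain ⟨p, hp⟩ : ∃ p, p = B.coord 1 u := ⟨_, rfl⟩
  obtain ⟨r, hr⟩ : ∃ r, r = B.coord 2 u := ⟨_, rfl⟩
  have eu := eq_sum_four B u
  rw [hu3, zero_smul, add_zero, ← hq, ← hp, ← hr] at eu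
  obtain ⟨k₀, hk₀⟩ : ∃ k, k = B.coord 0 (n (B 2)) := ⟨_, rfl⟩
  obtain ⟨k₁, hk₁⟩ : ∃ k, k = B.coord 1 (n (B 2)) := ⟨_, rfl⟩
  obtain ⟨k₂, hk₂⟩ : ∃ k, k = B.coord 2 (n (B 2)) := ⟨_, rfl⟩
  have en2 := eq_sum_four B (n (B 2))
  rw [hn3, zero_smul, add_zero, ← hk₀, ← hk₁, ← hk₂] at en2
  obtain ⟨a, ha⟩ : ∃ k, k = B.coord 0 (n (B 3)) := ⟨_, rfl⟩
  obtain ⟨b, hb⟩ : ∃ k, k = B.coord 1 (n (B 3)) := ⟨_, rfl⟩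
  obtain ⟨c, hc⟩ : ∃ k, k = B.coord 2 (n (B 3)) := ⟨_, rfl⟩
  have en3 := eq_sum_four B (n (B 3))
  rw [hn3, zero_smul, add_zero, ← ha, ← hb, ← hc] at en3
  have hnu' := hnu
  rw [eu] at hnu'
  simp only [map_add, map_smul, h1, h2, en2] at hnu'
  have f0 := congrArg (B.coord 0) hnu'
  have f1 := congrArg (B.coord 1) hnu'
  have f2 := congrArg (B.coord 2) hnu'
  simp only [map_add, map_smul, map_zero, smul_eq_mul, c00, c01, c02, c10, c11, c12,
        c20, c21, c22] at f0 f1 f2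
  have hr0 : r ≠ 0 := by
    intro h0
    rw [h0] at f1 f2
    refine hu ?_
    have hq0 : q = 0 := by linear_combination f1
    have hp0 : p = 0 := by linear_combination f2
    rw [eu, hq0, hp0, h0]
    simp
  have hk0 : k₀ = 0 := by
    refine (mul_eq_zero.1 (?_ : r * k₀ = 0)).resolve_left hr0
    linear_combination f0
  -- The cyclic subspace of `B 0 + s B 3` is not stable under `X`, unless this determinant vanishes.
  have hdet : ∀ s : ℂ, s ≠ 0 →
      s * a * (s * (a + c * k₁) * r - (1 + s * (b + c * k₂)) * p) +
        q * ((1 + s * b) * (1 + s * (b + c * k₂)) - s * c * (s * (a + c * k₁))) = 0 := by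
    intro s hs
    by_contra hD
    obtain ⟨B', hB'⟩ := exists_basis_of_coord (v := ![B 0 + s • B 3,
      B 1 + s • (a • B 0 + b • B 1 + c • B 2),
      B 2 + s • (a • B 1 + b • B 2 + c • (k₁ • B 1 + k₂ • B 2)), u]) hV (by
      intro x hx
      simp only [Matrix.cons_val] at hx
      rw [eu] at hx
      have e0 := congrArg (B.coord 0) hx
      have e1 := congrArg (B.coord 1) hx
      have e2 := congrArg (B.coord 2) hx
      have e3 := congrArg (B.coord 3) hx
      simp only [map_add, map_smul, map_zero, smul_eq_mul, c00, c01, c02, c03, c10, c11, c12, c13,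
        c20, c21, c22, c23, c30, c31, c32, c33] at e0 e1 e2 e3
      have x0 : x 0 = 0 := by
        refine (mul_eq_zero.1 (?_ : x 0 * s = 0)).resolve_right hs
        linear_combination e3
      rw [x0] at e0 e1 e2
      have x1 : x 1 = 0 := by
        refine (mul_eq_zero.1 (?_ : _ * x 1 = 0)).resolve_left hD
        linear_combination e0 * (s * (a + c * k₁) * r - (1 + s * (b + c * k₂)) * p) +
          e1 * (q * (1 + s * (b + c * k₂))) - e2 * (q * (s * (a + c * k₁)))
      have x2 : x 2 = 0 := by
        refine (mul_eq_zero.1 (?_ : _ * x 2 = 0)).resolve_left hD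
        linear_combination e0 * (s * c * p - r * (1 + s * b)) +
          e1 * (s * a * r - s * c * q) - e2 * (s * a * p - q * (1 + s * b))
      have x3 : x 3 = 0 := by
        refine (mul_eq_zero.1 (?_ : _ * x 3 = 0)).resolve_left hD
        linear_combination e0 * ((1 + s * b) * (1 + s * (b + c * k₂)) -
          s * c * (s * (a + c * k₁))) - e1 * (s * a * (1 + s * (b + c * k₂))) +
          e2 * (s * a * (s * (a + c * k₁)))
      intro i
      fin_cases i <;> assumption)
    have b0 : B' 0 = B 0 + s • B 3 := hB' 0
    have b1 : B' 1 = B 1 + s • (a • B 0 + b • B 1 + c • B 2) := hB' 1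
    have b2 : B' 2 = B 2 + s • (a • B 1 + b • B 2 + c • (k₁ • B 1 + k₂ • B 2)) := hB' 2
    have b3 : B' 3 = u := hB' 3
    have h := coord_three_apply_eq_zero hA hno hn B'
      (by rw [b0, b1, map_add, map_smul, h1, en3])
      (by
        rw [b1, b2]
        simp only [map_add, map_smul, h1, h2, en2, hk0, zero_smul, zero_add]) hX
    rw [b0, map_add, hX0, zero_add, map_smul, ← hudef, ← b3, map_smul] at h
    simp at h
    exact hs h
  have d1 := hdet 1 one_ne_zero
  have d2 := hdet (-1) (by norm_num)
  have d3 := hdet 2 two_ne_zero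
  have hq0 : q = 0 := by linear_combination d1 + (1 / 3) * d2 - (1 / 3) * d3
  have hk1 : k₁ = 0 := by
    refine (mul_eq_zero.1 (?_ : r * k₁ = 0)).resolve_left hr0
    linear_combination f1 - hq0
  rw [hq0, hk1] at d1 d2
  have hap : a * p = 0 := by linear_combination (-1 / 2) * d1 + (1 / 2) * d2
  have ha0 : a = 0 := by
    have : a * a * r = 0 := by
      linear_combination (1 / 2) * d1 + (1 / 2) * d2 + (b + c * k₂) * hap
    have := (mul_eq_zero.1 this).resolve_right hr0
    exact mul_self_eq_zero.1 this
  rw [ha0, zero_smul, zero_add] at en3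
  have hnw : n (B 3 - b • B 0 - c • B 1) = 0 := by
    rw [map_sub, map_sub, map_smul, map_smul, h1, h2, en3]
    abel
  refine hno ⟨B.coord 2, B.coord 2 ∘ₗ n, B 3 - b • B 0 - c • B 1, B 0, ?_, c20, ?_, ?_,
    fun Z hZ hZ1 hZ2 hZ3 => ⟨B.coord 0 (Z (B 0)), ?_⟩⟩
  · simp only [map_sub, map_smul, smul_eq_mul, c20, c21, c23]
    ring
  · rw [LinearMap.comp_apply, hnw, map_zero]
  · rw [LinearMap.comp_apply, h1, c21]
  have e0 := eq_sum_four B (Z (B 0))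
  rw [hZ2, coord_three_apply_eq_zero hA hno hn B h1 h2 hZ, zero_smul, add_zero, zero_smul,
    add_zero] at e0
  have hy : B.coord 1 (Z (B 0)) = 0 := by
    rw [LinearMap.comp_apply, e0] at hZ3
    simpa only [map_add, map_smul, h1, h2, c21, c22, smul_eq_mul, mul_zero, mul_one,
      zero_add] using hZ3
  rw [hy, zero_smul, add_zero] at e0
  generalize B.coord 0 (Z (B 0)) = x at *
  have hT : Z - x • 1 ∈ A := A.sub_mem hZ (A.smul_mem x h1A)
  obtain ⟨T, hTdef⟩ : ∃ T, T = Z - x • (1 : Module.End ℂ V) := ⟨_, rfl⟩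
  rw [← hTdef] at hT
  have hT0 : T (B 0) = 0 := by
    rw [hTdef, LinearMap.sub_apply, e0]
    simp
  have hT1 : T (B 1) = 0 := by rw [← h1, apply_comm hA hT hn, hT0, map_zero]
  have hT2 : T (B 2) = 0 := by rw [← h2, apply_comm hA hT hn, hT1, map_zero]
  have hTu : T u = 0 := by
    rw [eu]
    simp only [map_add, map_smul, hT0, hT1, hT2, smul_zero, add_zero]
  have hTw : T (B 3 - b • B 0 - c • B 1) = T (B 3) := by
    simp only [map_sub, map_smul, hT0, hT1, smul_zero, sub_zero]
  have t2 : B.coord 2 (T (B 3)) = 0 := by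
    rw [← hTw, hTdef, LinearMap.sub_apply, map_sub, hZ1]
    simp
  have t3 : B.coord 3 (T (B 3)) = 0 := by
    have h : X (T (B 3)) = 0 := by rw [apply_comm hA hX hT, ← hudef, hTu]
    rw [hXv] at h
    exact (smul_eq_zero.1 h).resolve_right hu
  have et := eq_sum_four B (T (B 3))
  rw [t2, t3, zero_smul, add_zero, zero_smul, add_zero] at et
  have hnt : n (T (B 3)) = 0 := by rw [← hTw, apply_comm hA hn hT, hnw, map_zero]
  rw [et, map_add, map_smul, map_smul, h1, h2] at hnt
  have t0 : B.coord 0 (T (B 3)) = 0 := by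
    simpa only [map_add, map_smul, c11, c12, smul_eq_mul, mul_zero, mul_one, add_zero,
      map_zero] using congrArg (B.coord 1) hnt
  have t1 : B.coord 1 (T (B 3)) = 0 := by
    simpa only [map_add, map_smul, c21, c22, smul_eq_mul, mul_zero, mul_one, zero_add,
      map_zero] using congrArg (B.coord 2) hnt
  rw [t0, t1, zero_smul, zero_smul, add_zero] at et
  have hT' : T = 0 := B.ext fun i => by
    fin_cases i
    exacts [hT0, hT1, hT2, et]
  rw [← sub_eq_zero, ← hTdef, hT']

/-- If some element of `A` has a three-dimensional cyclic subspace, then `A` has a frame. -/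
theorem hasChartFrame_of_linearIndependent [FiniteDimensional ℂ V] (hV : Module.finrank ℂ V = 4)
    (hA : ∀ X ∈ A, ∀ Y ∈ A, X * Y = Y * X) (h1A : 1 ∈ A) (hdim : 3 < Module.finrank ℂ A)
    {n₀ : Module.End ℂ V} (hn₀ : n₀ ∈ A) {v : V}
    (hv : LinearIndependent ℂ ![v, n₀ v, n₀ (n₀ v)]) : HasChartFrame A := by
  by_contra hno
  obtain ⟨B, b0, b1, b2⟩ := exists_basis_extension hV hv
  rw [← b0] at b1 b2
  rw [← b1] at b2
  have hN : ∀ {Z}, Z ∈ A → B.coord 3 (Z (B 0)) = 0 := fun hZ =>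
    coord_three_apply_eq_zero hA hno hn₀ B b1.symm b2.symm hZ
  -- The elements of `A` map `B 0` into a space of dimension three.
  let ev : A →ₗ[ℂ] Fin 3 → ℂ :=
    LinearMap.pi fun i => B.coord i.castSucc ∘ₗ LinearMap.applyₗ (B 0) ∘ₗ A.subtype
  have hker : LinearMap.ker ev ≠ ⊥ := LinearMap.ker_ne_bot_of_finrank_lt (by
    rwa [Module.finrank_fin_fun])
  obtain ⟨⟨X, hX⟩, hXker, hXne⟩ := (Submodule.ne_bot_iff _).1 hker
  have hX0 : X (B 0) = 0 := by
    rw [eq_sum_four B (X (B 0)), hN hX]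
    have h0 : B.coord 0 (X (B 0)) = 0 := congrFun hXker 0
    have h1 : B.coord 1 (X (B 0)) = 0 := congrFun hXker 1
    have h2 : B.coord 2 (X (B 0)) = 0 := congrFun hXker 2
    rw [h0, h1, h2]
    simp
  have hX1 : X (B 1) = 0 := by rw [b1, apply_comm hA hX hn₀, hX0, map_zero]
  have hX2 : X (B 2) = 0 := by rw [b2, apply_comm hA hX hn₀, hX1, map_zero]
  have hXv : ∀ v, X v = B.coord 3 v • X (B 3) := by
    intro v
    conv_lhs => rw [eq_sum_four B v]
    simp only [map_add, map_smul, hX0, hX1, hX2, smul_zero, zero_add]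
  have hu : X (B 3) ≠ 0 := by
    intro h0
    refine hXne (Subtype.ext (LinearMap.ext fun v => ?_))
    change X v = 0
    rw [hXv, h0, smul_zero]
  obtain ⟨l, hl⟩ : ∃ l, l = B.coord 3 (n₀ (B 3)) := ⟨_, rfl⟩
  have hnu : n₀ (X (B 3)) = l • X (B 3) := by rw [apply_comm hA hn₀ hX, hXv, hl]
  have hn : n₀ - l • 1 ∈ A := A.sub_mem hn₀ (A.smul_mem l h1A)
  have hnv : ∀ v, (n₀ - l • (1 : Module.End ℂ V)) v = n₀ v - l • v := fun v => rfl
  obtain ⟨B', hB'⟩ := exists_basis_of_coord (v := ![B 0, B 1 - l • B 0,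
    B 2 - l • B 1 - l • (B 1 - l • B 0), B 3]) hV (by
      intro x hx
      simp only [Matrix.cons_val] at hx
      have e0 := congrArg (B.coord 0) hx
      have e1 := congrArg (B.coord 1) hx
      have e2 := congrArg (B.coord 2) hx
      have e3 := congrArg (B.coord 3) hx
      simp at e0 e1 e2 e3
      simp only [e2] at e0 e1
      simp at e1
      simp only [e1] at e0
      simp at e0
      intro i
      fin_cases i <;> assumption)
  have c0 : B' 0 = B 0 := hB' 0
  have c1 : B' 1 = B 1 - l • B 0 := hB' 1
  have c2 : B' 2 = B 2 - l • B 1 - l • (B 1 - l • B 0) := hB' 2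
  have c3 : B' 3 = B 3 := hB' 3
  exact hno (hasChartFrame_of_rank_one hV hA h1A hn B'
    (by rw [c0, c1, hnv, b1])
    (by rw [c1, c2, hnv, map_sub, map_smul, ← b1, ← b2]) hX
    (by rw [c0, hX0]) (by rwa [c3]) (by rw [c3, hnv, hnu, sub_self]))

end CommutingEnd

section CommutingEnd

variable {V : Type*} [AddCommGroup V] [Module ℂ V] {A : Submodule ℂ (Module.End ℂ V)}

/-- If two vectors are dependent, so are their values under two linear forms. -/
theorem dual_mul_sub_eq_zero {z z' : V} (h : ¬LinearIndependent ℂ ![z, z'])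
    (f g : Module.Dual ℂ V) : f z * g z' - f z' * g z = 0 := by
  rw [LinearIndependent.pair_iff] at h
  push Not at h
  obtain ⟨s, t, hst, h0⟩ := h
  have hf := congrArg f hst
  have hg := congrArg g hst
  simp only [map_add, map_smul, smul_eq_mul, map_zero] at hf hg
  by_cases hs : s = 0
  · have ht := h0 hs
    refine (mul_eq_zero.1 (?_ : t * (f z * g z' - f z' * g z) = 0)).resolve_left ht
    linear_combination f z * hg - g z * hf
  · refine (mul_eq_zero.1 (?_ : s * (f z * g z' - f z' * g z) = 0)).resolve_left hs
    linear_combination g z' * hf - f z' * hg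

theorem not_linearIndependent_pair {z z' : V}
    (h : ∀ f g : Module.Dual ℂ V, f z * g z' - f z' * g z = 0) :
    ¬LinearIndependent ℂ ![z, z'] := by
  intro hi
  rw [LinearIndependent.pair_iff] at hi
  by_cases hz : z = 0
  · exact one_ne_zero (hi 1 0 (by simp [hz])).1
  · obtain ⟨f, hf⟩ : ∃ f : Module.Dual ℂ V, f z ≠ 0 := by
      by_contra! h0
      exact hz ((Module.forall_dual_apply_eq_zero_iff ℂ z).1 h0)
    have h1 : (-f z') • z + f z • z' = 0 := by
      refine (Module.forall_dual_apply_eq_zero_iff ℂ _).1 fun g => ?_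
      rw [map_add, map_smul, map_smul, smul_eq_mul, smul_eq_mul]
      linear_combination h f g
    exact hf (hi _ _ h1).2

/-- An endomorphism, all of whose cyclic subspaces have dimension at most two, satisfies a quadratic
equation. -/
theorem exists_quadratic_of_not_linearIndependent [FiniteDimensional ℂ V] [Nontrivial V]
    (y : Module.End ℂ V)
    (h : ∀ (l : ℂ) (v : V), ¬LinearIndependent ℂ ![v, (y - l • 1 : Module.End ℂ V) v,
      (y - l • 1 : Module.End ℂ V) ((y - l • 1 : Module.End ℂ V) v)]) :
    ∃ l κ : ℂ, (y - l • 1) * (y - l • 1) = κ • (y - l • 1) := by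
  obtain ⟨l, hl⟩ := Module.End.exists_eigenvalue y
  obtain ⟨w, hw⟩ := hl.exists_hasEigenvector
  refine ⟨l, ?_⟩
  replace h := h l
  have hker : (y - l • 1 : Module.End ℂ V) w = 0 := by
    change y w - l • w = 0
    rw [hw.apply_eq_smul, sub_self]
  generalize (y - l • 1 : Module.End ℂ V) = n at *
  have hlt : LinearMap.range n < ⊤ := by
    refine lt_top_iff_ne_top.2 fun ht => hw.2 ?_
    have hinj := LinearMap.injective_iff_surjective.2 (LinearMap.range_eq_top.1 ht)
    exact hinj (by rw [hker, map_zero])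
  have h2 : ∀ v, v ∉ LinearMap.range n → ¬LinearIndependent ℂ ![n v, n (n v)] := by
    intro v hv hi
    refine h v (linearIndependent_finCons.2 ⟨hi, fun hmem => hv ?_⟩)
    refine Submodule.span_le.2 ?_ hmem
    rintro _ ⟨i, rfl⟩
    fin_cases i <;> exact ⟨_, rfl⟩
  obtain ⟨v₀, -, hv₀⟩ := SetLike.exists_of_lt hlt
  have h3 : ∀ v, ¬LinearIndependent ℂ ![n v, n (n v)] := by
    intro v
    by_cases hv : v ∈ LinearMap.range n
    swap
    · exact h2 v hv
    -- The minors for `v + t v₀` are quadratic in `t` and vanish for all `t ≠ 0`.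
    refine not_linearIndependent_pair fun f g => ?_
    have ht : ∀ t : ℂ, t ≠ 0 → (f (n v) + t * f (n v₀)) * (g (n (n v)) + t * g (n (n v₀))) -
        (f (n (n v)) + t * f (n (n v₀))) * (g (n v) + t * g (n v₀)) = 0 := by
      intro t ht
      have hnot : v + t • v₀ ∉ LinearMap.range n := fun hm => hv₀ (by
        have := (LinearMap.range n).smul_mem t⁻¹ ((Submodule.add_mem_iff_right _ hv).1 hm)
        rwa [smul_smul, inv_mul_cancel₀ ht, one_smul] at this)
      simpa only [map_add, map_smul, smul_eq_mul] using dual_mul_sub_eq_zero (h2 _ hnot) f g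
    linear_combination ht 1 one_ne_zero + (1 / 3) * ht (-1) (by norm_num) -
      (1 / 3) * ht 2 two_ne_zero
  obtain ⟨κ, hκ⟩ := LinearMap.exists_eq_smul_id_of_forall_notLinearIndependent
    (f := (n.restrict (p := LinearMap.range n) (q := LinearMap.range n) fun v _ => ⟨v, rfl⟩)) (by
      rintro ⟨_, v, rfl⟩ hi
      refine h3 v ?_
      have := hi.map' (LinearMap.range n).subtype (Submodule.ker_subtype _)
      convert! this using 1
      funext i
      fin_cases i <;> rfl)
  refine ⟨κ, LinearMap.ext fun v => ?_⟩
  exact congrArg Subtype.val (LinearMap.congr_fun hκ ⟨n v, v, rfl⟩)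

theorem linearIndependent_fin_three_iff {x y z : V} : LinearIndependent ℂ ![x, y, z] ↔
    ∀ a b c : ℂ, a • x + b • y + c • z = 0 → a = 0 ∧ b = 0 ∧ c = 0 := by
  rw [Fintype.linearIndependent_iff]
  constructor
  · intro hi a b c h
    have := hi ![a, b, c] (by simpa [Fin.sum_univ_three] using h)
    exact ⟨this 0, this 1, this 2⟩
  · intro h g hg
    obtain ⟨h0, h1, h2⟩ := h (g 0) (g 1) (g 2) (by simpa [Fin.sum_univ_three] using hg)
    intro i
    fin_cases i <;> assumption

/-- In a commuting space of endomorphisms whose elements satisfy quadratic equations, an idempotent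
and an endomorphism with zero product are dependent modulo scalars. -/
theorem not_linearIndependent_of_idempotent
    (hsq : ∀ z ∈ A, ∃ s t : ℂ, z * z = s • 1 + t • z) {e z : Module.End ℂ V} (he : e ∈ A)
    (hz : z ∈ A) (hee : e * e = e) (hez : e * z = 0) (hze : z * e = 0) :
    ¬LinearIndependent ℂ ![1, e, z] := by
  intro hi
  have hcoef := linearIndependent_fin_three_iff.1 hi
  obtain ⟨s, t, hst⟩ := hsq z hz
  obtain ⟨s₁, t₁, h1⟩ := hsq (e + z) (A.add_mem he hz)
  obtain ⟨s₂, t₂, h2⟩ := hsq (e + (2 : ℂ) • z) (A.add_mem he (A.smul_mem _ hz))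
  have hs : s = 0 := by
    have h : e * (z * z) = e * (s • 1 + t • z) := by rw [hst]
    rw [← mul_assoc, hez, zero_mul, mul_add, mul_smul_comm, mul_one, mul_smul_comm, hez, smul_zero,
      add_zero] at h
    exact (hcoef 0 s 0 (by rw [← h]; simp)).2.1
  rw [hs, zero_smul, zero_add] at hst
  obtain ⟨-, hb, hc⟩ := hcoef (-s₁) (1 - t₁) (t - t₁) (by
    have : e + t • z = s₁ • 1 + t₁ • (e + z) := by
      rw [← h1, add_mul, mul_add, mul_add, hee, hez, hze, hst]
      abel
    rw [← sub_eq_zero] at this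
    rw [← this]
    module)
  obtain ⟨-, hb', hc'⟩ := hcoef (-s₂) (1 - t₂) (4 * t - 2 * t₂) (by
    have : e + (4 * t) • z = s₂ • 1 + t₂ • (e + (2 : ℂ) • z) := by
      rw [← h2, add_mul, mul_add, mul_add, hee, mul_smul_comm, smul_mul_assoc, smul_mul_assoc,
        mul_smul_comm, hez, hze, hst]
      module
    rw [← sub_eq_zero] at this
    rw [← this]
    module)
  have : (2 : ℂ) = 0 := by linear_combination hc' - 4 * hc + 4 * hb - 2 * hb'
  exact two_ne_zero this

theorem le_span_of_idempotent (hA : ∀ X ∈ A, ∀ Y ∈ A, X * Y = Y * X) (h1A : 1 ∈ A)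
    (hsq : ∀ z ∈ A, ∃ s t : ℂ, z * z = s • 1 + t • z) {e : Module.End ℂ V} (he : e ∈ A)
    (hee : e * e = e) (h1e : LinearIndependent ℂ ![1, e]) :
    A ≤ Submodule.span ℂ (Set.range ![1, e]) := by
  intro z hz
  by_contra hzn
  have hi : LinearIndependent ℂ ![1, e, z] := by
    have h := linearIndependent_finSnoc.2 ⟨h1e, hzn⟩
    convert! h using 1
    funext i
    fin_cases i <;> rfl
  have hcoef := linearIndependent_fin_three_iff.1 hi
  have hze := hA z hz e he
  obtain ⟨s, t, hst⟩ := hsq z hz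
  obtain ⟨s₁, t₁, h1⟩ := hsq (e + z) (A.add_mem he hz)
  rw [add_mul, mul_add, mul_add, hee, hze, hst] at h1
  obtain ⟨a, ha⟩ : ∃ a : ℂ, a = (1 / 2) * (s₁ - s) := ⟨_, rfl⟩
  obtain ⟨b, hb⟩ : ∃ b : ℂ, b = (1 / 2) * (t₁ - 1) := ⟨_, rfl⟩
  obtain ⟨c, hc⟩ : ∃ c : ℂ, c = (1 / 2) * (t₁ - t) := ⟨_, rfl⟩
  have hez : e * z = a • 1 + b • e + c • z := by
    have h2 : (2 : ℂ) • (e * z) = (s₁ - s) • 1 + (t₁ - 1) • e + (t₁ - t) • z := by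
      rw [← sub_eq_zero] at h1 ⊢
      rw [← h1]
      module
    rw [ha, hb, hc, mul_smul, mul_smul, mul_smul, ← smul_add, ← smul_add, ← h2, smul_smul]
    norm_num
  have hee' : (1 - c) • (e * z) = (a + b) • e := by
    have h : e * (e * z) = e * (a • 1 + b • e + c • z) := by rw [hez]
    rw [← mul_assoc, hee, mul_add, mul_add, mul_smul_comm, mul_smul_comm, mul_smul_comm, mul_one,
      hee] at h
    rw [sub_smul, one_smul]
    nth_rewrite 1 [h]
    module
  by_cases hc1 : c = 1
  · rw [hc1, sub_self, zero_smul] at hee'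
    have hab : a + b = 0 := (hcoef 0 (a + b) 0 (by rw [← hee']; simp)).2.1
    have h0 : (1 - e) * (z + a • 1) = 0 := by
      rw [sub_mul, one_mul, mul_add, hez, mul_smul_comm, mul_one, hc1]
      have : b = -a := by linear_combination hab
      rw [this]
      module
    have h0' : (z + a • 1) * (1 - e) = 0 := by
      rw [← h0]
      exact hA _ (A.add_mem hz (A.smul_mem a h1A)) _ (A.sub_mem h1A he)
    refine not_linearIndependent_of_idempotent hsq (A.sub_mem h1A he)
      (A.add_mem hz (A.smul_mem a h1A)) (by
        rw [sub_mul, one_mul, mul_sub, hee, mul_one, sub_self, sub_zero]) h0 h0'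
      (linearIndependent_fin_three_iff.2 fun x y w hxy => ?_)
    obtain ⟨h3, h4, h5⟩ := hcoef (x + y + w * a) (-y) w (by rw [← hxy]; module)
    refine ⟨?_, ?_, h5⟩
    · linear_combination h3 + h4 - a * h5
    · linear_combination -h4
  · have hc1' : 1 - c ≠ 0 := sub_ne_zero.2 (Ne.symm hc1)
    obtain ⟨m, hm⟩ : ∃ m : ℂ, m = (1 - c)⁻¹ * (a + b) := ⟨_, rfl⟩
    have hezm : e * z = m • e := by
      rw [hm, mul_smul, ← hee', smul_smul, inv_mul_cancel₀ hc1', one_smul]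
    have h0 : e * (z - m • 1) = 0 := by
      rw [mul_sub, hezm, mul_smul_comm, mul_one, sub_self]
    have h0' : (z - m • 1) * e = 0 := by
      rw [← h0]
      exact hA _ (A.sub_mem hz (A.smul_mem m h1A)) _ he
    refine not_linearIndependent_of_idempotent hsq he (A.sub_mem hz (A.smul_mem m h1A)) hee h0 h0'
      (linearIndependent_fin_three_iff.2 fun x y w hxy => ?_)
    obtain ⟨h3, h4, h5⟩ := hcoef (x - w * m) y w (by rw [← hxy]; module)
    exact ⟨by linear_combination h3 + m * h5, h4, h5⟩

/-- If `A` has no frame, then its elements are sums of scalars and endomorphisms of square zero. -/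
theorem exists_sub_smul_mul_self_eq_zero [FiniteDimensional ℂ V] (hV : Module.finrank ℂ V = 4)
    (hA : ∀ X ∈ A, ∀ Y ∈ A, X * Y = Y * X) (h1A : 1 ∈ A) (hdim : 3 < Module.finrank ℂ A)
    (hno : ¬HasChartFrame A) {y : Module.End ℂ V} (hy : y ∈ A) :
    ∃ l : ℂ, (y - l • 1) * (y - l • 1) = 0 := by
  have : Nontrivial V := Module.nontrivial_of_finrank_pos (R := ℂ) (by rw [hV]; norm_num)
  have hq : ∀ y ∈ A, ∃ l κ : ℂ, (y - l • 1) * (y - l • 1) = κ • (y - l • 1) := fun y hy =>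
    exists_quadratic_of_not_linearIndependent y fun l v hi =>
      hno (hasChartFrame_of_linearIndependent hV hA h1A hdim (A.sub_mem hy (A.smul_mem l h1A)) hi)
  have hsq : ∀ z ∈ A, ∃ s t : ℂ, z * z = s • 1 + t • z := by
    intro z hz
    obtain ⟨l, κ, h⟩ := hq z hz
    refine ⟨-(l * l + κ * l), 2 * l + κ, ?_⟩
    rw [sub_mul, mul_sub, mul_sub, smul_mul_assoc, smul_mul_assoc, mul_smul_comm, one_mul, one_mul,
      mul_one, ← sub_eq_zero] at h
    rw [← sub_eq_zero, ← h]
    module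
  obtain ⟨l, κ, h⟩ := hq y hy
  by_cases hκ : κ = 0
  · exact ⟨l, by rw [h, hκ, zero_smul]⟩
  -- The idempotent `κ⁻¹ (y - l)` is scalar, for dimension reasons.
  have hn : y - l • 1 ∈ A := A.sub_mem hy (A.smul_mem l h1A)
  generalize hndef : y - l • 1 = n at *
  have hee : (κ⁻¹ • n) * (κ⁻¹ • n) = κ⁻¹ • n := by
    rw [smul_mul_smul_comm, h, smul_smul, mul_assoc, inv_mul_cancel₀ hκ, mul_one]
  by_cases h1e : LinearIndependent ℂ ![1, κ⁻¹ • n]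
  · have h2 := Submodule.finrank_mono (le_span_of_idempotent hA h1A hsq (A.smul_mem κ⁻¹ hn) hee h1e)
    have h3 := finrank_range_le_card (R := ℂ) ![1, κ⁻¹ • n]
    rw [Fintype.card_fin] at h3
    have h4 := h2.trans h3
    omega
  · rw [LinearIndependent.pair_iff] at h1e
    push Not at h1e
    obtain ⟨s, t, hst, h0⟩ := h1e
    have ht : t ≠ 0 := by
      intro ht
      rw [ht, zero_smul, add_zero] at hst
      exact h0 ((smul_eq_zero.1 hst).resolve_right one_ne_zero) ht
    have hyn : y = n + l • 1 := by rw [← hndef, sub_add_cancel]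
    have hns : n = (-(κ * t⁻¹ * s)) • 1 := by
      have : (κ * t⁻¹) • (s • (1 : Module.End ℂ V) + t • κ⁻¹ • n) = 0 := by rw [hst, smul_zero]
      rw [smul_add, smul_smul, smul_smul, smul_smul] at this
      have hc : κ * t⁻¹ * t * κ⁻¹ = 1 := by field_simp
      rw [hc, one_smul] at this
      rw [neg_smul]
      exact eq_neg_of_add_eq_zero_right this
    refine ⟨l + -(κ * t⁻¹ * s), ?_⟩
    rw [hyn, add_smul, ← hns, add_comm n, sub_self, zero_mul]

end CommutingEnd

/-! ### The minimal orbits -/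

section Minimal

theorem conj_mulVec (g : GL (Fin 4) ℂ) (X : sl4) (v : Fin 4 → ℂ) :
    (conj g X).1 *ᵥ (vecEquiv g v) = vecEquiv g (X.1 *ᵥ v) := by
  change (g.1 * X.1 * g⁻¹.1) *ᵥ (g.1 *ᵥ v) = g.1 *ᵥ (X.1 *ᵥ v)
  rw [Matrix.mulVec_mulVec, Matrix.mul_assoc, Units.inv_mul, Matrix.mul_one, Matrix.mulVec_mulVec]

theorem map_conj_flagAlgebra (g : GL (Fin 4) ℂ) (L : Submodule ℂ (Fin 4 → ℂ)) :
    (flagAlgebra L).map (conj g : sl4 →ₗ[ℂ] sl4) =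
      flagAlgebra (L.map (vecEquiv g : (Fin 4 → ℂ) →ₗ[ℂ] (Fin 4 → ℂ))) := by
  refine Submodule.eq_of_le_of_finrank_eq ?_ ?_
  · rintro _ ⟨X, hX, rfl⟩
    refine ⟨fun v => ?_, ?_⟩
    · obtain ⟨w, rfl⟩ := (vecEquiv g).surjective v
      exact ⟨X.1 *ᵥ w, hX.1 w, (conj_mulVec g X w).symm⟩
    · rintro _ ⟨w, hw, rfl⟩
      refine (conj_mulVec g X w).trans ?_
      rw [hX.2 w hw, map_zero]
  · have h1 := L.finrank_quotient_add_finrank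
    have h2 := (L.map
      (vecEquiv g : (Fin 4 → ℂ) →ₗ[ℂ] (Fin 4 → ℂ))).finrank_quotient_add_finrank
    rw [LinearEquiv.finrank_map_eq] at h2
    rw [LinearEquiv.finrank_map_eq, finrank_flagAlgebra, finrank_flagAlgebra,
      LinearEquiv.finrank_map_eq]
    congr 1
    omega

theorem smul_lineAlgebra (g : GL (Fin 4) ℂ) (L : Gr 1 (Fin 4 → ℂ)) :
    g • lineAlgebra L = lineAlgebra (L.map (vecEquiv g)) :=
  Subtype.ext (map_conj_flagAlgebra g L.1)

theorem smul_hyperplaneAlgebra (g : GL (Fin 4) ℂ) (L : Gr 3 (Fin 4 → ℂ)) :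
    g • hyperplaneAlgebra L = hyperplaneAlgebra (L.map (vecEquiv g)) :=
  Subtype.ext (map_conj_flagAlgebra g L.1)

/-- The general linear group acts transitively on the subspaces of given dimension. -/
theorem exists_map_vecEquiv_eq {k : ℕ} (L L' : Gr k (Fin 4 → ℂ)) :
    ∃ g : GL (Fin 4) ℂ, L.map (vecEquiv g) = L' := by
  obtain ⟨C, hC⟩ := exists_isCompl L.1
  obtain ⟨C', hC'⟩ := exists_isCompl L'.1
  have h1 : Module.finrank ℂ L.1 = Module.finrank ℂ L'.1 := L.2.trans L'.2.symm
  have h2 : Module.finrank ℂ C = Module.finrank ℂ C' := by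
    have a := Submodule.finrank_add_eq_of_isCompl hC
    have b := Submodule.finrank_add_eq_of_isCompl hC'
    omega
  let e := (Submodule.prodEquivOfIsCompl L.1 C hC).symm ≪≫ₗ
    ((LinearEquiv.ofFinrankEq L.1 L'.1 h1).prodCongr (LinearEquiv.ofFinrankEq C C' h2)) ≪≫ₗ
    Submodule.prodEquivOfIsCompl L'.1 C' hC'
  let g : GL (Fin 4) ℂ :=
    { val := LinearMap.toMatrix' e.toLinearMap
      inv := LinearMap.toMatrix' e.symm.toLinearMap
      val_inv := by
        rw [← LinearMap.toMatrix'_comp, LinearEquiv.comp_symm, LinearMap.toMatrix'_id]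
      inv_val := by
        rw [← LinearMap.toMatrix'_comp, LinearEquiv.symm_comp, LinearMap.toMatrix'_id] }
  refine ⟨g, Subtype.ext (Submodule.eq_of_le_of_finrank_eq ?_ ?_)⟩
  · rintro _ ⟨v, hv, rfl⟩
    have hev : vecEquiv g v = e v := LinearMap.toMatrix'_mulVec _ v
    change vecEquiv g v ∈ L'.1
    rw [hev]
    have h3 : (Submodule.prodEquivOfIsCompl L.1 C hC).symm v = (⟨v, hv⟩, 0) :=
      Submodule.prodEquivOfIsCompl_symm_apply_left L.1 C hC ⟨v, hv⟩
    simp only [e, LinearEquiv.trans_apply, h3]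
    simp
  · exact (L.map (vecEquiv g)).2.trans L'.2.symm

theorem orbit_lineAlgebra (L : Gr 1 (Fin 4 → ℂ)) :
    MulAction.orbit (GL (Fin 4) ℂ) (lineAlgebra L) = minimalOrbit := by
  ext W
  constructor
  · rintro ⟨g, rfl⟩
    exact ⟨_, (smul_lineAlgebra g L).symm⟩
  · rintro ⟨L', rfl⟩
    obtain ⟨g, hg⟩ := exists_map_vecEquiv_eq L L'
    exact ⟨g, (smul_lineAlgebra g L).trans (by rw [hg])⟩

theorem orbit_hyperplaneAlgebra (L : Gr 3 (Fin 4 → ℂ)) :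
    MulAction.orbit (GL (Fin 4) ℂ) (hyperplaneAlgebra L) = dualMinimalOrbit := by
  ext W
  constructor
  · rintro ⟨g, rfl⟩
    exact ⟨_, (smul_hyperplaneAlgebra g L).symm⟩
  · rintro ⟨L', rfl⟩
    obtain ⟨g, hg⟩ := exists_map_vecEquiv_eq L L'
    exact ⟨g, (smul_hyperplaneAlgebra g L).trans (by rw [hg])⟩

/-- A proper subspace is determined by its algebra: it is spanned by the images. -/
theorem le_of_flagAlgebra_le {L L' : Submodule ℂ (Fin 4 → ℂ)} (hL : L ≠ ⊤)
    (h : flagAlgebra L ≤ flagAlgebra L') : L ≤ L' := by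
  intro l hl
  obtain ⟨w, -, hw⟩ := SetLike.exists_of_lt (lt_top_iff_ne_top.2 hL)
  obtain ⟨f, hfw, hfL⟩ := Submodule.exists_dual_map_eq_bot_of_notMem hw inferInstance
  have hf : ∀ v ∈ L, f v = 0 := fun v hv => by
    have : f v ∈ L.map f := ⟨v, hv, rfl⟩
    rwa [hfL, Submodule.mem_bot] at this
  have hmul : ∀ v, LinearMap.toMatrix' (f.smulRight l) *ᵥ v = f v • l := fun v => by
    rw [LinearMap.toMatrix'_mulVec, LinearMap.smulRight_apply]
  have hsq : LinearMap.toMatrix' (f.smulRight l) ^ 2 = 0 := by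
    rw [pow_two, ← LinearMap.toMatrix'_comp]
    have : (f.smulRight l) ∘ₗ (f.smulRight l) = 0 := by
      ext v
      simp [hf l hl]
    rw [this, map_zero]
  let X : sl4 := ⟨LinearMap.toMatrix' (f.smulRight l), mem_sl4.2
    (Matrix.isNilpotent_trace_of_isNilpotent ⟨2, hsq⟩).eq_zero⟩
  have hX : X ∈ flagAlgebra L := by
    refine ⟨fun v => ?_, fun v hv => ?_⟩
    · rw [hmul]
      exact L.smul_mem _ hl
    · rw [hmul, hf v hv, zero_smul]
  have h1 := (h hX).1 w
  rw [hmul] at h1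
  exact (Submodule.smul_mem_iff _ hfw).1 h1

theorem Gr.ne_top {k : ℕ} (hk : k ≠ 4) (L : Gr k (Fin 4 → ℂ)) : L.1 ≠ ⊤ := fun h => hk (by
  have := L.2
  rw [h, finrank_top, Module.finrank_fin_fun] at this
  exact this.symm)

theorem lineAlgebra_injective : Function.Injective lineAlgebra := fun L L' h => by
  have h' : flagAlgebra L.1 = flagAlgebra L'.1 := congrArg Subtype.val h
  exact Subtype.ext (le_antisymm (le_of_flagAlgebra_le (L.ne_top (by norm_num)) h'.le)
    (le_of_flagAlgebra_le (L'.ne_top (by norm_num)) h'.ge))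

theorem hyperplaneAlgebra_injective : Function.Injective hyperplaneAlgebra := fun L L' h => by
  have h' : flagAlgebra L.1 = flagAlgebra L'.1 := congrArg Subtype.val h
  exact Subtype.ext (le_antisymm (le_of_flagAlgebra_le (L.ne_top (by norm_num)) h'.le)
    (le_of_flagAlgebra_le (L'.ne_top (by norm_num)) h'.ge))

theorem disjoint_minimalOrbit : Disjoint minimalOrbit dualMinimalOrbit := by
  rw [Set.disjoint_left]
  rintro _ ⟨L, rfl⟩ ⟨L', h⟩
  have h' : flagAlgebra L'.1 = flagAlgebra L.1 := congrArg Subtype.val h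
  have := Submodule.finrank_mono (le_of_flagAlgebra_le (L'.ne_top (by norm_num)) h'.le)
  rw [L.2, L'.2] at this
  omega

theorem isCommuting_flagAlgebra (L : Submodule ℂ (Fin 4 → ℂ)) : IsCommuting (flagAlgebra L) := by
  have h : ∀ X ∈ flagAlgebra L, ∀ Y ∈ flagAlgebra L, X.1 * Y.1 = 0 := by
    intro X hX Y hY
    refine Matrix.toLin'.injective (LinearMap.ext fun v => ?_)
    rw [Matrix.toLin'_mul, LinearMap.comp_apply, Matrix.toLin'_apply, Matrix.toLin'_apply,
      hX.2 _ (hY.1 v), map_zero, LinearMap.zero_apply]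
  intro X hX Y hY
  rw [h X hX Y hY, h Y hY X hX]

end Minimal

/-! ### Commuting subspaces outside of the minimal orbits meet the chart -/

section Classification

/-- A traceless matrix as an endomorphism. -/
def toEnd : sl4 →ₗ[ℂ] Module.End ℂ (Fin 4 → ℂ) where
  toFun X := Matrix.toLin' X.1
  map_add' X Y := map_add Matrix.toLin' X.1 Y.1
  map_smul' c X := map_smul Matrix.toLin' c X.1

theorem toEnd_apply (X : sl4) (v : Fin 4 → ℂ) : toEnd X v = X.1 *ᵥ v := rfl

theorem toEnd_mul (X Y : sl4) : toEnd X * toEnd Y = Matrix.toLin' (X.1 * Y.1) :=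
  (Matrix.toLin'_mul X.1 Y.1).symm

theorem toEnd_injective : Function.Injective toEnd := fun _ _ h =>
  Subtype.ext (Matrix.toLin'.injective h)

theorem eq_zero_of_toEnd_eq_smul_one {X : sl4} {c : ℂ} (h : toEnd X = c • 1) : X = 0 := by
  have hX : X.1 = c • (1 : Matrix (Fin 4) (Fin 4) ℂ) := by
    refine Matrix.toLin'.injective (h.trans ?_)
    rw [map_smul, Matrix.toLin'_one]
    rfl
  have htr := mem_sl4.1 X.2
  rw [hX, Matrix.trace_smul, Matrix.trace_one, Fintype.card_fin, smul_eq_mul] at htr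
  have hc : c = 0 := by simpa using htr
  refine Subtype.ext ?_
  rw [hX, hc, zero_smul]
  rfl

/-- The span of a subspace of `sl₄` and of the identity, as endomorphisms. -/
def endSpace (W : Submodule ℂ sl4) : Submodule ℂ (Module.End ℂ (Fin 4 → ℂ)) :=
  W.map toEnd ⊔ Submodule.span ℂ {1}

theorem mem_endSpace {W : Submodule ℂ sl4} {X : Module.End ℂ (Fin 4 → ℂ)} :
    X ∈ endSpace W ↔ ∃ Y ∈ W, ∃ c : ℂ, X = toEnd Y + c • 1 := by
  rw [endSpace, Submodule.mem_sup]
  constructor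
  · rintro ⟨_, ⟨Y, hY, rfl⟩, z, hz, rfl⟩
    obtain ⟨c, rfl⟩ := Submodule.mem_span_singleton.1 hz
    exact ⟨Y, hY, c, rfl⟩
  · rintro ⟨Y, hY, c, rfl⟩
    exact ⟨_, ⟨Y, hY, rfl⟩, _, Submodule.mem_span_singleton.2 ⟨c, rfl⟩, rfl⟩

theorem toEnd_mem_endSpace {W : Submodule ℂ sl4} {X : sl4} (hX : X ∈ W) :
    toEnd X ∈ endSpace W := mem_endSpace.2 ⟨X, hX, 0, by simp⟩

theorem one_mem_endSpace (W : Submodule ℂ sl4) : 1 ∈ endSpace W :=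
  mem_endSpace.2 ⟨0, W.zero_mem, 1, by simp⟩

theorem endSpace_mul_comm {W : Submodule ℂ sl4} (hW : IsCommuting W) :
    ∀ X ∈ endSpace W, ∀ Y ∈ endSpace W, X * Y = Y * X := by
  intro X hX Y hY
  obtain ⟨X', hX', c, rfl⟩ := mem_endSpace.1 hX
  obtain ⟨Y', hY', d, rfl⟩ := mem_endSpace.1 hY
  simp only [add_mul, mul_add, toEnd_mul, hW X' hX' Y' hY', smul_mul_assoc, mul_smul_comm, one_mul,
    mul_one]
  module

theorem three_lt_finrank_endSpace (W : Gr 3 sl4) : 3 < Module.finrank ℂ (endSpace W.1) := by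
  have := W.finiteDimensional three_pos
  have h : Module.finrank ℂ (W.1.map toEnd) = 3 := by
    rw [(W.1.equivMapOfInjective toEnd toEnd_injective).finrank_eq.symm, W.2]
  refine h.symm.trans_lt (Submodule.finrank_lt_finrank_of_lt
    (lt_of_le_of_ne le_sup_left fun he => ?_))
  have h1 : (1 : Module.End ℂ (Fin 4 → ℂ)) ∈ W.1.map toEnd := by
    rw [he]
    exact one_mem_endSpace W.1
  obtain ⟨X, -, hX⟩ := h1
  have := eq_zero_of_toEnd_eq_smul_one (c := 1) (by rw [one_smul, hX])
  rw [this, map_zero] at hX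
  exact zero_ne_one hX

theorem exists_conj_eq_coord (B : Module.Basis (Fin 4) ℂ (Fin 4 → ℂ)) :
    ∃ g : GL (Fin 4) ℂ, ∀ (X : sl4) i j, (conj g X).1 i j = B.coord i (X.1 *ᵥ B j) := by
  refine ⟨⟨B.toMatrix (Pi.basisFun ℂ (Fin 4)), (Pi.basisFun ℂ (Fin 4)).toMatrix B,
    Module.Basis.toMatrix_mul_toMatrix_flip _ _, Module.Basis.toMatrix_mul_toMatrix_flip _ _⟩,
    fun X i j => ?_⟩
  have h := basis_toMatrix_mul_linearMap_toMatrix_mul_basis_toMatrix B (Pi.basisFun ℂ (Fin 4)) B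
    (Pi.basisFun ℂ (Fin 4)) (Matrix.toLin' X.1)
  rw [LinearMap.toMatrix_eq_toMatrix', LinearMap.toMatrix'_toLin'] at h
  have h2 := congrFun (congrFun h i) j
  rw [LinearMap.toMatrix_apply] at h2
  exact h2

theorem exists_inChart_of_hasChartFrame (W : Gr 3 sl4) (hf : HasChartFrame (endSpace W.1)) :
    ∃ g : GL (Fin 4) ℂ, InChart (g • W).1 := by
  have := W.finiteDimensional three_pos
  obtain ⟨α₁, α₂, v₃, v₄, h13, h14, h23, h24, hinj⟩ := hf
  let φ : sl4 →ₗ[ℂ] Fin 3 → ℂ :=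
    { toFun := fun X => ![α₁ (toEnd X v₃), α₁ (toEnd X v₄), α₂ (toEnd X v₄)]
      map_add' := fun X Y => by
        funext i
        fin_cases i <;> simp
      map_smul' := fun c X => by
        funext i
        fin_cases i <;> simp }
  have hφ : ∀ X ∈ W.1, φ X = 0 → X = 0 := by
    intro X hX h
    obtain ⟨c, hc⟩ := hinj _ (toEnd_mem_endSpace hX) (congrFun h 0) (congrFun h 1) (congrFun h 2)
    exact eq_zero_of_toEnd_eq_smul_one hc
  have hinj' : Function.Injective (φ.comp W.1.subtype) := by
    rw [← LinearMap.ker_eq_bot, LinearMap.ker_eq_bot']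
    exact fun X hX => Subtype.ext (hφ X X.2 hX)
  have hsurj : Function.Surjective (φ.comp W.1.subtype) :=
    (LinearMap.injective_iff_surjective_of_finrank_eq_finrank
      (by rw [W.2, Module.finrank_fin_fun])).1 hinj'
  choose X hX using fun k : Fin 3 => hsurj (Pi.single k 1)
  have x1 : ∀ k, α₁ (toEnd (X k).1 v₃) = (Pi.single k 1 : Fin 3 → ℂ) 0 :=
    fun k => congrFun (hX k) 0
  have x2 : ∀ k, α₁ (toEnd (X k).1 v₄) = (Pi.single k 1 : Fin 3 → ℂ) 1 :=
    fun k => congrFun (hX k) 1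
  have x3 : ∀ k, α₂ (toEnd (X k).1 v₄) = (Pi.single k 1 : Fin 3 → ℂ) 2 :=
    fun k => congrFun (hX k) 2
  obtain ⟨B, hB⟩ := exists_basis_of_coord
    (v := ![toEnd (X 1).1 v₄, toEnd (X 2).1 v₄, v₃, v₄]) (Module.finrank_fin_fun ℂ) (by
      intro c hc
      simp only [Matrix.cons_val] at hc
      have c0 : c 0 = 0 := by
        have := congrArg α₁ hc
        simpa [x2, h13, h14] using this
      have c1 : c 1 = 0 := by
        have := congrArg α₂ hc
        simpa [x3, h23, h24] using this
      rw [c0, c1, zero_smul, zero_smul, zero_add, zero_add] at hc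
      have c2 : c 2 = 0 := by
        have := congrArg (fun v => α₁ (toEnd (X 0).1 v)) hc
        simpa [x1, x2] using this
      have c3 : c 3 = 0 := by
        have := congrArg (fun v => α₁ (toEnd (X 1).1 v)) hc
        simpa [x1, x2] using this
      intro i
      fin_cases i <;> assumption)
  have b0 : B 0 = toEnd (X 1).1 v₄ := hB 0
  have b1 : B 1 = toEnd (X 2).1 v₄ := hB 1
  have b2 : B 2 = v₃ := hB 2
  have b3 : B 3 = v₄ := hB 3
  have hc : ∀ i j : Fin 4, B.coord i (B j) = if j = i then 1 else 0 := fun i j => by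
    rw [B.coord_apply, B.repr_self, Finsupp.single_apply]
  have e0 : B.coord 0 = α₁ := B.ext fun i => by
    rw [hc]
    fin_cases i
    · exact Eq.symm (by simpa [x2] using congrArg α₁ b0)
    · exact Eq.symm (by simpa [x2] using congrArg α₁ b1)
    · exact Eq.symm ((congrArg α₁ b2).trans h13)
    · exact Eq.symm ((congrArg α₁ b3).trans h14)
  have e1 : B.coord 1 = α₂ := B.ext fun i => by
    rw [hc]
    fin_cases i
    · exact Eq.symm (by simpa [x3] using congrArg α₂ b0)
    · exact Eq.symm (by simpa [x3] using congrArg α₂ b1)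
    · exact Eq.symm ((congrArg α₂ b2).trans h23)
    · exact Eq.symm ((congrArg α₂ b3).trans h24)
  obtain ⟨g, hg⟩ := exists_conj_eq_coord B
  refine ⟨g, ?_⟩
  rintro _ ⟨Y, hY, rfl⟩ h0
  have y0 : (conj g Y).1 0 2 = 0 := congrFun h0 0
  have y1 : (conj g Y).1 0 3 = 0 := congrFun h0 1
  have y2 : (conj g Y).1 1 3 = 0 := congrFun h0 2
  rw [hg, e0, b2] at y0
  rw [hg, e0, b3] at y1
  rw [hg, e1, b3] at y2
  have hY0 : Y = 0 := hφ Y hY (by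
    funext i
    fin_cases i <;> assumption)
  rw [hY0, map_zero]

/-- A three-dimensional space of endomorphisms that map `ℂ⁴` to a plane `K` and kill `K` has a
frame: three of the four entries with respect to any bases are independent. -/
theorem hasChartFrame_of_le_flagAlgebra {W : Gr 3 sl4} {K : Submodule ℂ (Fin 4 → ℂ)}
    (hK : Module.finrank ℂ K = 2) (hWK : W.1 ≤ flagAlgebra K) : HasChartFrame (endSpace W.1) := by
  have := W.finiteDimensional three_pos
  obtain ⟨C, hC⟩ := exists_isCompl K
  have hC2 : Module.finrank ℂ C = 2 := by
    have a := Submodule.finrank_add_eq_of_isCompl hC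
    rw [hK, Module.finrank_fin_fun] at a
    omega
  let bK : Module.Basis (Fin 2) ℂ K := Module.finBasisOfFinrankEq ℂ K hK
  let bC : Module.Basis (Fin 2) ℂ C := Module.finBasisOfFinrankEq ℂ C hC2
  let α : Fin 2 → Module.Dual ℂ (Fin 4 → ℂ) := fun i => bK.coord i ∘ₗ K.projectionOnto C hC
  let v : Fin 2 → Fin 4 → ℂ := fun j => bC j
  have hαv : ∀ i j, α i (v j) = 0 := fun i j => by
    simp only [α, v, LinearMap.comp_apply]
    rw [Submodule.projectionOnto_apply_right hC, map_zero]
  let φ : sl4 →ₗ[ℂ] Fin 2 × Fin 2 → ℂ :=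
    { toFun := fun X p => α p.1 (toEnd X (v p.2))
      map_add' := fun X Y => by
        funext i
        simp
      map_smul' := fun c X => by
        funext i
        simp }
  have hφ : ∀ X ∈ W.1, φ X = 0 → X = 0 := by
    intro X hX h
    have hXv : ∀ j, toEnd X (v j) = 0 := by
      intro j
      have hmem : toEnd X (v j) ∈ K := (hWK hX).1 _
      have h1 : (⟨_, hmem⟩ : K) = 0 := by
        refine bK.ext_elem fun i => ?_
        have := congrFun h (i, j)
        change bK.coord i (K.projectionOnto C hC (⟨_, hmem⟩ : K)) = 0 at this
        rw [Submodule.projectionOnto_apply_left hC] at this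
        rw [map_zero]
        exact this
      exact congrArg Subtype.val h1
    refine toEnd_injective (LinearMap.ext fun w => ?_)
    obtain ⟨k, hk, c, hc, rfl⟩ := Submodule.mem_sup.1
      (show w ∈ K ⊔ C by rw [hC.sup_eq_top]; trivial)
    have h1 : toEnd X k = 0 := (hWK hX).2 k hk
    have h2 : c = ∑ j, bC.coord j ⟨c, hc⟩ • v j := by
      have := congrArg Subtype.val (bC.sum_repr ⟨c, hc⟩)
      rw [Submodule.coe_sum] at this
      exact this.symm
    rw [map_add, h1, h2, map_sum]
    simp only [map_smul, hXv, smul_zero, Finset.sum_const_zero, map_zero, LinearMap.zero_apply,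
      add_zero]
  -- One of the four entries can be omitted.
  obtain ⟨⟨i, j⟩, hp⟩ : ∃ p, ∀ X ∈ W.1, (∀ q, q ≠ p → φ X q = 0) → X = 0 := by
    by_contra! hcon
    choose X hXW hXz hXne using hcon
    have hs : ∀ p, φ (X p) p ≠ 0 := by
      intro p h0
      refine hXne p (hφ _ (hXW p) (funext fun q => ?_))
      by_cases hq : q = p
      · rw [hq, h0]
        rfl
      · exact hXz p q hq
    have hi : LinearIndependent ℂ fun p => (⟨X p, hXW p⟩ : W.1) := by
      refine Fintype.linearIndependent_iff.2 fun c hc p => ?_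
      have h1 := congrArg (fun Y : W.1 => φ Y.1 p) hc
      simp only [Submodule.coe_sum, Submodule.coe_smul, map_sum, map_smul, Finset.sum_apply,
        Pi.smul_apply, Submodule.coe_zero, map_zero, Pi.zero_apply, smul_eq_mul] at h1
      rw [Finset.sum_eq_single p (fun q _ hq => by rw [hXz q p (Ne.symm hq), mul_zero])
        (fun h => absurd (Finset.mem_univ p) h)] at h1
      exact (mul_eq_zero.1 h1).resolve_right (hs p)
    have h4 := hi.fintype_card_le_finrank
    rw [W.2] at h4
    simp at h4
  have hother : ∀ i j a b : Fin 2, (a, b) ≠ (i, j) →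
      (a, b) = (i.rev, j) ∨ (a, b) = (i.rev, j.rev) ∨ (a, b) = (i, j.rev) := by decide
  refine ⟨α i.rev, α i, v j, v j.rev, hαv _ _, hαv _ _, hαv _ _, hαv _ _, ?_⟩
  intro Z hZ h1 h2 h3
  obtain ⟨Y, hY, c, rfl⟩ := mem_endSpace.1 hZ
  refine ⟨c, ?_⟩
  have h0 : ∀ a b, α a ((toEnd Y + c • (1 : Module.End ℂ (Fin 4 → ℂ))) (v b)) = φ Y (a, b) := by
    intro a b
    rw [LinearMap.add_apply, map_add, LinearMap.smul_apply, Module.End.one_apply, map_smul, hαv,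
      smul_zero, add_zero]
    rfl
  rw [h0] at h1 h2 h3
  have hY0 : Y = 0 := by
    refine hp Y hY ?_
    rintro ⟨a, b⟩ hq
    rcases hother i j a b hq with h | h | h <;> rw [h] <;> assumption
  rw [hY0, map_zero, zero_add]

/-- The commuting subspaces outside of the two minimal orbits can be moved to the chart. -/
theorem exists_inChart {W : Gr 3 sl4} (hW : IsCommuting W.1) (hmin : W ∉ minimalOrbit)
    (hdual : W ∉ dualMinimalOrbit) : ∃ g : GL (Fin 4) ℂ, InChart (g • W).1 := by
  refine exists_inChart_of_hasChartFrame W ?_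
  by_contra hno
  have hsq : ∀ X ∈ W.1, X.1 * X.1 = 0 := by
    intro X hX
    obtain ⟨l, hl⟩ := exists_sub_smul_mul_self_eq_zero (Module.finrank_fin_fun ℂ)
      (endSpace_mul_comm hW) (one_mem_endSpace W.1) (three_lt_finrank_endSpace W) hno
      (toEnd_mem_endSpace hX)
    have h1 : (X.1 - l • 1) ^ 2 = 0 := by
      refine Matrix.toLin'.injective ?_
      rw [pow_two, Matrix.toLin'_mul, map_sub, map_smul, Matrix.toLin'_one, map_zero]
      exact hl
    have htr := (Matrix.isNilpotent_trace_of_isNilpotent ⟨2, h1⟩).eq_zero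
    rw [Matrix.trace_sub, mem_sl4.1 X.2, Matrix.trace_smul, Matrix.trace_one, Fintype.card_fin,
      smul_eq_mul] at htr
    have hl0 : l = 0 := by simpa using htr
    rwa [hl0, zero_smul, sub_zero, pow_two] at h1
  have hmul : ∀ X ∈ W.1, ∀ Y ∈ W.1, X.1 * Y.1 = 0 := by
    intro X hX Y hY
    have h : (X.1 + Y.1) * (X.1 + Y.1) = 0 := hsq _ (W.1.add_mem hX hY)
    rw [add_mul, mul_add, mul_add, hsq X hX, hsq Y hY, zero_add, add_zero, hW Y hY X hX,
      ← two_smul ℂ] at h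
    exact (smul_eq_zero.1 h).resolve_left two_ne_zero
  let K : Submodule ℂ (Fin 4 → ℂ) := ⨅ X : W.1, LinearMap.ker (toEnd X)
  have hK : ∀ v, v ∈ K ↔ ∀ X ∈ W.1, X.1 *ᵥ v = 0 := fun v => by
    simp [K, toEnd_apply]
  have hWK : W.1 ≤ flagAlgebra K := by
    intro X hX
    refine ⟨fun v => (hK _).2 fun Y hY => ?_, fun v hv => (hK v).1 hv X hX⟩
    rw [Matrix.mulVec_mulVec, hmul Y hY X hX, Matrix.zero_mulVec]
  have h1 := Submodule.finrank_mono hWK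
  have h2 := K.finrank_quotient_add_finrank
  rw [Module.finrank_fin_fun] at h2
  rw [W.2, finrank_flagAlgebra] at h1
  have h3 : Module.finrank ℂ K ≤ 4 := by omega
  obtain ⟨k, hk⟩ : ∃ k, k = Module.finrank ℂ K := ⟨_, rfl⟩
  have hq : Module.finrank ℂ ((Fin 4 → ℂ) ⧸ K) = 4 - k := by omega
  rw [hq, ← hk] at h1
  rw [← hk] at h3
  interval_cases k
  · omega
  · refine hmin ⟨⟨K, hk.symm⟩, Subtype.ext (Submodule.eq_of_le_of_finrank_eq hWK ?_).symm⟩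
    rw [W.2, finrank_flagAlgebra, hq, ← hk]
  · exact hno (hasChartFrame_of_le_flagAlgebra hk.symm hWK)
  · refine hdual ⟨⟨K, hk.symm⟩, Subtype.ext (Submodule.eq_of_le_of_finrank_eq hWK ?_).symm⟩
    rw [W.2, finrank_flagAlgebra, hq, ← hk]
  · omega

end Classification

/-! ### The variety of reductions as the variety of commuting subspaces -/

section Red4

/-- The last three entries of the first row. -/
def topRow : sl4 →ₗ[ℂ] Fin 3 → ℂ where
  toFun X i := X.1 0 i.succ
  map_add' _ _ := rfl
  map_smul' _ _ := rfl

theorem topRow_tracelessPart (X : Matrix (Fin 4) (Fin 4) ℂ) (i : Fin 3) :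
    topRow (tracelessPart X) i = X 0 i.succ :=
  tracelessPart_apply_of_ne X (Fin.succ_ne_zero i).symm

theorem linearIndependent_of_topRow {u : Fin 3 → sl4} (h : ∀ i, topRow (u i) = Pi.single i 1) :
    LinearIndependent ℂ u := by
  refine LinearIndependent.of_comp topRow ?_
  have : topRow ∘ u = fun k => Pi.single k 1 := funext h
  rw [this]
  exact Pi.linearIndependent_single_one (Fin 3) ℂ

/-- The traceless parts of the matrices `E₁ⱼ + Nⱼ`. -/
def lineFrame (N : Fin 3 → Matrix (Fin 4) (Fin 4) ℂ) (i : Fin 3) : sl4 :=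
  tracelessPart (Matrix.single 0 i.succ 1 + N i)

theorem topRow_lineFrame {N : Fin 3 → Matrix (Fin 4) (Fin 4) ℂ} (hN : ∀ i j, N i 0 (Fin.succ j) = 0)
    (i : Fin 3) : topRow (lineFrame N i) = Pi.single i 1 := by
  funext j
  rw [lineFrame, topRow_tracelessPart, Matrix.add_apply, hN, add_zero, Matrix.single_apply,
    Pi.single_apply]
  simp [eq_comm]

theorem linearIndependent_lineFrame {N : Fin 3 → Matrix (Fin 4) (Fin 4) ℂ}
    (hN : ∀ i j, N i 0 (Fin.succ j) = 0) : LinearIndependent ℂ (lineFrame N) :=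
  linearIndependent_of_topRow (topRow_lineFrame hN)

/-- The line spanned by the first basis vector. -/
def firstLine : Gr 1 (Fin 4 → ℂ) :=
  ⟨Submodule.span ℂ {Pi.single 0 1}, finrank_span_singleton (by
    intro h
    simpa using congrFun h 0)⟩

/-- The hyperplane of the vectors with vanishing first coordinate. -/
def firstHyperplane : Gr 3 (Fin 4 → ℂ) :=
  ⟨LinearMap.ker (LinearMap.proj 0 : (Fin 4 → ℂ) →ₗ[ℂ] ℂ), by
    have h := LinearMap.finrank_range_add_finrank_ker
      (LinearMap.proj 0 : (Fin 4 → ℂ) →ₗ[ℂ] ℂ)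
    rw [LinearMap.range_eq_top.2 (LinearMap.proj_surjective 0), finrank_top, Module.finrank_self,
      Module.finrank_fin_fun] at h
    omega⟩

theorem lineFrame_zero_mem (i : Fin 3) : lineFrame 0 i ∈ flagAlgebra firstLine.1 := by
  have hX : (lineFrame 0 i).1 = Matrix.single 0 i.succ 1 := by
    rw [lineFrame, tracelessPart_val, Pi.zero_apply, add_zero,
      Matrix.trace_single_eq_of_ne _ _ _ (Fin.succ_ne_zero i).symm, zero_div, zero_smul, sub_zero]
  have hv : ∀ v : Fin 4 → ℂ, (lineFrame 0 i).1 *ᵥ v = v i.succ • Pi.single 0 1 := by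
    intro v
    rw [hX, Matrix.single_mulVec]
    funext j
    simp [Function.update_apply, Pi.single_apply]
  refine ⟨fun v => ?_, fun v hv' => ?_⟩
  · rw [hv]
    exact Submodule.mem_span_singleton.2 ⟨_, rfl⟩
  · obtain ⟨c, rfl⟩ := Submodule.mem_span_singleton.1 hv'
    rw [hv]
    simp

theorem spanGr_lineFrame_zero :
    spanGr (lineFrame 0) (linearIndependent_lineFrame fun _ _ => rfl) = lineAlgebra firstLine := by
  refine Subtype.ext (Submodule.eq_of_le_of_finrank_eq (Submodule.span_le.2 ?_) ?_)
  · rintro _ ⟨k, rfl⟩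
    exact lineFrame_zero_mem k
  · exact (spanGr _ _).2.trans (lineAlgebra firstLine).2.symm

theorem map_transposition_lineAlgebra :
    (lineAlgebra firstLine).map transposition = hyperplaneAlgebra firstHyperplane := by
  refine Subtype.ext (Submodule.eq_of_le_of_finrank_eq ?_ ?_)
  · rintro _ ⟨X, hX, rfl⟩
    have h0 : (Pi.single 0 1 : Fin 4 → ℂ) ∈ firstLine.1 := Submodule.mem_span_singleton_self _
    have hcol : ∀ i, X.1 i 0 = 0 := fun i => by
      have := congrFun (hX.2 _ h0) i
      rwa [Matrix.mulVec_single_one] at this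
    have hrow : ∀ i j, i ≠ 0 → X.1 i j = 0 := fun i j hi => by
      obtain ⟨c, hc⟩ := Submodule.mem_span_singleton.1 (hX.1 (Pi.single j 1))
      have := congrFun hc i
      rw [Matrix.mulVec_single_one, Pi.smul_apply, Pi.single_eq_of_ne hi, smul_zero] at this
      exact this.symm
    refine ⟨fun v => ?_, fun v hv => ?_⟩
    · change (X.1ᵀ *ᵥ v) 0 = 0
      simp [Matrix.mulVec, dotProduct, hcol]
    · have hv0 : v 0 = 0 := hv
      change X.1ᵀ *ᵥ v = 0
      funext i
      simp only [Matrix.mulVec, dotProduct, Matrix.transpose_apply, Pi.zero_apply]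
      refine Finset.sum_eq_zero fun j _ => ?_
      by_cases hj : j = 0
      · rw [hj, hv0, mul_zero]
      · rw [hrow j i hj, zero_mul]
  · exact ((lineAlgebra firstLine).map transposition).2.trans
      (hyperplaneAlgebra firstHyperplane).2.symm

/-- If the matrices `E₁ⱼ + Nⱼ` commute, so do their traceless parts. -/
theorem isCommuting_spanGr_lineFrame {N : Fin 3 → Matrix (Fin 4) (Fin 4) ℂ}
    (hN : ∀ i j, N i 0 (Fin.succ j) = 0)
    (h : ∀ i j, (Matrix.single 0 (Fin.succ i) 1 + N i) * (Matrix.single 0 (Fin.succ j) 1 + N j) =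
      (Matrix.single 0 (Fin.succ j) 1 + N j) * (Matrix.single 0 (Fin.succ i) 1 + N i)) :
    IsCommuting (spanGr (lineFrame N) (linearIndependent_lineFrame hN)).1 :=
  isCommuting_span fun i j => tracelessPart_mul_comm (h i j)

theorem lineAlgebra_firstLine_mem : lineAlgebra firstLine ∈ closure regularCommuting := by
  -- For `t ≠ 0`, the matrices `E₁ⱼ + t Eⱼⱼ` are multiples of orthogonal idempotents.
  let N : ℂ → Fin 3 → Matrix (Fin 4) (Fin 4) ℂ := fun t i => t • Matrix.single i.succ i.succ 1
  have hN : ∀ t i j, N t i 0 (Fin.succ j) = 0 := fun t i j => by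
    simp [N]
  have hinf : {t : ℂ | spanGr (lineFrame (N t)) (linearIndependent_lineFrame (hN t)) ∈
      closure regularCommuting}.Infinite := by
    refine (Set.finite_singleton (0 : ℂ)).infinite_compl.mono fun t ht => subset_closure ⟨?_, ?_⟩
    · refine isCommuting_spanGr_lineFrame (hN t) fun i j => ?_
      by_cases hij : i = j
      · rw [hij]
      · have h1 : i.succ ≠ j.succ := fun h => hij (Fin.succ_injective _ h)
        simp [N, add_mul, mul_add, h1, h1.symm, Fin.succ_ne_zero]
    · let c : Fin 3 → ℂ := ![1, 2, 3]
      refine ⟨∑ i, c i • (Matrix.single 0 i.succ 1 + N t i), ?_, ?_⟩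
      · rw [map_sum]
        refine Submodule.sum_mem _ fun i _ => ?_
        rw [map_smul]
        exact Submodule.smul_mem _ _ (Submodule.subset_span ⟨i, rfl⟩)
      · have ht : t ≠ 0 := ht
        have hM : ∑ i, c i • (Matrix.single 0 i.succ 1 + N t i) =
            !![0, 1, 2, 3; 0, t, 0, 0; 0, 0, 2 * t, 0; 0, 0, 0, 3 * t] := by
          ext i j
          simp only [Fin.sum_univ_three, N, c]
          fin_cases i <;> fin_cases j <;> simp
        rw [hM]
        refine separable_charpoly_of_upperTriangular ?_ ?_
        · intro i j hij
          fin_cases i <;> fin_cases j <;> simp at hij ⊢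
        · intro i j hij
          fin_cases i <;> fin_cases j <;> simp [ht] at hij ⊢
          all_goals
            refine ht ?_
            first
            | linear_combination hij
            | linear_combination -hij
  have h := curve_mem_of_isClosed isClosed_closure (fun t => lineFrame (N t))
    (fun t => linearIndependent_lineFrame (hN t)) (fun f i => mem_polyFun.2
      ⟨Polynomial.C (f (tracelessPart (Matrix.single 0 i.succ 1))) +
        Polynomial.X * Polynomial.C (f (tracelessPart (Matrix.single i.succ i.succ 1))),
        fun t => by
          simp only [Polynomial.eval_add, Polynomial.eval_mul, Polynomial.eval_C,
            Polynomial.eval_X, lineFrame, N, map_add, map_smul, smul_eq_mul]⟩) hinf 0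
  rw [← spanGr_lineFrame_zero]
  have h0 : N 0 = 0 := by
    funext i
    simp [N]
  simpa only [h0] using h

/-- The variety of reductions is the variety of the commuting three-dimensional subspaces. -/
theorem mem_red4_iff {W : Gr 3 sl4} : W ∈ red4 ↔ IsCommuting W.1 := by
  refine ⟨isCommuting_of_mem_red4, fun hW => closure_mono regularCommuting_subset ?_⟩
  by_cases hmin : W ∈ minimalOrbit
  · rw [← orbit_lineAlgebra firstLine] at hmin
    obtain ⟨g, rfl⟩ := hmin
    exact smul_mem_closure_regularCommuting g lineAlgebra_firstLine_mem
  by_cases hdual : W ∈ dualMinimalOrbit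
  · rw [← orbit_hyperplaneAlgebra firstHyperplane] at hdual
    obtain ⟨g, rfl⟩ := hdual
    refine smul_mem_closure_regularCommuting g ?_
    rw [← map_transposition_lineAlgebra]
    exact Gr.map_mem_closure transposition
      (fun _ hU => map_transposition_mem_regularCommuting hU) lineAlgebra_firstLine_mem
  obtain ⟨g, hg⟩ := exists_inChart hW hmin hdual
  obtain ⟨x, hx⟩ := exists_eq_chartPoint (isCommuting_map_conj hW g) hg
  have h := smul_mem_closure_regularCommuting g⁻¹ (mem_closure_regularCommuting_chartPoint x)
  rwa [← hx, inv_smul_smul] at h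

theorem exists_smul_eq_chartPoint {W : Gr 3 sl4} (hW : W ∈ red4) (hmin : W ∉ minimalOrbit)
    (hdual : W ∉ dualMinimalOrbit) : ∃ (g : GL (Fin 4) ℂ) (x : Fin 12 → ℂ),
      g • W = chartPoint x := by
  have hW' := mem_red4_iff.1 hW
  obtain ⟨g, hg⟩ := exists_inChart hW' hmin hdual
  exact ⟨g, exists_eq_chartPoint (isCommuting_map_conj hW' g) hg⟩

theorem chartPoint_mem_red4 (x : Fin 12 → ℂ) : chartPoint x ∈ red4 :=
  mem_red4_iff.2 (isCommuting_chartPoint x)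

theorem lineAlgebra_mem_red4 (L : Gr 1 (Fin 4 → ℂ)) : lineAlgebra L ∈ red4 :=
  mem_red4_iff.2 (isCommuting_flagAlgebra L.1)

theorem hyperplaneAlgebra_mem_red4 (L : Gr 3 (Fin 4 → ℂ)) : hyperplaneAlgebra L ∈ red4 :=
  mem_red4_iff.2 (isCommuting_flagAlgebra L.1)

theorem smul_mem_red4 (g : GL (Fin 4) ℂ) {W : Gr 3 sl4} (hW : W ∈ red4) : g • W ∈ red4 :=
  mem_red4_iff.2 (isCommuting_map_conj (mem_red4_iff.1 hW) g)

theorem map_transposition_mem_red4 {W : Gr 3 sl4} (hW : W ∈ red4) : W.map transposition ∈ red4 :=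
  mem_red4_iff.2 (isCommuting_map_transposition (mem_red4_iff.1 hW))

end Red4

/-! ### Regular points and linear automorphisms -/

section Transport

variable {V V' : Type*} [AddCommGroup V] [Module ℂ V] [AddCommGroup V'] [Module ℂ V'] {k : ℕ}

theorem range_graph_map (e : V ≃ₗ[ℂ] V') {W W' : Submodule ℂ V} {U U' : Submodule ℂ V'}
    (a : W ≃ₗ[ℂ] U) (b : W' ≃ₗ[ℂ] U') (ha : ∀ w, (a w : V') = e w) (hb : ∀ w, (b w : V') = e w)
    (φ : W →ₗ[ℂ] W') :
    graph (b.toLinearMap ∘ₗ φ ∘ₗ a.symm.toLinearMap) = (graph φ).map (e : V →ₗ[ℂ] V') := by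
  ext v
  constructor
  · rintro ⟨u, rfl⟩
    refine ⟨_, ⟨a.symm u, rfl⟩, ?_⟩
    have h := ha (a.symm u)
    rw [LinearEquiv.apply_symm_apply] at h
    simp [hb, h]
  · rintro ⟨_, ⟨w, rfl⟩, rfl⟩
    exact ⟨a w, by simp [ha, hb]⟩

/-- Regularity of a point is invariant under linear automorphisms of the ambient space that preserve
the variety. -/
theorem IsRegularPoint.map {X : Set (Gr k V)} (e : V ≃ₗ[ℂ] V) (hX : ∀ W, W.map e ∈ X ↔ W ∈ X)
    {W : Gr k V} {hW : W ∈ X} (h : IsRegularPoint X W hW) :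
    IsRegularPoint X (W.map e) ((hX W).2 hW) := by
  intro U' hU'
  let W' : Submodule ℂ V := U'.map (e.symm : V →ₗ[ℂ] V)
  have hcompl : IsCompl W.1 W' := by
    have h1 := hU'.map (Submodule.orderIsoMapComap e.symm)
    have h2 : (W.map e).1.map (e.symm : V →ₗ[ℂ] V) = W.1 := by
      change (W.1.map (e : V →ₗ[ℂ] V)).map (e.symm : V →ₗ[ℂ] V) = W.1
      rw [← Submodule.map_comp]
      simp
    change IsCompl ((W.map e).1.map (e.symm : V →ₗ[ℂ] V)) W' at h1
    rwa [h2] at h1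
  let a : W.1 ≃ₗ[ℂ] (W.map e).1 := e.submoduleMap W.1
  let b : W' ≃ₗ[ℂ] U' := (e.symm.submoduleMap U').symm
  have ha : ∀ w, (a w : V) = e w := fun w => rfl
  have hb : ∀ w, (b w : V) = e w := fun w => by
    obtain ⟨u, rfl⟩ := (e.symm.submoduleMap U').surjective w
    simp [b]
  let T : (W.1 →ₗ[ℂ] W') ≃ₗ[ℂ] ((W.map e).1 →ₗ[ℂ] U') := LinearEquiv.arrowCongr a b
  have hT : ∀ φ, graph (T φ) = (graph φ).map (e : V →ₗ[ℂ] V) := range_graph_map e a b ha hb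
  have hmem : ∀ φ, T φ ∈ chartSet X (W.map e).1 U' ↔ φ ∈ chartSet X W.1 W' := by
    intro φ
    constructor
    · rintro ⟨U, hU, hUφ⟩
      refine ⟨U.map e.symm, (hX _).1 (by rwa [Gr.map_map_symm]), ?_⟩
      change U.1.map (e.symm : V →ₗ[ℂ] V) = _
      rw [hUφ, hT, ← Submodule.map_comp]
      simp
    · rintro ⟨U, hU, hUφ⟩
      refine ⟨U.map e, (hX _).2 hU, ?_⟩
      change U.1.map (e : V →ₗ[ℂ] V) = _
      rw [hUφ, hT]
  let τ : chartSet X W.1 W' ≃ chartSet X (W.map e).1 U' := T.toEquiv.subtypeEquiv fun φ =>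
    (hmem φ).symm
  exact isRegularLocalRing_of_linearEquiv T τ (fun z => rfl)
    ⟨0, zero_mem_chartSet hW W'⟩ ⟨0, zero_mem_chartSet ((hX W).2 hW) U'⟩
    (Subtype.ext (map_zero T)) (h W' hcompl)

end Transport

/-! ### Smoothness in the chart -/

section Smooth

/-- The algebra of polynomial functions of `n` variables. -/
def mvPolyFun (n : ℕ) : Subalgebra ℂ ((Fin n → ℂ) → ℂ) :=
  (AlgHom.pi fun x => MvPolynomial.aeval (R := ℂ) x).range

theorem mem_mvPolyFun {n : ℕ} {f : (Fin n → ℂ) → ℂ} :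
    f ∈ mvPolyFun n ↔ ∃ p : MvPolynomial (Fin n) ℂ, ∀ x, MvPolynomial.eval x p = f x := by
  constructor
  · rintro ⟨p, rfl⟩
    exact ⟨p, fun t => by simp [MvPolynomial.aeval_eq_eval]⟩
  · rintro ⟨p, hp⟩
    exact ⟨p, funext fun t => by simp [MvPolynomial.aeval_eq_eval, hp]⟩

theorem graph_injective {V : Type*} [AddCommGroup V] [Module ℂ V] {W W' : Submodule ℂ V}
    (h : IsCompl W W') : Function.Injective (graph : (W →ₗ[ℂ] W') → Submodule ℂ V) := by
  intro φ ψ hφψ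
  ext w
  have hmem : (w : V) + φ w ∈ graph ψ := by
    rw [← hφψ]
    exact ⟨w, rfl⟩
  obtain ⟨w', hw'⟩ := hmem
  have h1 : (w' : V) + ψ w' = w + φ w := hw'
  have h2 : (w' : V) - w = φ w - ψ w' := by
    rw [sub_eq_sub_iff_add_eq_add, h1, add_comm]
  have h3 : (w' : V) - w = 0 := by
    refine (Submodule.disjoint_def.1 h.disjoint) _ (W.sub_mem w'.2 w.2) ?_
    rw [h2]
    exact W'.sub_mem (φ w).2 (ψ w').2
  have h4 : w' = w := Subtype.ext (sub_eq_zero.1 h3)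
  rw [h3, h4] at h2
  exact sub_eq_zero.1 h2.symm

/-- The alternating form `det (Lₐ (u_b))` given by three linear forms `Lₐ`. -/
def detForm (L : Fin 3 → Module.Dual ℂ sl4) : sl4 [⋀^Fin 3]→ₗ[ℂ] ℂ :=
  Matrix.detRowAlternating.compLinearMap (LinearMap.pi L)

theorem detForm_apply (L : Fin 3 → Module.Dual ℂ sl4) (u : Fin 3 → sl4) :
    detForm L u = (Matrix.of fun b a => L a (u b)).det := rfl

/-- The matrix entry, as a linear form. -/
def entry (i j : Fin 4) : Module.Dual ℂ sl4 where
  toFun X := X.1 i j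
  map_add' _ _ := rfl
  map_smul' _ _ := rfl

/-- The coordinates of the chart are linear forms in the vectors of the normalized frame; these are
the linear forms. The diagonal coordinates refer to matrices with vanishing entry `(3, 3)`. -/
def coordForm : Fin 12 → Module.Dual ℂ sl4 :=
  ![entry 0 1, entry 1 2, entry 2 3, entry 0 1, entry 1 2, entry 1 1 - entry 2 2, entry 0 1,
    entry 1 2, entry 2 3, entry 1 1 - entry 2 2, entry 1 1 - entry 2 2, entry 1 0]

/-- The index of the vector of the frame from which the coordinate is read off. -/
def coordIndex : Fin 12 → Fin 3 := ![0, 0, 0, 2, 2, 0, 1, 1, 1, 2, 1, 2]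

theorem coordForm_chartFrame (x : Fin 12 → ℂ) (i : Fin 12) :
    coordForm i (chartFrame x (coordIndex i)) = x i := by
  have h1 : ∀ k a b, a ≠ b → entry a b (chartFrame x k) = chartMat x k a b :=
    fun k a b hab => tracelessPart_apply_of_ne _ hab
  have h2 : ∀ k,
      (entry 1 1 - entry 2 2) (chartFrame x k) = chartMat x k 1 1 - chartMat x k 2 2 := by
    intro k
    change (tracelessPart _).1 1 1 - (tracelessPart _).1 2 2 = _
    rw [tracelessPart_val]
    simp
  fin_cases i <;> simp only [Fin.zero_eta, Fin.mk_one, Fin.reduceFinMk, Fin.isValue, coordForm,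
    coordIndex, Matrix.cons_val]
  all_goals first
    | rw [h2]; simp [chartMat]
    | rw [h1 _ _ _ (by decide)]; simp [chartMat]

/-- The three entries that define the chart, as linear forms. -/
def entryForms (a : Fin 3) : Module.Dual ℂ sl4 := LinearMap.proj a ∘ₗ chartEntries

/-- The determinant of the three entries on a frame is the denominator of the coordinates. -/
def denForm : sl4 [⋀^Fin 3]→ₗ[ℂ] ℂ := detForm entryForms

/-- The numerators of the coordinates, by Cramer's rule. -/
def numForm (i : Fin 12) : sl4 [⋀^Fin 3]→ₗ[ℂ] ℂ :=
  detForm (Function.update entryForms (coordIndex i) (coordForm i))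

theorem entryForms_chartFrame (x : Fin 12 → ℂ) (a b : Fin 3) :
    entryForms a (chartFrame x b) = if a = b then 1 else 0 := by
  change chartEntries (chartFrame x b) a = _
  rw [chartEntries_chartFrame, Pi.single_apply]

theorem denForm_chartFrame (x : Fin 12 → ℂ) : denForm (chartFrame x) = 1 := by
  rw [denForm, detForm_apply]
  convert Matrix.det_one (n := Fin 3) (R := ℂ)
  ext b a
  rw [Matrix.of_apply, entryForms_chartFrame, Matrix.one_apply]
  simp [eq_comm]

theorem numForm_chartFrame (x : Fin 12 → ℂ) (i : Fin 12) : numForm i (chartFrame x) = x i := by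
  rw [numForm, detForm_apply, ← coordForm_chartFrame x i]
  generalize coordForm i = f
  generalize coordIndex i = k
  rw [Matrix.det_fin_three]
  fin_cases k <;> simp [entryForms_chartFrame, Function.update_apply]

/-- The coordinates of a point of the chart in terms of any frame. -/
theorem numForm_div_denForm {x : Fin 12 → ℂ} {u : Fin 3 → sl4}
    (hu : ∀ i, u i ∈ (chartPoint x).1) (h0 : denForm u ≠ 0) (i : Fin 12) :
    numForm i u / denForm u = x i := by
  obtain ⟨c, hc⟩ := exists_pluecker_eq_mul (linearIndependent_chartFrame x) u hu
  rw [hc, denForm_chartFrame, mul_one] at h0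
  rw [hc, hc, denForm_chartFrame, numForm_chartFrame, mul_one, mul_div_cancel_left₀ _ h0]

theorem inChart_of_denForm_ne_zero {u : Fin 3 → sl4} (h : denForm u ≠ 0) :
    InChart (Submodule.span ℂ (Set.range u)) := by
  intro X hX h0
  obtain ⟨c, rfl⟩ := (Submodule.mem_span_range_iff_exists_fun ℂ).1 hX
  have hc : c ᵥ* (Matrix.of fun b a => entryForms a (u b)) = 0 := by
    funext a
    have := congrFun h0 a
    rw [map_sum, Finset.sum_apply] at this
    simpa [Matrix.vecMul, dotProduct, entryForms] using this
  rw [denForm, detForm_apply] at h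
  have := Matrix.eq_zero_of_vecMul_eq_zero h hc
  simp [this]

theorem graph_eq_span {V : Type*} [AddCommGroup V] [Module ℂ V] {W W' : Submodule ℂ V}
    (φ : W →ₗ[ℂ] W') {n : ℕ} (b : Module.Basis (Fin n) ℂ W) :
    graph φ = Submodule.span ℂ (Set.range fun j => (b j : V) + φ (b j)) := by
  rw [graph, LinearMap.range_eq_map, ← b.span_eq, Submodule.map_span, ← Set.range_comp]
  rfl

/-- The variety of reductions is smooth at the points of the chart: the frames `u + φ u` of the
graphs `φ` and the frames of the points of the chart yield mutually inverse rational maps. -/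
theorem isRegularPoint_chartPoint (x₀ : Fin 12 → ℂ) :
    IsRegularPoint red4 (chartPoint x₀) (chartPoint_mem_red4 x₀) := by
  intro W' hW'
  let W := (chartPoint x₀).1
  let b : Module.Basis (Fin 3) ℂ W := Module.Basis.span (linearIndependent_chartFrame x₀)
  have hb : ∀ j, (b j : sl4) = chartFrame x₀ j := fun j =>
    congrArg Subtype.val (Module.Basis.span_apply (linearIndependent_chartFrame x₀) j)
  let pW : sl4 →ₗ[ℂ] W := W.projectionOnto W' hW'
  let pW' : sl4 →ₗ[ℂ] W' := W'.projectionOnto W hW'.symm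
  have hp : ∀ v, (pW v : sl4) + pW' v = v := fun v =>
    Submodule.projection_add_projection_eq_self hW' v
  let Z := chartSet red4 W W'
  let u : (W →ₗ[ℂ] W') → Fin 3 → sl4 := fun φ j => (b j : sl4) + φ (b j)
  have hgraph : ∀ φ, graph φ = Submodule.span ℂ (Set.range (u φ)) := fun φ => graph_eq_span φ b
  have humem : ∀ φ j, u φ j ∈ graph φ := fun φ j => ⟨b j, rfl⟩
  have hS : ∀ ω : sl4 [⋀^Fin 3]→ₗ[ℂ] ℂ, (fun φ : Z => ω (u φ)) ∈ coordinateRing Z := by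
    refine pluecker_mem (coordinateRing Z) (fun φ : Z => u φ) fun f j => ?_
    have h : (fun φ : Z => f (u φ j)) = algebraMap ℂ (Z → ℂ) (f (b j)) +
        fun φ : Z => (f ∘ₗ W'.subtype ∘ₗ LinearMap.applyₗ (b j)) φ.1 := by
      funext φ
      simp [u]
    rw [h]
    exact Subalgebra.add_mem _ (Subalgebra.algebraMap_mem _ _) (dual_mem_coordinateRing Z _)
  -- The matrix of the projection of the frame to `W`.
  have hM : ∀ s j, ∃ p : MvPolynomial (Fin 12) ℂ, ∀ x,
      MvPolynomial.eval x p = b.coord j (pW (chartFrame x s)) := fun s j =>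
    mem_mvPolyFun.1 (chartFrame_mem_subalgebra (mvPolyFun 12) (fun x => x)
      (fun i => mem_mvPolyFun.2 ⟨MvPolynomial.X i, fun x => MvPolynomial.eval_X i⟩)
      (b.coord j ∘ₗ pW) s)
  choose P hP using hM
  let g' : MvPolynomial (Fin 12) ℂ := (Matrix.of P).det
  let M : (Fin 12 → ℂ) → Matrix (Fin 3) (Fin 3) ℂ := fun x =>
    Matrix.of fun s j => b.coord j (pW (chartFrame x s))
  have hPM : ∀ x, (Matrix.of P).map (MvPolynomial.eval x) = M x := fun x => by
    ext s j
    exact hP s j x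
  have hg' : ∀ x, MvPolynomial.eval x g' = (M x).det := fun x => by
    rw [← hPM]
    exact RingHom.map_det _ _
  let Ψ : (Fin 12 → ℂ) → (W →ₗ[ℂ] W') := fun x =>
    ∑ j, ∑ s, (M x)⁻¹ j s • (b.coord j).smulRight (pW' (chartFrame x s))
  have hΨb : ∀ x j, Ψ x (b j) = ∑ s, (M x)⁻¹ j s • pW' (chartFrame x s) := by
    intro x j
    simp only [Ψ, LinearMap.sum_apply, LinearMap.smul_apply, LinearMap.smulRight_apply]
    rw [Finset.sum_eq_single j]
    · simp
    · intro i _ hij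
      simp [hij]
    · simp
  have hΨ : ∀ x, (M x).det ≠ 0 → graph (Ψ x) = (chartPoint x).1 := by
    intro x hx
    have hu' : ∀ j, u (Ψ x) j = ∑ s, (M x)⁻¹ j s • chartFrame x s := by
      intro j
      have h1 : pW (∑ s, (M x)⁻¹ j s • chartFrame x s) = b j := by
        refine b.ext_elem fun i => ?_
        rw [map_sum, map_sum, Finset.sum_apply']
        have h2 := congrFun (congrFun (Matrix.nonsing_inv_mul (M x) hx.isUnit) j) i
        rw [Matrix.mul_apply, Matrix.one_apply] at h2
        rw [b.repr_self, Finsupp.single_apply, ← h2]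
        refine Finset.sum_congr rfl fun s _ => ?_
        rw [map_smul, map_smul]
        rfl
      rw [← hp (∑ s, (M x)⁻¹ j s • chartFrame x s), h1]
      simp only [u, hΨb, map_sum, map_smul]
    refine Submodule.eq_of_le_of_finrank_eq ?_ ?_
    · rw [hgraph]
      refine Submodule.span_le.2 ?_
      rintro _ ⟨j, rfl⟩
      rw [hu']
      exact Submodule.sum_mem _ fun s _ => Submodule.smul_mem _ _ (chartFrame_mem x s)
    · rw [(chartPoint x).2, graph, LinearMap.finrank_range_of_inj, (chartPoint x₀).2]
      intro w w' hww
      have h1 : (w : sl4) + Ψ x w = w' + Ψ x w' := hww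
      have h2 := congrArg pW h1
      rwa [map_add, map_add, Submodule.projectionOnto_apply_left hW',
        Submodule.projectionOnto_apply_right hW', Submodule.projectionOnto_apply_left hW',
        Submodule.projectionOnto_apply_right hW', add_zero, add_zero] at h2
  have hu0 : u 0 = chartFrame x₀ := by
    funext j
    simp [u, hb]
  have hx₀ : (fun i => numForm i (u 0) / denForm (u 0)) = x₀ := by
    rw [hu0]
    funext i
    rw [numForm_chartFrame, denForm_chartFrame, div_one]
  refine isRegularLocalRing_of_chart (fun i => ⟨_, hS (numForm i)⟩) ⟨_, hS denForm⟩ ?_ g' Ψ ?_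
    (fun x hx => ?_) (fun f => ?_) (fun y hy hgy => ?_) (fun x hx hgx i => ?_)
  · change denForm (u 0) ≠ 0
    rw [hu0, denForm_chartFrame]
    exact one_ne_zero
  · change MvPolynomial.eval (fun i => numForm i (u 0) / denForm (u 0)) g' ≠ 0
    rw [hx₀, hg']
    have : M x₀ = 1 := by
      ext s j
      change b.coord j (pW (chartFrame x₀ s)) = _
      rw [← hb, Submodule.projectionOnto_apply_left hW', b.coord_apply, b.repr_self,
        Finsupp.single_apply, Matrix.one_apply]
    rw [this, Matrix.det_one]
    exact one_ne_zero
  · rw [hg'] at hx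
    exact ⟨chartPoint x, chartPoint_mem_red4 x, (hΨ x hx).symm⟩
  · have hQ : ∀ s j, ∃ q : MvPolynomial (Fin 12) ℂ, ∀ x, MvPolynomial.eval x q =
        f ((b.coord j).smulRight (pW' (chartFrame x s))) := fun s j =>
      mem_mvPolyFun.1 (chartFrame_mem_subalgebra (mvPolyFun 12) (fun x => x)
        (fun i => mem_mvPolyFun.2 ⟨MvPolynomial.X i, fun x => MvPolynomial.eval_X i⟩)
        (f ∘ₗ LinearMap.smulRightₗ (b.coord j) ∘ₗ pW') s)
    choose Q hQ using hQ
    refine ⟨∑ j, ∑ s, (Matrix.of P).adjugate j s * Q s j, fun x hx => ?_⟩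
    rw [hg'] at hx ⊢
    have hadj : ∀ j s, MvPolynomial.eval x ((Matrix.of P).adjugate j s) = (M x).adjugate j s := by
      intro j s
      have := RingHom.map_adjugate (MvPolynomial.eval x) (Matrix.of P)
      rw [RingHom.mapMatrix_apply, RingHom.mapMatrix_apply, hPM] at this
      exact congrFun (congrFun this j) s
    simp only [Ψ, map_sum, map_smul, map_mul, hadj, hQ, Finset.mul_sum, smul_eq_mul]
    refine Finset.sum_congr rfl fun j _ => Finset.sum_congr rfl fun s _ => ?_
    rw [Matrix.inv_def, Matrix.smul_apply, Ring.inverse_eq_inv', smul_eq_mul, ← mul_assoc,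
      ← mul_assoc, mul_inv_cancel₀ hx, one_mul]
  · obtain ⟨φ, U, hU, hUφ⟩ := y
    change denForm (u φ) ≠ 0 at hy
    have hUc : InChart U.1 := by
      rw [hUφ, hgraph]
      exact inChart_of_denForm_ne_zero hy
    obtain ⟨x, rfl⟩ := exists_eq_chartPoint (mem_red4_iff.1 hU) hUc
    have hx : (fun i => numForm i (u φ) / denForm (u φ)) = x :=
      funext fun i => numForm_div_denForm (fun j => hUφ ▸ humem φ j) hy i
    change MvPolynomial.eval (fun i => numForm i (u φ) / denForm (u φ)) g' ≠ 0 at hgy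
    change Ψ (fun i => numForm i (u φ) / denForm (u φ)) = φ
    rw [hx] at hgy ⊢
    rw [hg'] at hgy
    exact graph_injective hW' ((hΨ x hgy).trans hUφ)
  · rw [hg'] at hx
    exact numForm_div_denForm (fun j => (hΨ x hx).le (humem (Ψ x) j)) hgx i

theorem smul_mem_red4_iff (g : GL (Fin 4) ℂ) (W : Gr 3 sl4) :
    W.map (conj g) ∈ red4 ↔ W ∈ red4 := by
  refine ⟨fun h => ?_, fun h => smul_mem_red4 g h⟩
  have := smul_mem_red4 g⁻¹ h
  change g⁻¹ • (g • W) ∈ red4 at this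
  rwa [inv_smul_smul] at this

theorem smul_mem_regularLocus (g : GL (Fin 4) ℂ) {W : Gr 3 sl4} (hW : W ∈ regularLocus red4) :
    g • W ∈ regularLocus red4 := by
  obtain ⟨hW, h⟩ := hW
  exact ⟨smul_mem_red4 g hW, h.map (conj g) (smul_mem_red4_iff g)⟩

theorem mem_regularLocus {W : Gr 3 sl4} (hW : W ∈ red4) (hmin : W ∉ minimalOrbit)
    (hdual : W ∉ dualMinimalOrbit) : W ∈ regularLocus red4 := by
  obtain ⟨g, x, hx⟩ := exists_smul_eq_chartPoint hW hmin hdual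
  have h := smul_mem_regularLocus g⁻¹ ⟨_, isRegularPoint_chartPoint x⟩
  rwa [← hx, inv_smul_smul] at h

theorem orbitO6_subset_regularLocus : orbitO6 ⊆ regularLocus red4 := by
  rintro _ ⟨g, rfl⟩
  refine smul_mem_regularLocus g ?_
  rw [o6Point_eq_chartPoint]
  exact ⟨_, isRegularPoint_chartPoint 0⟩

end Smooth

/-! ### Singularity along the minimal orbits -/

section SingularPoints

/-- The structure constants of the algebra in which the only nonzero products of basis vectors are
`x_p x_q = x_q x_p = x_r`, and also `x_q² = x_q` if `r = p ≠ q` and `x_p² = x_p` if `r = q ≠ p`. -/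
def structConst (p q r i j k : Fin 3) : ℕ :=
  if (((i = p ∧ j = q) ∨ (i = q ∧ j = p)) ∧ k = r) ∨
    (p ≠ q ∧ i = j ∧ j = k ∧ ((r = p ∧ i = q) ∨ (r = q ∧ i = p))) then 1 else 0

theorem structConst_symm : ∀ p q r i j k,
    structConst p q r i j k = structConst p q r j i k := by
  decide +kernel

/-- Associativity of the commutative algebras. -/
theorem structConst_assoc : ∀ p q r i j l k,
    ∑ a, structConst p q r l i a * structConst p q r a j k =
      ∑ a, structConst p q r l j a * structConst p q r a i k := by
  decide +kernel

/-- The matrices of the multiplications by the basis vectors of the algebra, without the first row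
and column. -/
def lineMat (p q r j : Fin 3) : Matrix (Fin 4) (Fin 4) ℂ :=
  Matrix.of fun a b => Fin.cases (motive := fun _ => ℂ) 0 (fun i =>
    Fin.cases (motive := fun _ => ℂ) 0 (fun k => (structConst p q r i j k : ℂ)) b) a

theorem lineMat_zero_left (p q r j : Fin 3) (b : Fin 4) : lineMat p q r j 0 b = 0 := rfl

theorem lineMat_zero_right (p q r j : Fin 3) (a : Fin 4) : lineMat p q r j a 0 = 0 := by
  cases a using Fin.cases <;> rfl

theorem lineMat_succ (p q r j i k : Fin 3) :
    lineMat p q r j i.succ k.succ = structConst p q r i j k := rfl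

theorem lineMat_mul_comm (p q r i j : Fin 3) (t : ℂ) :
    (Matrix.single 0 i.succ 1 + t • lineMat p q r i) *
        (Matrix.single 0 j.succ 1 + t • lineMat p q r j) =
      (Matrix.single 0 j.succ 1 + t • lineMat p q r j) *
        (Matrix.single 0 i.succ 1 + t • lineMat p q r i) := by
  have hss : ∀ i j : Fin 3, (Matrix.single 0 i.succ 1 : Matrix (Fin 4) (Fin 4) ℂ) *
      Matrix.single 0 j.succ 1 = 0 := fun i j => by
    simp [Fin.succ_ne_zero]
  have hms : ∀ i j : Fin 3, lineMat p q r i * Matrix.single 0 j.succ 1 = 0 := fun i j => by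
    ext a b
    rw [Matrix.mul_apply]
    refine Finset.sum_eq_zero fun c _ => ?_
    by_cases hc : c = 0
    · rw [hc, lineMat_zero_right, zero_mul]
    · rw [Matrix.single_apply_of_row_ne (Ne.symm hc), mul_zero]
  have hsm : ∀ i j : Fin 3, Matrix.single 0 i.succ 1 * lineMat p q r j =
      Matrix.single 0 j.succ 1 * lineMat p q r i := fun i j => by
    ext a b
    by_cases ha : a = 0
    · rw [ha, Matrix.single_mul_apply_same, Matrix.single_mul_apply_same]
      cases b using Fin.cases with
      | zero => rw [lineMat_zero_right, lineMat_zero_right]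
      | succ k => rw [lineMat_succ, lineMat_succ, structConst_symm]
    · rw [Matrix.single_mul_apply_of_ne _ _ _ _ _ ha, Matrix.single_mul_apply_of_ne _ _ _ _ _ ha]
  have hmm : lineMat p q r i * lineMat p q r j = lineMat p q r j * lineMat p q r i := by
    ext a b
    rw [Matrix.mul_apply, Matrix.mul_apply]
    cases a using Fin.cases with
    | zero => simp [lineMat_zero_left]
    | succ l =>
      cases b using Fin.cases with
      | zero => simp [lineMat_zero_right]
      | succ k =>
        have hs : ∀ f : Fin 4 → ℂ, ∑ c, f c = f 0 + ∑ c : Fin 3, f c.succ := Fin.sum_univ_succ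
        rw [hs, hs, lineMat_zero_right, lineMat_zero_right, zero_mul,
          zero_mul]
        simp only [lineMat_succ]
        exact_mod_cast congrArg (0 + ·) (structConst_assoc p q r i j l k)
  simp only [add_mul, mul_add, hss, smul_mul_assoc, mul_smul_comm, hms, hmm, hsm i j]




/-- The first row of the product of `X i` and `X j` is the row `i` of `X j`. -/
theorem entry_symm_of_commute {X : Fin 3 → Matrix (Fin 4) (Fin 4) ℂ}
    (hX : ∀ i j, X i * X j = X j * X i) (h0 : ∀ j, X j 0 0 = 0)
    (h1 : ∀ j k : Fin 3, X j 0 k.succ = if j = k then 1 else 0) (i j : Fin 3) (c : Fin 4) :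
    X j i.succ c = X i j.succ c := by
  have h : ∀ i j, (X i * X j) 0 c = X j i.succ c := fun i j => by
    rw [Matrix.mul_apply, Fin.sum_univ_succ, h0, zero_mul, zero_add]
    simp [h1]
  rw [← h i j, ← h j i, hX]

theorem entry_succ_of_commute {X : Fin 3 → Matrix (Fin 4) (Fin 4) ℂ}
    (hX : ∀ i j, X i * X j = X j * X i)
    (h1 : ∀ j k : Fin 3, X j 0 k.succ = if j = k then 1 else 0) (i j l k : Fin 3) :
    X i l.succ 0 * (if j = k then 1 else 0) + ∑ m : Fin 3, X i l.succ m.succ * X j m.succ k.succ =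
      X j l.succ 0 * (if i = k then 1 else 0) +
        ∑ m : Fin 3, X j l.succ m.succ * X i m.succ k.succ := by
  have h := congrFun (congrFun (hX i j) l.succ) k.succ
  have hs : ∀ f : Fin 4 → ℂ, ∑ c, f c = f 0 + ∑ c : Fin 3, f c.succ := Fin.sum_univ_succ
  rwa [Matrix.mul_apply, Matrix.mul_apply, hs, hs, h1, h1] at h


theorem isCompl_ker_topRow : IsCompl (lineAlgebra firstLine).1 (LinearMap.ker topRow) := by
  have hspan : (lineAlgebra firstLine).1 = Submodule.span ℂ (Set.range (lineFrame 0)) := by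
    rw [← spanGr_lineFrame_zero]
    rfl
  have htop : ∀ c : Fin 3 → ℂ, topRow (∑ i, c i • lineFrame 0 i) = c := fun c => by
    rw [map_sum]
    funext k
    simp [topRow_lineFrame (N := 0) fun _ _ => rfl, Finset.sum_apply, Pi.single_apply]
  rw [hspan]
  constructor
  · rw [Submodule.disjoint_def]
    intro Y hY h0
    obtain ⟨c, rfl⟩ := (Submodule.mem_span_range_iff_exists_fun ℂ).1 hY
    have h0' : topRow (∑ i, c i • lineFrame 0 i) = 0 := h0
    rw [htop] at h0'
    simp [h0']
  · rw [codisjoint_iff, eq_top_iff]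
    intro Y _
    refine Submodule.mem_sup.2 ⟨∑ i, topRow Y i • lineFrame 0 i,
      (Submodule.mem_span_range_iff_exists_fun ℂ).2 ⟨_, rfl⟩,
      Y - ∑ i, topRow Y i • lineFrame 0 i, ?_, by abel⟩
    rw [LinearMap.mem_ker, map_sub, htop, sub_self]

/-- The indices `(i, j, k)` with `i ≤ j` of the structure constants of commutative algebras with
basis `x₁, x₂, x₃` modulo scalars. -/
abbrev StructIndex : Type := {p : Fin 3 × Fin 3 × Fin 3 // p.1 ≤ p.2.1}

/-- The structure constant with the indices in any order, as a variable. -/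
def structVar (i j k : Fin 3) : MvPolynomial StructIndex ℂ :=
  MvPolynomial.X ⟨(min i j, max i j, k), min_le_max⟩

theorem structConst_triangular : ∀ m : StructIndex,
    (∀ l : StructIndex, structConst m.1.1 m.1.2.1 m.1.2.2 l.1.1 l.1.2.1 l.1.2.2 =
      if l = m then 1 else 0) ∨
    ∃ d : StructIndex, d ≠ m ∧
      (∀ l : StructIndex, structConst d.1.1 d.1.2.1 d.1.2.2 l.1.1 l.1.2.1 l.1.2.2 =
        if l = d then 1 else 0) ∧
      ∀ l : StructIndex, structConst m.1.1 m.1.2.1 m.1.2.2 l.1.1 l.1.2.1 l.1.2.2 =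
        (if l = m then 1 else 0) + if l = d then 1 else 0 := by
  decide +kernel

/-- In the chart of the complement `ker topRow`, a point is spanned modulo scalars by matrices `X j`
with first rows the last three basis vectors, and the commuting matrices `X j` are the
multiplication matrices of a commutative associative algebra with basis `1, x₁, x₂, x₃`. The
eighteen structure constants `xᵢ xⱼ ↦ x_k` generate the coordinate ring, they satisfy a nontrivial
relation, and there are eighteen independent lines through the origin. -/
theorem not_isRegularPoint_firstLine :
    ¬IsRegularPoint red4 (lineAlgebra firstLine) (lineAlgebra_mem_red4 firstLine) := by
  intro hreg
  let W := (lineAlgebra firstLine).1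
  let W' : Submodule ℂ sl4 := LinearMap.ker topRow
  have hW' : IsCompl W W' := isCompl_ker_topRow
  have hspan : W = Submodule.span ℂ (Set.range (lineFrame 0)) := by
    change (lineAlgebra firstLine).1 = _
    rw [← spanGr_lineFrame_zero]
    rfl
  have hlin : LinearIndependent ℂ (lineFrame 0) := linearIndependent_lineFrame fun _ _ => rfl
  let b : Module.Basis (Fin 3) ℂ W := (Module.Basis.span hlin).map (LinearEquiv.ofEq _ _ hspan.symm)
  have hb : ∀ j, (b j : sl4) = lineFrame 0 j := fun j =>
    congrArg Subtype.val (Module.Basis.span_apply hlin j)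
  have hbv : ∀ j, (b j : sl4).1 = Matrix.single 0 j.succ 1 := fun j => by
    rw [hb, lineFrame, tracelessPart_val, Pi.zero_apply, add_zero,
      Matrix.trace_single_eq_of_ne _ _ _ (Fin.succ_ne_zero j).symm, zero_div, zero_smul, sub_zero]
  let pW' : sl4 →ₗ[ℂ] W' := W'.projectionOnto W hW'.symm
  let Z := chartSet red4 W W'
  let D : Fin 3 → Fin 3 → Module.Dual ℂ sl4 := fun i k =>
    entry i.succ k.succ - if i = k then entry 0 0 else 0
  let Γ : Fin 3 → Fin 3 → Fin 3 → Module.Dual ℂ (W →ₗ[ℂ] W') := fun i j k =>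
    D i k ∘ₗ W'.subtype ∘ₗ LinearMap.applyₗ (b j)
  -- The matrices `X j` of the point `φ`.
  let X : (W →ₗ[ℂ] W') → Fin 3 → Matrix (Fin 4) (Fin 4) ℂ := fun φ j =>
    ((b j : sl4).1 + (φ (b j) : sl4).1) - (φ (b j) : sl4).1 0 0 • 1
  have hXsucc : ∀ φ j (i k : Fin 3), X φ j i.succ k.succ = Γ i j k φ := by
    intro φ j i k
    have : Γ i j k φ = (φ (b j) : sl4).1 i.succ k.succ -
        if i = k then (φ (b j) : sl4).1 0 0 else 0 := by
      change (entry i.succ k.succ - if i = k then entry 0 0 else 0 : Module.Dual ℂ sl4) _ = _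
      split_ifs <;> rfl
    rw [this]
    simp only [X, hbv, Matrix.sub_apply, Matrix.add_apply, Matrix.smul_apply, Matrix.one_apply,
      smul_eq_mul, Fin.succ_inj, mul_ite, mul_one, mul_zero]
    rw [Matrix.single_apply_of_row_ne (Fin.succ_ne_zero i).symm, zero_add]
  have htop : ∀ (φ : W →ₗ[ℂ] W') j (k : Fin 3), (φ (b j) : sl4).1 0 k.succ = 0 := fun φ j k =>
    congrFun (φ (b j)).2 k
  have hX0 : ∀ φ j, X φ j 0 0 = 0 := by
    intro φ j
    simp [X, hbv]
  have hX1 : ∀ φ j (k : Fin 3), X φ j 0 k.succ = if j = k then 1 else 0 := by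
    intro φ j k
    simp [X, hbv, htop, Matrix.single_apply, (Fin.succ_ne_zero k).symm]
  have hXcomm : ∀ φ ∈ Z, ∀ i j, X φ i * X φ j = X φ j * X φ i := by
    rintro φ ⟨U, hU, hUφ⟩ i j
    have hc := mem_red4_iff.1 hU
    rw [hUφ] at hc
    have h := hc _ ⟨b i, rfl⟩ _ ⟨b j, rfl⟩
    change ((b i : sl4).1 + (φ (b i) : sl4).1) * ((b j : sl4).1 + (φ (b j) : sl4).1) =
      ((b j : sl4).1 + (φ (b j) : sl4).1) * ((b i : sl4).1 + (φ (b i) : sl4).1) at h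
    simp only [X, sub_mul, mul_sub, h, smul_mul_assoc, mul_smul_comm, one_mul, mul_one, smul_sub]
    rw [smul_comm]
    abel
  have hΓsymm : ∀ φ ∈ Z, ∀ i j k, Γ i j k φ = Γ j i k φ := by
    intro φ hφ i j k
    rw [← hXsucc, ← hXsucc]
    exact entry_symm_of_commute (hXcomm φ hφ) (hX0 φ) (hX1 φ) i j _
  let γ : StructIndex → Module.Dual ℂ (W →ₗ[ℂ] W') := fun l => Γ l.1.1 l.1.2.1 l.1.2.2
  have hvar : ∀ φ ∈ Z, ∀ i j k,
      MvPolynomial.eval (fun l => γ l φ) (structVar i j k) = X φ j i.succ k.succ := by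
    intro φ hφ i j k
    rw [structVar, MvPolynomial.eval_X, hXsucc]
    rcases le_total i j with h | h
    · simp only [γ, min_eq_left h, max_eq_right h]
    · simp only [γ, min_eq_right h, max_eq_left h]
      exact hΓsymm φ hφ j i k
  have hpoly : ∀ j a c, ∃ q : MvPolynomial StructIndex ℂ, ∀ φ ∈ Z,
      MvPolynomial.eval (fun l => γ l φ) q = X φ j a c := by
    intro j a c
    cases a using Fin.cases with
    | zero =>
      cases c using Fin.cases with
      | zero => exact ⟨0, fun φ _ => by rw [map_zero, hX0]⟩
      | succ k => exact ⟨if j = k then 1 else 0, fun φ _ => by rw [hX1]; split_ifs <;> simp⟩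
    | succ i =>
      cases c using Fin.cases with
      | succ k => exact ⟨structVar i j k, fun φ hφ => hvar φ hφ i j k⟩
      | zero =>
        -- The coefficient at another basis vector in the associativity relation.
        obtain ⟨j', hj⟩ := exists_ne j
        refine ⟨∑ m, structVar i j' m * structVar m j j' - ∑ m, structVar i j m * structVar m j' j',
          fun φ hφ => ?_⟩
        have h := entry_succ_of_commute (hXcomm φ hφ) (hX1 φ) j j' i j'
        rw [if_pos rfl, if_neg hj.symm, mul_one, mul_zero, zero_add] at h
        simp only [map_sub, map_sum, map_mul, hvar φ hφ]
        rw [← h]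
        ring
  have hgen : ∀ f : Module.Dual ℂ (W →ₗ[ℂ] W'), ∃ p : MvPolynomial StructIndex ℂ, ∀ φ ∈ Z,
      f φ = MvPolynomial.eval (fun l => γ l φ) p := by
    intro f
    choose q hq using hpoly
    let F : Fin 3 → Module.Dual ℂ (Matrix (Fin 4) (Fin 4) ℂ) := fun j =>
      f ∘ₗ LinearMap.smulRightₗ (b.coord j) ∘ₗ pW' ∘ₗ tracelessPart
    have hF : ∀ φ, f φ = ∑ j, F j (X φ j - Matrix.single 0 j.succ 1) := by
      intro φ
      have h1 : φ = ∑ j, (b.coord j).smulRight (φ (b j)) := by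
        refine b.ext fun i => ?_
        rw [LinearMap.sum_apply, Finset.sum_eq_single i]
        · simp
        · intro j _ hij
          simp [hij.symm]
        · simp
      conv_lhs => rw [h1, map_sum]
      refine Finset.sum_congr rfl fun j _ => ?_
      have h2 : tracelessPart (X φ j - Matrix.single 0 j.succ 1) = φ (b j) := by
        have h3 : X φ j - Matrix.single 0 j.succ 1 =
            (φ (b j) : sl4).1 - (φ (b j) : sl4).1 0 0 • 1 := by
          simp only [X, hbv]
          abel
        rw [h3, tracelessPart_sub_smul_one]
      simp only [F, LinearMap.comp_apply, h2]
      rw [Submodule.projectionOnto_apply_left hW'.symm]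
      rfl
    refine ⟨∑ j, ∑ a, ∑ c, MvPolynomial.C (F j (Matrix.single a c 1)) *
      (q j a c - MvPolynomial.C ((Matrix.single 0 j.succ 1 : Matrix (Fin 4) (Fin 4) ℂ) a c)),
      fun φ hφ => ?_⟩
    rw [hF, map_sum]
    refine Finset.sum_congr rfl fun j _ => ?_
    conv_lhs => rw [Matrix.matrix_eq_sum_single (X φ j - Matrix.single 0 j.succ 1)]
    simp only [map_sum]
    refine Finset.sum_congr rfl fun a _ => Finset.sum_congr rfl fun c _ => ?_
    rw [← mul_one ((X φ j - Matrix.single 0 j.succ 1 : Matrix (Fin 4) (Fin 4) ℂ) a c),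
      ← smul_eq_mul, ← Matrix.smul_single,
      map_smul, smul_eq_mul, mul_comm, Matrix.sub_apply, map_mul, map_sub, MvPolynomial.eval_C,
      MvPolynomial.eval_C, hq _ _ _ φ hφ]
  have hmem : ∀ p q r j, tracelessPart (lineMat p q r j) ∈ W' := fun p q r j =>
    LinearMap.mem_ker.2 (funext fun k => (topRow_tracelessPart _ k).trans rfl)
  let ψ : StructIndex → (W →ₗ[ℂ] W') := fun m =>
    b.constr ℂ fun j => ⟨_, hmem m.1.1 m.1.2.1 m.1.2.2 j⟩
  have hψb : ∀ m j, (ψ m (b j) : sl4) = tracelessPart (lineMat m.1.1 m.1.2.1 m.1.2.2 j) :=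
    fun m j => congrArg Subtype.val (b.constr_basis ℂ _ j)
  have hψ : ∀ m (t : ℂ), t • ψ m ∈ Z := by
    intro m t
    let N : Fin 3 → Matrix (Fin 4) (Fin 4) ℂ := fun j => t • lineMat m.1.1 m.1.2.1 m.1.2.2 j
    have hN : ∀ i j, N i 0 (Fin.succ j) = 0 := fun i j => by
      simp [N, lineMat_zero_left]
    refine ⟨spanGr (lineFrame N) (linearIndependent_lineFrame hN), mem_red4_iff.2
      (isCommuting_spanGr_lineFrame hN fun i j => lineMat_mul_comm _ _ _ i j t), ?_⟩
    rw [graph_eq_span _ b]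
    change Submodule.span ℂ (Set.range (lineFrame N)) = _
    congr 2
    funext j
    rw [LinearMap.smul_apply, Submodule.coe_smul, hψb, hb, lineFrame, lineFrame, Pi.zero_apply,
      add_zero, map_add, map_smul]
  have hγψ : ∀ l m, γ l (ψ m) =
      structConst m.1.1 m.1.2.1 m.1.2.2 l.1.1 l.1.2.1 l.1.2.2 := by
    intro l m
    have : γ l (ψ m) = D l.1.1 l.1.2.2 (ψ m (b l.1.2.1)) := rfl
    rw [this, hψb]
    change (entry _ _ - if _ then entry 0 0 else 0 : Module.Dual ℂ sl4) _ = _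
    rw [LinearMap.sub_apply]
    change (tracelessPart _).1 _ _ - _ = _
    rw [tracelessPart_val, Matrix.sub_apply, lineMat_succ, Matrix.smul_apply, Matrix.one_apply]
    split_ifs with h1 h2 h2
    · change _ - (tracelessPart _).1 0 0 = _
      rw [tracelessPart_val, Matrix.sub_apply, lineMat_zero_left]
      simp
    · exact absurd (Fin.succ_injective _ h1) h2
    · exact absurd (congrArg Fin.succ h2) h1
    · simp
  have hind : LinearIndependent ℂ fun l m => γ l (ψ m) := by
    refine Fintype.linearIndependent_iff.2 fun c hc => ?_
    have hsum : ∀ m : StructIndex, ∑ l : StructIndex, c l *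
        (structConst m.1.1 m.1.2.1 m.1.2.2 l.1.1 l.1.2.1 l.1.2.2 : ℂ) = 0 := by
      intro m
      have := congrFun hc m
      simpa only [Finset.sum_apply, Pi.smul_apply, smul_eq_mul, hγψ, Pi.zero_apply] using this
    have hdiag : ∀ m : StructIndex, (∀ l : StructIndex,
        structConst m.1.1 m.1.2.1 m.1.2.2 l.1.1 l.1.2.1 l.1.2.2 = if l = m then 1 else 0) →
        c m = 0 := by
      intro m hm
      have := hsum m
      simpa [hm] using this
    intro m
    rcases structConst_triangular m with hm | ⟨d, hdm, hd, hm⟩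
    · exact hdiag m hm
    · have h := hsum m
      simp only [hm, Nat.cast_add, mul_add, Finset.sum_add_distrib] at h
      simpa [hdiag d hd] using h
  refine not_isRegularLocalRing_of_lines rfl γ ψ hψ hind hgen
    (∑ m, structVar 0 0 m * structVar m 1 2 - ∑ m, structVar 0 1 m * structVar m 0 2) ?_ ?_
    (hreg W' hW')
  · intro h
    have h1 := congrArg (MvPolynomial.eval fun l : StructIndex =>
      if l.1 = (0, 0, 1) ∨ l.1 = (1, 1, 2) then (1 : ℂ) else 0) h
    simp [structVar, Fin.sum_univ_three] at h1
  · intro φ hφ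
    have h := entry_succ_of_commute (hXcomm φ hφ) (hX1 φ) 0 1 0 2
    rw [if_neg (by decide), if_neg (by decide), mul_zero, mul_zero, zero_add, zero_add] at h
    simp only [map_sub, map_sum, map_mul, hvar φ hφ]
    rw [h, sub_self]

theorem lineAlgebra_notMem_regularLocus (L : Gr 1 (Fin 4 → ℂ)) :
    lineAlgebra L ∉ regularLocus red4 := by
  intro h
  obtain ⟨g, hg⟩ := exists_map_vecEquiv_eq L firstLine
  have h1 := smul_mem_regularLocus g h
  rw [smul_lineAlgebra, hg] at h1
  exact not_isRegularPoint_firstLine h1.2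

theorem map_transposition_mem_red4_iff (W : Gr 3 sl4) :
    W.map transposition ∈ red4 ↔ W ∈ red4 :=
  ⟨fun h => by
    have := map_transposition_mem_red4 h
    rwa [show (W.map transposition).map transposition = W from
      Gr.map_symm_map transposition W] at this, map_transposition_mem_red4⟩

theorem hyperplaneAlgebra_notMem_regularLocus (L : Gr 3 (Fin 4 → ℂ)) :
    hyperplaneAlgebra L ∉ regularLocus red4 := by
  intro h
  obtain ⟨g, hg⟩ := exists_map_vecEquiv_eq L firstHyperplane
  have h1 := smul_mem_regularLocus g h
  rw [smul_hyperplaneAlgebra, hg, ← map_transposition_lineAlgebra] at h1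
  obtain ⟨h2, h3⟩ := h1
  have h4 : ((lineAlgebra firstLine).map transposition).map transposition ∈ regularLocus red4 :=
    ⟨_, h3.map transposition map_transposition_mem_red4_iff⟩
  rw [show ((lineAlgebra firstLine).map transposition).map transposition = lineAlgebra firstLine
    from Gr.map_symm_map transposition _] at h4
  exact not_isRegularPoint_firstLine h4.2

theorem singularLocus_red4 : singularLocus red4 = minimalOrbit ∪ dualMinimalOrbit := by
  ext W
  constructor
  · rintro ⟨hW, h⟩
    by_contra hn
    obtain ⟨h1, h2⟩ := not_or.1 hn
    exact h (mem_regularLocus hW h1 h2).2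
  · rintro (⟨L, rfl⟩ | ⟨L, rfl⟩)
    · exact ⟨lineAlgebra_mem_red4 L, fun h => lineAlgebra_notMem_regularLocus L ⟨_, h⟩⟩
    · exact ⟨hyperplaneAlgebra_mem_red4 L, fun h => hyperplaneAlgebra_notMem_regularLocus L ⟨_, h⟩⟩

end SingularPoints

end Reductions

end

theorem proposition22 :
    -- the singular locus is the disjoint union of the two minimal orbits
    Reductions.singularLocus Reductions.red4 =
      Reductions.minimalOrbit ∪ Reductions.dualMinimalOrbit ∧
    Disjoint Reductions.minimalOrbit Reductions.dualMinimalOrbit ∧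
    -- these are single orbits, equivariantly parametrized by `ℙ³` and by the dual `ℙ³`
    (∀ L, MulAction.orbit (GL (Fin 4) ℂ) (Reductions.lineAlgebra L) =
      Reductions.minimalOrbit) ∧
    Function.Injective Reductions.lineAlgebra ∧
    (∀ (g : GL (Fin 4) ℂ) L, g • Reductions.lineAlgebra L =
      Reductions.lineAlgebra (L.map (Reductions.vecEquiv g))) ∧
    (∀ L, MulAction.orbit (GL (Fin 4) ℂ) (Reductions.hyperplaneAlgebra L) =
      Reductions.dualMinimalOrbit) ∧
    Function.Injective Reductions.hyperplaneAlgebra ∧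
    (∀ (g : GL (Fin 4) ℂ) L, g • Reductions.hyperplaneAlgebra L =
      Reductions.hyperplaneAlgebra (L.map (Reductions.vecEquiv g))) ∧
    -- the variety is smooth along `O₆`
    Reductions.orbitO6 ⊆ Reductions.regularLocus Reductions.red4 ∧
    -- `O₆` lies in the closure of every orbit other than the two minimal ones
    (∀ W ∈ Reductions.red4, W ∉ Reductions.minimalOrbit → W ∉ Reductions.dualMinimalOrbit →
      Reductions.orbitO6 ⊆ closure (MulAction.orbit (GL (Fin 4) ℂ) W)) :=
  ⟨Reductions.singularLocus_red4, Reductions.disjoint_minimalOrbit, Reductions.orbit_lineAlgebra,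
    Reductions.lineAlgebra_injective, Reductions.smul_lineAlgebra,
    Reductions.orbit_hyperplaneAlgebra, Reductions.hyperplaneAlgebra_injective,
    Reductions.smul_hyperplaneAlgebra, Reductions.orbitO6_subset_regularLocus,
    fun _ hW h1 h2 =>
      let ⟨_, _, hx⟩ := Reductions.exists_smul_eq_chartPoint hW h1 h2
      Reductions.orbitO6_subset_closure_orbit hx⟩
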